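/- Let $m\ge 1$. There is a constant $c(m)<\infty$, depending only on $m$, such that the following holds. Let $M$ be an oriented compact smooth Riemannian manifold with (possibly empty) boundary, of dimension $2m$, and let $\omega=1+\omega_1+\dots+\omega_m$ be a smooth real mixed differential form on $M$, where $\omega_j$ has degree $2j$. Then $$K\text{-}\mathrm{cw}_2(M)\;\le\; c(m)\cdot \omega\text{-}\mathrm{cw}_2(M)\qquad\text{in }[0,\infty].$$ Here bundles $E$ over $M$ are smooth Hermitian vector bundles of finite rank $\mathrm{rk}(E)$ with metric connection; $R^E$ is the curvature and $\|R^E\|=\sup_{x\in M}\sup\{|R^E(X,Y)| : X,Y\in T_xM,\ |X|=|Y|=1\}$, with $|\cdot|$ the operator norm. Let $\mathrm{c}(E)=\det\bigl(1+\tfrac{i}{2\pi}R^E\bigr)=1+\mathrm{c}_1(E)+\dots+\mathrm{c}_m(E)$ be the Chern form and $\mathsf{ch}(E)=\mathrm{tr}\exp\bigl(\tfrac{i}{2\pi}R^E\bigr)$ the Chern character form. The bundle $E$ is boundary-adapted if over some neighborhood of $\partial M$ it is isomorphic to the trivial Hermitian bundle with trivial connection, and admissible if moreover $\int_M \mathrm{c}_{\gamma_1}(E)\wedge\dots\wedge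 \mathrm{c}_{\gamma_m}(E)\ne0$ for some $\gamma_1,\dots,\gamma_m\in\mathbb N_0$. Integrals of mixed forms are integrals of their parts of degree $2m$. Finally, $$K\text{-}\mathrm{cw}_2(M)=\frac1{\inf\{\|R^E\| : E\text{ admissible}\}},\qquad \omega\text{-}\mathrm{cw}_2(M)=\frac1{\inf\{\|R^E\| : E\text{ boundary-adapted},\ \int_M\omega\wedge[\mathsf{ch}(E)-\mathrm{rk}(E)]\neq0\}},$$ with $\inf\emptyset=\infty$, $1/\infty=0$ and $1/0=\infty$. -/

import Mathlib

open scoped Manifold ContDiff Topology ENNReal NNReal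

noncomputable section

namespace KCowaist

/-- The model vector space `ℝⁿ`. In Mathlib the tangent space at a point `x` of a manifold modelled
on the half space of `ℝⁿ` is this space, read in the preferred chart at `x`. -/
abbrev Model (n : ℕ) := EuclideanSpace ℝ (Fin n)

/-! ### Differential forms with values in a vector space -/

section Forms

variable {n k : ℕ} [NeZero n] {M : Type*} [TopologicalSpace M]
  [ChartedSpace (EuclideanHalfSpace n) M] [IsManifold (𝓡∂ n) ∞ M]
  {W : Type*} [NormedAddCommGroup W] [NormedSpace ℝ W]

variable (n k M W) in
/-- A (not necessarily smooth) `k`-form on `M` with values in `W`. -/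
abbrev DiffForm := ∀ x : M, TangentSpace (𝓡∂ n) x [⋀^Fin k]→L[ℝ] W

/-- The local expression of a `k`-form in the chart around `c`, that is, its pullback under the
inverse chart (meaningful on the target of the chart). -/
def DiffForm.inChart (η : DiffForm n k M W) (c : M) (y : Model n) : Model n [⋀^Fin k]→L[ℝ] W :=
  (η ((extChartAt (𝓡∂ n) c).symm y)).compContinuousLinearMap
    (tangentCoordChange (𝓡∂ n) c ((extChartAt (𝓡∂ n) c).symm y) ((extChartAt (𝓡∂ n) c).symm y))

/-- A form is smooth on the open set `U` if all its local expressions are smooth. -/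
def DiffForm.SmoothOn (η : DiffForm n k M W) (U : Set M) : Prop :=
  ∀ c : M, ContDiffOn ℝ ∞ (η.inChart c)
    ((extChartAt (𝓡∂ n) c).target ∩ (extChartAt (𝓡∂ n) c).symm ⁻¹' U)

/-- The exterior derivative of a form, computed at each point `x` in the preferred chart at `x`. -/
def DiffForm.d (η : DiffForm n k M W) : DiffForm n (k + 1) M W := fun x ↦
  extDerivWithin (η.inChart x) (Set.range (𝓡∂ n)) (extChartAt (𝓡∂ n) x x)

end Forms

/-! ### The exterior algebra of a cotangent space -/

/-- Complex-valued mixed forms at a point: the complex exterior algebra of the complexified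
cotangent space. The multiplication is the wedge product. -/
abbrev Ext (n : ℕ) := ExteriorAlgebra ℂ (Model n →L[ℝ] ℂ)

/-- The coordinate covector `dxᵃ`. -/
def dx {n : ℕ} (a : Fin n) : Model n →L[ℝ] ℂ :=
  Complex.ofRealCLM ∘L (EuclideanSpace.proj a : Model n →L[ℝ] ℝ)

/-- The element `(1 / k!) ∑_I f(e_{I₁}, …, e_{I_k}) dx^{I₁} ∧ ⋯ ∧ dx^{I_k}` of the exterior algebra
that corresponds to an alternating `k`-linear function `f`. -/
def toExt {n : ℕ} (k : ℕ) (f : (Fin k → Model n) → ℂ) : Ext n :=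
  ((k.factorial : ℂ))⁻¹ • ∑ I : Fin k → Fin n,
    f (fun l ↦ EuclideanSpace.single (I l) 1) • ExteriorAlgebra.ιMulti ℂ k (fun l ↦ dx (I l))

/-- The value of the degree `n` part of a mixed form on the frame `v₁, …, vₙ`, normalised by
`(φ₁ ∧ ⋯ ∧ φₙ)(v₁, …, vₙ) = det (φᵢ vⱼ)`. The parts of other degrees are discarded. -/
def topEval {n : ℕ} (v : Fin n → Model n) : Ext n →ₗ[ℂ] ℂ :=
  ExteriorAlgebra.liftAlternating (R := ℂ)
    (Pi.single n (Matrix.detRowAlternating.compLinearMap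
      ({ toFun := fun φ j ↦ φ (v j)
         map_add' := fun _ _ ↦ rfl
         map_smul' := fun _ _ ↦ rfl } : (Model n →L[ℝ] ℂ) →ₗ[ℂ] (Fin n → ℂ))))

/-! ### Orientations and integration -/

section Integration

variable {n : ℕ} [NeZero n] {M : Type*} [TopologicalSpace M]
  [ChartedSpace (EuclideanHalfSpace n) M] [IsManifold (𝓡∂ n) ∞ M]

/-- The coordinate frame `∂₁, …, ∂ₙ` at `x` of the chart around `c`. -/
def chartFrame (c x : M) (a : Fin n) : TangentSpace (𝓡∂ n) x :=
  tangentCoordChange (𝓡∂ n) c x x (EuclideanSpace.single a 1 : Model n)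

/-- The frame `v` is a positively oriented basis. -/
def IsPositive {V : Type*} [AddCommGroup V] [Module ℝ V]
    (o : Orientation ℝ V (Fin n)) (v : Fin n → V) : Prop :=
  ∃ b : Module.Basis (Fin n) ℝ V, ⇑b = v ∧ b.orientation = o

variable (n M) in
/-- An orientation of `M`: an orientation of each tangent space such that whether the coordinate
frame of a chart is positive is a locally constant property on the domain of that chart. -/
structure ManifoldOrientation where
  at' : ∀ x : M, Orientation ℝ (TangentSpace (𝓡∂ n) x) (Fin n)
  locallyConstant : ∀ c : M, ∀ x ∈ (chartAt (EuclideanHalfSpace n) c).source, ∀ᶠ x' in 𝓝 x,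
    (IsPositive (at' x') (chartFrame c x') ↔ IsPositive (at' x) (chartFrame c x))

open Classical in
/-- The sign of the coordinate frame at `x` of the chart around `c`. -/
def ManifoldOrientation.sign (o : ManifoldOrientation n M) (c x : M) : ℝ :=
  if IsPositive (o.at' x) (chartFrame c x) then 1 else -1

variable [CompactSpace M] [T2Space M]

variable (n M) in
/-- A smooth partition of unity on `M` subordinate to the domains of the charts. -/
def partitionOfUnity : SmoothPartitionOfUnity M (𝓡∂ n) M Set.univ :=
  (SmoothPartitionOfUnity.exists_isSubordinate_chartAt_source (𝓡∂ n) M).choose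

/-- The integral over an oriented manifold of (the degree `n` part of) a mixed form, computed in
charts by means of a partition of unity. For smooth forms it does not depend on that partition. -/
def integral (o : ManifoldOrientation n M) (η : M → Ext n) : ℂ :=
  ∑ᶠ c : M, ∫ y in (extChartAt (𝓡∂ n) c).target,
    let x := (extChartAt (𝓡∂ n) c).symm y
    ((partitionOfUnity n M c x * o.sign c x : ℝ) : ℂ) * topEval (chartFrame c x) (η x)

end Integration

/-! ### Hermitian vector bundles with connection -/

section Bundles

variable {n : ℕ} [NeZero n] {M : Type*} [TopologicalSpace M]
  [ChartedSpace (EuclideanHalfSpace n) M] [IsManifold (𝓡∂ n) ∞ M]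

/-- The endomorphisms of `ℂʳ` with its standard Hermitian structure, with the operator norm. -/
abbrev EndC (r : ℕ) := EuclideanSpace ℂ (Fin r) →L[ℂ] EuclideanSpace ℂ (Fin r)

variable (n M) in
/-- A smooth Hermitian vector bundle with metric connection over `M`, given in local unitary frames.

The bundle `core` is described by an open cover and transition functions: if a section is given
over the `i`-th open set by the coordinate vector `sᵢ`, then `sⱼ = coordChange i j · sᵢ`. The
transition functions are smooth and unitary, so that the standard Hermitian form of `ℂʳ` induces a
Hermitian metric on the bundle. The metric connection is described by its connection forms: skew-
Hermitian matrices `Aᵢ = conn i` of smooth 1-forms such that `(∇_X s)ᵢ = dsᵢ(X) + Aᵢ(X) sᵢ`. -/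
structure HermitianBundle where
  rank : ℕ
  ι : Type
  core : VectorBundleCore ℂ M (EuclideanSpace ℂ (Fin rank)) ι
  unitary_coordChange : ∀ i j, ∀ x ∈ core.baseSet i ∩ core.baseSet j,
    core.coordChange i j x ∈ unitary (EndC rank)
  smooth_coordChange : ∀ i j, ContMDiffOn (𝓡∂ n) 𝓘(ℝ, EndC rank) ∞ (core.coordChange i j)
    (core.baseSet i ∩ core.baseSet j)
  conn : ι → DiffForm n 1 M (EndC rank)
  smooth_conn : ∀ i, (conn i).SmoothOn (core.baseSet i)
  skew_conn : ∀ i, ∀ x ∈ core.baseSet i, ∀ X : TangentSpace (𝓡∂ n) x,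
    star (conn i x ![X]) = -conn i x ![X]
  conn_coordChange : ∀ i j, ∀ x ∈ core.baseSet i ∩ core.baseSet j,
    ∀ X : TangentSpace (𝓡∂ n) x,
      mvfderiv (𝓡∂ n) (core.coordChange i j) x X + conn j x ![X] * core.coordChange i j x
        = core.coordChange i j x * conn i x ![X]

namespace HermitianBundle

variable (E : HermitianBundle n M)

/-- The curvature `R(X, Y) = dAᵢ(X, Y) + Aᵢ(X) Aᵢ(Y) - Aᵢ(Y) Aᵢ(X)` in the `i`-th frame. -/
def localCurvature (i : E.ι) (x : M) (X Y : TangentSpace (𝓡∂ n) x) : EndC E.rank :=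
  (E.conn i).d x ![X, Y] + (E.conn i x ![X] * E.conn i x ![Y] - E.conn i x ![Y] * E.conn i x ![X])

/-- The curvature endomorphism `R(X, Y)` of the fibre at `x`, written in the preferred local unitary
frame at `x`. Another frame would give a unitarily conjugate endomorphism. -/
def curvature (x : M) (X Y : TangentSpace (𝓡∂ n) x) : EndC E.rank :=
  E.localCurvature (E.core.indexAt x) x X Y

/-- `‖Rᴱ‖`, the supremum of the operator norms of `R(X, Y)` over all unit vectors `X`, `Y` of the
Riemannian metric `g`. -/
def curvatureNorm (g : Bundle.ContMDiffRiemannianMetric (𝓡∂ n) ∞ (Model n)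
    (fun x : M ↦ TangentSpace (𝓡∂ n) x)) : ℝ≥0∞ :=
  ⨆ (x : M) (X : TangentSpace (𝓡∂ n) x) (Y : TangentSpace (𝓡∂ n) x)
    (_ : g.inner x X X = 1) (_ : g.inner x Y Y = 1), ‖E.curvature x X Y‖ₑ

/-- `E` is boundary-adapted: over an open neighbourhood `W` of the boundary it is isomorphic to the
trivial Hermitian bundle with trivial connection. The isomorphism from the trivial bundle is
given in the `i`-th frame by the unitary matrix function `h i`; it is compatible with the transition
functions and it is parallel. -/
def IsBoundaryAdapted : Prop :=
  ∃ (W : Set M) (h : E.ι → M → EndC E.rank),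
    IsOpen W ∧ (𝓡∂ n).boundary M ⊆ W ∧
    (∀ i, ContMDiffOn (𝓡∂ n) 𝓘(ℝ, EndC E.rank) ∞ (h i) (E.core.baseSet i ∩ W)) ∧
    (∀ i, ∀ x ∈ E.core.baseSet i ∩ W, h i x ∈ unitary (EndC E.rank)) ∧
    (∀ i j, ∀ x ∈ E.core.baseSet i ∩ E.core.baseSet j ∩ W,
      h j x = E.core.coordChange i j x * h i x) ∧
    (∀ i, ∀ x ∈ E.core.baseSet i ∩ W, ∀ X : TangentSpace (𝓡∂ n) x,
      mvfderiv (𝓡∂ n) (h i) x X + E.conn i x ![X] * h i x = 0)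

/-- The matrix of 2-forms at `x` that represents the curvature. -/
def curvatureMatrix (x : M) : Matrix (Fin E.rank) (Fin E.rank) (Ext n) :=
  Matrix.of fun a b ↦
    toExt 2 fun v : Fin 2 → Model n ↦ E.curvature x (v 0) (v 1) (EuclideanSpace.single b 1) a

/-- The total Chern form `c(E) = det (1 + (i / 2π) R)`. The determinant is given by the Leibniz
formula; the entries of the matrix are even forms, hence commute. -/
def totalChernForm (x : M) : Ext n :=
  ∑ σ : Equiv.Perm (Fin E.rank), (Equiv.Perm.sign σ : ℤ) • (List.ofFn fun a ↦
    (1 + (Complex.I / (2 * Real.pi)) • E.curvatureMatrix x) a (σ a)).prod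

/-- The `j`-th Chern form `c_j(E)`, the part of degree `2j` of the total Chern form. -/
def chernForm (j : ℕ) (x : M) : Ext n :=
  GradedRing.proj (fun d : ℕ ↦ ⋀[ℂ]^d (Model n →L[ℝ] ℂ)) (2 * j) (E.totalChernForm x)

/-- The form `ch_j(E) = (1 / j!) tr ((i / 2π) R)ʲ`, the part of degree `2j` of the Chern character
form `tr exp ((i / 2π) R)`. -/
def chernCharacter (j : ℕ) (x : M) : Ext n :=
  ((j.factorial : ℂ))⁻¹ • (((Complex.I / (2 * Real.pi)) • E.curvatureMatrix x) ^ j).trace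

end HermitianBundle

end Bundles

/-! ### The two cowaists of a manifold of dimension `2m` -/

section Cowaist

variable {m : ℕ} [NeZero m] {M : Type*} [TopologicalSpace M]
  [ChartedSpace (EuclideanHalfSpace (2 * m)) M] [IsManifold (𝓡∂ (2 * m)) ∞ M]
  [CompactSpace M] [T2Space M]

/-- `E` is admissible: it is boundary-adapted and has a nonzero Chern number
`∫_M c_{γ₁}(E) ∧ ⋯ ∧ c_{γ_m}(E)`. -/
def HermitianBundle.IsAdmissible (E : HermitianBundle (2 * m) M)
    (o : ManifoldOrientation (2 * m) M) : Prop :=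
  E.IsBoundaryAdapted ∧
    ∃ γ : Fin m → ℕ, integral o (fun x ↦ (List.ofFn fun j ↦ E.chernForm (γ j) x).prod) ≠ 0

/-- The mixed form `1 + w₁ + ⋯ + w_m`. -/
def mixedForm (w : ∀ j : ℕ, DiffForm (2 * m) (2 * j) M ℝ) (x : M) : Ext (2 * m) :=
  1 + ∑ j ∈ Finset.Icc 1 m, toExt (2 * j) (fun v : Fin (2 * j) → Model (2 * m) ↦ (w j x v : ℂ))

/-- The `K`-cowaist of the oriented compact Riemannian manifold `(M, g)`. -/
def kCowaist (g : Bundle.ContMDiffRiemannianMetric (𝓡∂ (2 * m)) ∞ (Model (2 * m))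
    (fun x : M ↦ TangentSpace (𝓡∂ (2 * m)) x)) (o : ManifoldOrientation (2 * m) M) : ℝ≥0∞ :=
  (⨅ (E : HermitianBundle (2 * m) M) (_ : E.IsAdmissible o), E.curvatureNorm g)⁻¹

/-- The `ω`-cowaist of the oriented compact Riemannian manifold `(M, g)`, for the mixed form
`ω = 1 + w₁ + ⋯ + w_m`. -/
def omegaCowaist (g : Bundle.ContMDiffRiemannianMetric (𝓡∂ (2 * m)) ∞ (Model (2 * m))
    (fun x : M ↦ TangentSpace (𝓡∂ (2 * m)) x)) (o : ManifoldOrientation (2 * m) M)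
    (w : ∀ j : ℕ, DiffForm (2 * m) (2 * j) M ℝ) : ℝ≥0∞ :=
  (⨅ (E : HermitianBundle (2 * m) M)
    (_ : E.IsBoundaryAdapted ∧ integral o (fun x ↦ mixedForm w x *
      (∑ j ∈ Finset.range (m + 1), E.chernCharacter j x - (E.rank : Ext (2 * m)))) ≠ 0),
    E.curvatureNorm g)⁻¹

end Cowaist

end KCowaist

end

/-! Let `E` have a nonzero Chern number. Newton's identities make the Chern forms polynomials in the
components ch_j, j ≥ 1, of the Chern character form (`exists_chernForm`). Hence some product ch_{J₁}
∧ ⋯ ∧ ch_{J_s} with all J_i ≥ 1 has nonzero integral. By degree ∑ J_i = m, so s ≤ m, and wedging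
this top-degree product with ω = 1 + ⋯ changes nothing. It remains to detect such a product by the
Chern character of a single bundle built from `E` with controlled curvature.

The Adams operation ψ^k multiplies ch_j by k^j. So the Chern character of ∏ ψ^{k_i+1} E is ∏ ∑_j
(k_i+1)^j ch_j, a polynomial in the numbers k_i+1 whose coefficients are the products ch_{J₁} ⋯
ch_{J_s}. If ω pairs to zero with these forms, their rank part removed, for all k_i+1 in {1, …,
m+1}, then every coefficient with J ≠ 0 pairs to zero (`coeff_eq_zero_of_sum_prod_pow`,
`map_prod_eq_zero_of_vandermonde`), a contradiction.

The product of Adams operations is only a virtual bundle; `exists_realization` replaces it by a real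
combination of honest ones. Let σ be a product of disjoint cycles of lengths k_i+1, permuting the
factors of a tensor power of `E`. Then tr(σ g^{⊗}) = ∏ tr(g^{k_i+1}), and the same holds for σ⁻¹.
The Hermitian operator σ + σ⁻¹ commutes with the structure group, so its eigenspaces form parallel
subbundles F_t. Inserting the exponential of the curvature for g gives ∑ t ch(F_t) = 2 ∏
ch(ψ^{k_i+1} E). Thus some F_t pairs nontrivially with ω. Its curvature is a compression of ∑ 1 ⊗ ⋯
⊗ R ⊗ ⋯ ⊗ 1, of norm at most ∑ (k_i+1) ‖R‖ ≤ m(m+1) ‖R‖.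

Two technical points run through the proof. Forms of degree two are central, so curvature matrices
are nilpotent matrices over a commutative ring and all exponentials are finite sums. And the
integral is additive only on integrable forms, so Chern character forms must be shown continuous,
although the curvature is written in a frame and a chart that may jump from point to point; this is
where gauge covariance and chart independence enter. -/

noncomputable section

namespace KCowaist

/-! ### Tensor powers of matrices -/

section Tensor

open Matrix

variable {ι n : Type*} [Fintype ι] [DecidableEq ι] [Fintype n] [DecidableEq n]
variable {R : Type*} [CommRing R]

/-- The tensor product of a family of square matrices, as a matrix indexed by multi-indices. -/
def tens (A : ι → Matrix n n R) : Matrix (ι → n) (ι → n) R :=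
  Matrix.of fun f g ↦ ∏ l, A l (f l) (g l)

omit [DecidableEq ι] [Fintype n] [DecidableEq n] in
lemma tens_apply (A : ι → Matrix n n R) (f g : ι → n) : tens A f g = ∏ l, A l (f l) (g l) := rfl

omit [DecidableEq n] in
lemma tens_mul (A B : ι → Matrix n n R) : tens A * tens B = tens (A * B) := by
  ext f g
  simp only [Matrix.mul_apply, tens_apply, Pi.mul_apply]
  rw [Finset.prod_univ_sum, Fintype.piFinset_univ]
  simp [Finset.prod_mul_distrib]

omit [DecidableEq ι] [Fintype n] in
lemma tens_one : tens (1 : ι → Matrix n n R) = 1 := by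
  ext f g
  simp only [tens_apply, Pi.one_apply, Matrix.one_apply, funext_iff]
  rw [Finset.prod_ite_zero]
  simp

omit [DecidableEq ι] [Fintype n] [DecidableEq n] in
lemma tens_conjTranspose [StarRing R] (A : ι → Matrix n n R) :
    (tens A)ᴴ = tens fun l ↦ (A l)ᴴ := by
  ext f g
  simp [tens_apply, Matrix.conjTranspose_apply]

/-- The endomorphism `1 ⊗ ⋯ ⊗ x ⊗ ⋯ ⊗ 1` with `x` in the slot `l`, as an algebra homomorphism. -/
def slot (l : ι) : Matrix n n R →ₐ[R] Matrix (ι → n) (ι → n) R where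
  toFun x := tens (Pi.mulSingle l x)
  map_one' := by simp [tens_one]
  map_mul' x y := by rw [tens_mul, Pi.mulSingle_mul]
  map_zero' := by
    ext f g
    simpa [tens_apply] using Finset.prod_eq_zero (Finset.mem_univ l) (by simp)
  map_add' x y := by
    ext f g
    simp only [tens_apply, Matrix.add_apply]
    rw [← Finset.mul_prod_erase _ _ (Finset.mem_univ l),
      ← Finset.mul_prod_erase _ _ (Finset.mem_univ l),
      ← Finset.mul_prod_erase _ _ (Finset.mem_univ l)]
    simp only [Pi.mulSingle_eq_same, Matrix.add_apply, add_mul]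
    congr 1 <;> congr 1 <;> refine Finset.prod_congr rfl fun k hk ↦ ?_ <;>
      simp [Pi.mulSingle_eq_of_ne (Finset.ne_of_mem_erase hk)]
  commutes' r := by
    ext f g
    simp only [tens_apply, Matrix.algebraMap_eq_diagonal]
    rw [← Finset.mul_prod_erase _ _ (Finset.mem_univ l)]
    have : ∏ k ∈ Finset.univ.erase l,
        (Pi.mulSingle l (diagonal (algebraMap (n → R) (n → R) (algebraMap R (n → R) r))) :
          ι → Matrix n n R) k (f k) (g k)
        = ∏ k ∈ Finset.univ.erase l, (1 : Matrix n n R) (f k) (g k) :=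
      Finset.prod_congr rfl fun k hk ↦ by
        simp [Pi.mulSingle_eq_of_ne (Finset.ne_of_mem_erase hk)]
    simp only [Algebra.algebraMap_self, RingHom.id_apply] at this
    rw [this]
    by_cases h : f = g
    · subst h; simp
    · obtain ⟨k, hk⟩ := Function.ne_iff.1 h
      rw [diagonal_apply_ne _ h]
      by_cases hkl : k = l
      · subst hkl; simp [diagonal_apply_ne _ hk]
      · rw [Finset.prod_eq_zero (Finset.mem_erase.2 ⟨hkl, Finset.mem_univ k⟩), mul_zero]
        simp [hk]

lemma slot_apply (l : ι) (x : Matrix n n R) : slot l x = tens (Pi.mulSingle l x) := rfl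

lemma slot_apply_apply (l : ι) (x : Matrix n n R) (f g : ι → n) :
    slot l x f g = x (f l) (g l) * ∏ k ∈ Finset.univ.erase l, (1 : Matrix n n R) (f k) (g k) := by
  rw [slot_apply, tens_apply, ← Finset.mul_prod_erase _ _ (Finset.mem_univ l)]
  congr 1
  · simp
  · exact Finset.prod_congr rfl fun k hk ↦ by
      simp [Pi.mulSingle_eq_of_ne (Finset.ne_of_mem_erase hk)]

lemma slot_commute {k l : ι} (h : k ≠ l) (x y : Matrix n n R) :
    Commute (slot k x) (slot l y) := by
  have : (Pi.mulSingle k x * Pi.mulSingle l y : ι → Matrix n n R)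
      = Pi.mulSingle l y * Pi.mulSingle k x :=
    (Pi.mulSingle_commute (f := fun _ : ι ↦ Matrix n n R) h x y).eq
  simp only [Commute, SemiconjBy, slot_apply, tens_mul, this]

lemma slot_conjTranspose [StarRing R] (l : ι) (x : Matrix n n R) :
    (slot l x)ᴴ = slot l xᴴ := by
  rw [slot_apply, slot_apply, tens_conjTranspose]
  congr 1
  ext1 k
  by_cases h : k = l
  · subst h; simp
  · simp [Pi.mulSingle_eq_of_ne h]

/-- The derivation `∑ₗ 1 ⊗ ⋯ ⊗ x ⊗ ⋯ ⊗ 1` on the tensor power. -/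
def tensDer (ι : Type*) [Fintype ι] [DecidableEq ι] : Matrix n n R →ₗ[R] Matrix (ι → n) (ι → n) R :=
  ∑ l : ι, (slot l).toLinearMap

lemma tensDer_apply (x : Matrix n n R) : tensDer ι x = ∑ l : ι, slot l x := by
  simp [tensDer]

lemma tensDer_conjTranspose [StarRing R] (x : Matrix n n R) :
    (tensDer ι x)ᴴ = tensDer ι xᴴ := by
  simp [tensDer_apply, Matrix.conjTranspose_sum, slot_conjTranspose]

/-- Operators in different slots commute, so only the diagonal terms of the double sum survive. This
is what makes the curvature of a tensor power the derivation applied to the curvature. -/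
lemma tensDer_lie (x y : Matrix n n R) :
    tensDer ι (x * y - y * x) = tensDer ι x * tensDer ι y - tensDer ι y * tensDer ι x := by
  simp only [tensDer_apply, Finset.sum_mul_sum]
  rw [Finset.sum_comm (f := fun i j ↦ slot i y * slot j x), ← Finset.sum_sub_distrib]
  refine Finset.sum_congr rfl fun l _ ↦ ?_
  rw [← Finset.sum_sub_distrib, Finset.sum_eq_single l]
  · simp
  · intro k _ hk
    rw [(slot_commute hk.symm x y).eq, sub_self]
  · simp

lemma prod_slot (A : ι → Matrix n n R) (s : Finset ι)
    (hc : (s : Set ι).Pairwise (Function.onFun Commute fun l ↦ slot l (A l))) :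
    s.noncommProd (fun l ↦ slot l (A l)) hc
      = tens fun l ↦ if l ∈ s then A l else 1 := by
  induction s using Finset.induction_on with
  | empty =>
    rw [Finset.noncommProd_empty]
    exact tens_one.symm
  | insert a s ha ih =>
    rw [Finset.noncommProd_insert_of_notMem _ _ _ _ ha, ih, slot_apply,
      tens_mul]
    congr 1
    ext1 l
    by_cases h : l = a
    · subst h; simp [ha]
    · simp [h]

lemma exp_sum_of_commute {A κ : Type*} [Ring A] [Module ℚ A] [SMulCommClass ℚ A A]
    [IsScalarTower ℚ A A] (s : Finset κ) (a : κ → A)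
    (hc : (s : Set κ).Pairwise fun i j ↦ Commute (a i) (a j))
    (hn : ∀ i ∈ s, IsNilpotent (a i)) :
    IsNilpotent (∑ i ∈ s, a i) ∧ ∀ h, IsNilpotent.exp (∑ i ∈ s, a i)
      = s.noncommProd (fun i ↦ IsNilpotent.exp (a i)) h := by
  classical
  induction s using Finset.induction_on with
  | empty => simp
  | insert k s hk ih =>
    rw [Finset.coe_insert] at hc
    obtain ⟨ih1, ih2⟩ := ih (hc.mono (Set.subset_insert _ _))
      fun i hi ↦ hn i (Finset.mem_insert_of_mem hi)
    have hcs : Commute (a k) (∑ i ∈ s, a i) := Commute.sum_right _ _ _ fun i hi ↦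
      hc (Set.mem_insert _ _) (Set.mem_insert_of_mem _ hi) (by rintro rfl; exact hk hi)
    have hnk := hn k (Finset.mem_insert_self _ _)
    rw [Finset.sum_insert hk]
    refine ⟨hcs.isNilpotent_add hnk ih1, fun h ↦ ?_⟩
    rw [IsNilpotent.exp_add_of_commute hcs hnk ih1, Finset.noncommProd_insert_of_notMem _ _ _ _ hk,
      ih2]

/-- The slots commute, so the exponential of the sum is the product of the exponentials, one in each
slot. It passes from the infinitesimal action, which carries the curvature, to the group action,
whose traces can be computed. -/
lemma exp_tensDer [Algebra ℚ R] {x : Matrix n n R} (hx : IsNilpotent x) :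
    IsNilpotent (tensDer ι x) ∧
      IsNilpotent.exp (tensDer ι x) = tens fun _ : ι ↦ IsNilpotent.exp x := by
  have h := exp_sum_of_commute (Finset.univ : Finset ι) (fun l ↦ slot l x)
    (fun i _ j _ hij ↦ slot_commute hij x x) (fun l _ ↦ hx.map (slot l))
  rw [tensDer_apply]
  refine ⟨h.1, ?_⟩
  have he : ∀ l : ι, IsNilpotent.exp (slot l x) = slot l (IsNilpotent.exp x) := fun l ↦
    (IsNilpotent.map_exp hx (slot l)).symm
  have hf : (fun l : ι ↦ IsNilpotent.exp (slot l x)) = fun l ↦ slot l (IsNilpotent.exp x) :=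
    funext he
  have h2 := h.2
  rw [hf] at h2
  have hc : ((Finset.univ : Finset ι) : Set ι).Pairwise
      (Function.onFun Commute fun l ↦ slot l (IsNilpotent.exp x)) :=
    fun i _ j _ hij ↦ slot_commute hij _ _
  refine (h2 hc).trans ((prod_slot (fun _ : ι ↦ IsNilpotent.exp x) _ hc).trans ?_)
  simp

omit [Fintype ι] [DecidableEq ι] [Fintype n] [DecidableEq n] in
variable (n R) in
/-- The permutation of the tensor factors as a matrix. -/
def permTens [DecidableEq (ι → n)] (σ : Equiv.Perm ι) : Matrix (ι → n) (ι → n) R :=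
  Matrix.of fun f g ↦ if g = f ∘ σ then 1 else 0

/-- Consequently permutations of the factors commute with both actions of a single matrix on the
tensor power, and so do their spectral projections. -/
lemma permTens_mul (σ : Equiv.Perm ι) (A : ι → Matrix n n R) :
    permTens n R σ * tens A = tens (A ∘ σ.symm) * permTens n R σ := by
  ext f g
  simp only [permTens, Matrix.mul_apply, Matrix.of_apply, ite_mul, one_mul, zero_mul,
    Finset.sum_ite_eq', Finset.mem_univ, if_true, mul_ite, mul_one, mul_zero]
  have : ∀ x : ι → n, g = x ∘ σ ↔ x = g ∘ σ.symm := fun x ↦ by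
    rw [Equiv.eq_comp_symm, eq_comm]
  simp only [this, Finset.sum_ite_eq', Finset.mem_univ, if_true, tens_apply]
  rw [← Equiv.prod_comp σ (fun l ↦ (A ∘ σ.symm) l (f l) ((g ∘ σ.symm) l))]
  simp

lemma permTens_commute_tens (σ : Equiv.Perm ι) (a : Matrix n n R) :
    Commute (permTens n R σ) (tens fun _ ↦ a) :=
  permTens_mul σ _

lemma permTens_commute_tensDer (σ : Equiv.Perm ι) (x : Matrix n n R) :
    Commute (permTens n R σ) (tensDer ι x) := by
  simp only [Commute, SemiconjBy, tensDer_apply, Finset.mul_sum, Finset.sum_mul]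
  rw [← Equiv.sum_comp σ (fun l ↦ slot l x * permTens n R σ)]
  refine Finset.sum_congr rfl fun l _ ↦ ?_
  rw [slot_apply, permTens_mul, slot_apply]
  congr 2
  ext1 k
  by_cases h : k = σ l
  · subst h; simp
  · rw [Pi.mulSingle_eq_of_ne h, Function.comp_apply, Pi.mulSingle_eq_of_ne]
    rintro h'
    exact h (by rw [← h', Equiv.apply_symm_apply])

-- It makes σ + σ⁻¹ Hermitian, whereas σ itself is only unitary.
omit [DecidableEq ι] [Fintype n] in
lemma permTens_conjTranspose [StarRing R] (σ : Equiv.Perm ι) :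
    (permTens n R σ)ᴴ = permTens n R σ⁻¹ := by
  ext f g
  have : f = g ∘ σ ↔ g = f ∘ ⇑σ⁻¹ := by
    rw [Equiv.Perm.inv_def, Equiv.eq_comp_symm, eq_comm]
  simp only [permTens, Matrix.conjTranspose_apply, Matrix.of_apply, this]
  split_ifs <;> simp

lemma trace_permTens_mul (σ : Equiv.Perm ι) (a : Matrix n n R) :
    (permTens n R σ * tens fun _ ↦ a).trace = ∑ f : ι → n, ∏ l, a (f (σ l)) (f l) := by
  simp [Matrix.trace, permTens, Matrix.mul_apply, tens_apply]

/-- Sum over cyclic paths. -/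
lemma sum_prod_castSucc (a : Matrix n n R) (k : ℕ) (φ : n → n → R) :
    ∑ f : Fin (k + 1) → n, (∏ l : Fin k, a (f l.castSucc) (f l.succ)) * φ (f 0) (f (Fin.last k))
      = ∑ i, ∑ j, (a ^ k) i j * φ i j := by
  induction k generalizing φ with
  | zero =>
    rw [← Equiv.sum_comp (Equiv.funUnique (Fin 1) n).symm]
    simp [Matrix.one_apply]
  | succ k ih =>
    rw [← Equiv.sum_comp (Fin.snocEquiv fun _ : Fin (k + 2) ↦ n), Fintype.sum_prod_type_right]
    have := fun j : n ↦ ih fun i i' ↦ a i' j * φ i j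
    simp only [Fin.snocEquiv, Equiv.coe_fn_mk]
    calc _ = ∑ f : Fin (k + 1) → n, ∑ j : n, (∏ l : Fin k, a (f l.castSucc) (f l.succ)) *
            (a (f (Fin.last k)) j * φ (f 0) j) := by
          refine Finset.sum_congr rfl fun f _ ↦ Finset.sum_congr rfl fun j _ ↦ ?_
          rw [Fin.prod_univ_castSucc]
          have h0 : (Fin.snoc f j : Fin (k + 2) → n) 0 = f 0 :=
            Fin.snoc_castSucc (α := fun _ ↦ n) (i := 0) ..
          simp only [Fin.succ_castSucc, Fin.snoc_castSucc, Fin.succ_last, Fin.snoc_last, h0]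
          ring
      _ = ∑ j, ∑ i, ∑ i', (a ^ k) i i' * (a i' j * φ i j) := by
          rw [Finset.sum_comm]
          exact Finset.sum_congr rfl fun j _ ↦ this j
      _ = _ := by
          rw [Finset.sum_comm]
          refine Finset.sum_congr rfl fun i _ ↦ Finset.sum_congr rfl fun j _ ↦ ?_
          rw [pow_succ, Matrix.mul_apply, Finset.sum_mul]
          exact Finset.sum_congr rfl fun _ _ ↦ by ring

lemma sum_prod_finRotate (a : Matrix n n R) (k : ℕ) :
    ∑ f : Fin (k + 1) → n, ∏ l, a (f l) (f (finRotate _ l)) = (a ^ (k + 1)).trace := by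
  -- The choice φ i j = a j i is the edge that closes the path into a cycle.
  have := sum_prod_castSucc a k fun i j ↦ a j i
  rw [pow_succ]
  simp only [Matrix.trace, Matrix.diag, Matrix.mul_apply]
  rw [← this]
  refine Finset.sum_congr rfl fun f _ ↦ ?_
  rw [Fin.prod_univ_castSucc]
  simp

omit [DecidableEq n] in
/-- A sum over multi-indices on a disjoint union of a product over its parts. -/
lemma sum_prod_sigma {κ : Type*} [Fintype κ] [DecidableEq κ] {α : κ → Type*} [∀ i, Fintype (α i)]
    [∀ i, DecidableEq (α i)] (φ : ∀ i, (α i → n) → R) :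
    ∑ f : (Σ i, α i) → n, ∏ i, φ i (fun l ↦ f ⟨i, l⟩) = ∏ i, ∑ f : α i → n, φ i f := by
  rw [Finset.prod_univ_sum, Fintype.piFinset_univ]
  exact Fintype.sum_equiv (Equiv.piCurry fun _ _ ↦ n) _ _ fun _ ↦ rfl

variable {κ : Type*} [Fintype κ] [DecidableEq κ]

/-- A product of disjoint cycles of lengths `k i + 1`. -/
def cycles (k : κ → ℕ) : Equiv.Perm (Σ i, Fin (k i + 1)) :=
  Equiv.Perm.sigmaCongrRight fun i ↦ finRotate (k i + 1)

omit [Fintype κ] [DecidableEq κ] in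
lemma cycles_apply (k : κ → ℕ) (i : κ) (l : Fin (k i + 1)) :
    cycles k ⟨i, l⟩ = ⟨i, finRotate _ l⟩ := rfl

/-- The sum over multi-indices factors over the cycles of the permutation, and a closed path of
length k_i + 1 contributes tr(a^{k_i+1}). -/
lemma trace_permTens_cycles_inv (k : κ → ℕ) (a : Matrix n n R) :
    (permTens n R (cycles k)⁻¹ * tens fun _ ↦ a).trace = ∏ i, (a ^ (k i + 1)).trace := by
  rw [trace_permTens_mul]
  calc _ = ∑ f : (Σ i, Fin (k i + 1)) → n, ∏ i, ∏ l, a (f ⟨i, l⟩) (f ⟨i, finRotate _ l⟩) := by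
        refine Finset.sum_congr rfl fun f _ ↦ ?_
        rw [← Equiv.prod_comp (cycles k), Fintype.prod_sigma]
        simp only [← cycles_apply, Equiv.Perm.inv_def, Equiv.symm_apply_apply]
    _ = _ := by
        rw [sum_prod_sigma (fun i (f : Fin (k i + 1) → n) ↦ ∏ l, a (f l) (f (finRotate _ l)))]
        simp only [sum_prod_finRotate]

/-- The cycles are now traversed in the opposite direction, which replaces a by its transpose and
leaves the traces unchanged. -/
lemma trace_permTens_cycles (k : κ → ℕ) (a : Matrix n n R) :
    (permTens n R (cycles k) * tens fun _ ↦ a).trace = ∏ i, (a ^ (k i + 1)).trace := by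
  rw [trace_permTens_mul]
  calc _ = ∑ f : (Σ i, Fin (k i + 1)) → n, ∏ i, ∏ l, aᵀ (f ⟨i, l⟩) (f ⟨i, finRotate _ l⟩) := by
        refine Finset.sum_congr rfl fun f _ ↦ ?_
        rw [Fintype.prod_sigma]
        simp [cycles_apply]
    _ = _ := by
        rw [sum_prod_sigma (fun i (f : Fin (k i + 1) → n) ↦ ∏ l, aᵀ (f l) (f (finRotate _ l)))]
        simp only [sum_prod_finRotate, ← Matrix.transpose_pow, Matrix.trace_transpose]

end Tensor

/-! ### Spectral projections and isometries -/

section Spectral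

open Matrix

/-- A Hermitian matrix is a linear combination of projections `J Jᴴ` with isometries `J`, and these
projections commute with everything that commutes with the matrix. -/
lemma exists_isometries {N : Type*} [Fintype N] [DecidableEq N] {H : Matrix N N ℂ}
    (hH : H.IsHermitian) :
    ∃ (Λ : Finset ℝ) (s : ℝ → ℕ) (J : ∀ t, Matrix N (Fin (s t)) ℂ),
      (∀ t, (J t)ᴴ * J t = 1) ∧ (∀ t X, Commute H X → Commute (J t * (J t)ᴴ) X) ∧
      H = ∑ t ∈ Λ, (t : ℂ) • (J t * (J t)ᴴ) := by
  classical
  set U : Matrix N N ℂ := (hH.eigenvectorUnitary : Matrix N N ℂ) with hU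
  have hU1 : Uᴴ * U = 1 := by
    simpa [hU, Matrix.star_eq_conjTranspose] using Unitary.coe_star_mul_self hH.eigenvectorUnitary
  have hU2 : U * Uᴴ = 1 := by
    simpa [hU, Matrix.star_eq_conjTranspose] using Unitary.coe_mul_star_self hH.eigenvectorUnitary
  set ev := hH.eigenvalues with hev
  have hs : H = U * diagonal (fun i ↦ (ev i : ℂ)) * Uᴴ := by
    have := hH.spectral_theorem
    rwa [Unitary.conjStarAlgAut_apply] at this
  -- The columns of `J t` are the eigenvectors for the eigenvalue t. If t is not an eigenvalue there
  -- are none, so the isometry condition holds for every real t.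
  let e : ∀ t : ℝ, Fin (Fintype.card {i // ev i = t}) ≃ {i // ev i = t} :=
    fun t ↦ (Fintype.equivFin _).symm
  let J : ∀ t : ℝ, Matrix N (Fin (Fintype.card {i // ev i = t})) ℂ :=
    fun t ↦ U.submatrix id fun a ↦ (e t a : N)
  have hP : ∀ t, J t * (J t)ᴴ = U * diagonal (fun i ↦ if ev i = t then (1 : ℂ) else 0) * Uᴴ := by
    intro t
    ext a b
    rw [Matrix.mul_apply, Matrix.mul_apply]
    simp only [mul_diagonal, conjTranspose_apply, J, submatrix_apply, id]
    rw [(e t).sum_comp (fun i : {i // ev i = t} ↦ U a i * star (U b i)),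
      ← Finset.sum_subtype (Finset.univ.filter fun i ↦ ev i = t) (by simp)
        (fun i ↦ U a i * star (U b i)), Finset.sum_filter]
    exact Finset.sum_congr rfl fun i _ ↦ by split_ifs <;> simp
  refine ⟨Finset.univ.image ev, _, J, fun t ↦ ?_, fun t X hX ↦ ?_, ?_⟩
  · ext a b
    have : ((J t)ᴴ * J t) a b = (Uᴴ * U) (e t a) (e t b) := rfl
    rw [this, hU1, Matrix.one_apply, Matrix.one_apply]
    simp [Subtype.ext_iff.symm]
  · rw [hP]
    set D := diagonal (fun i ↦ (ev i : ℂ))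
    set Q := diagonal (fun i ↦ if ev i = t then (1 : ℂ) else 0)
    set Y := Uᴴ * X * U with hY
    have hXY : X = U * Y * Uᴴ := by
      rw [hY]; simp only [← Matrix.mul_assoc, hU2, Matrix.one_mul]
      rw [Matrix.mul_assoc, hU2, Matrix.mul_one]
    have hDY : D * Y = Y * D := by
      have h1 : Uᴴ * H * U = D := by
        rw [hs]; simp only [← Matrix.mul_assoc, hU1, Matrix.one_mul]
        rw [Matrix.mul_assoc, hU1, Matrix.mul_one]
      calc D * Y = Uᴴ * H * (U * Uᴴ) * X * U := by rw [← h1, hY]; simp only [Matrix.mul_assoc]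
        _ = Uᴴ * (H * X) * U := by rw [hU2]; simp only [Matrix.mul_assoc, Matrix.one_mul]
        _ = Uᴴ * (X * (U * Uᴴ) * H) * U := by rw [hX.eq, hU2, Matrix.mul_one]
        _ = Y * D := by rw [← h1, hY]; simp only [Matrix.mul_assoc]
    -- Commuting with D forces the entries of Y between different eigenvalues to vanish, and
    -- therefore Y commutes with every function of D.
    have hQY : Q * Y = Y * Q := by
      ext a b
      have h := congr_fun (congr_fun hDY a) b
      simp only [D, Q, diagonal_mul, mul_diagonal] at h ⊢
      by_cases hab : ev a = ev b
      · rw [hab]; ring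
      · have : Y a b = 0 := by
          have : ((ev a : ℂ) - ev b) * Y a b = 0 := by linear_combination h
          refine (mul_eq_zero.1 this).resolve_left fun h0 ↦ hab ?_
          exact_mod_cast sub_eq_zero.1 h0
        rw [this]; ring
    change U * Q * Uᴴ * X = X * (U * Q * Uᴴ)
    calc U * Q * Uᴴ * X = U * Q * (Uᴴ * U) * Y * Uᴴ := by
          rw [hXY]; simp only [Matrix.mul_assoc]
      _ = U * (Q * Y) * Uᴴ := by rw [hU1]; simp only [Matrix.mul_assoc, Matrix.one_mul]
      _ = U * Y * (Uᴴ * U) * Q * Uᴴ := by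
          rw [hQY, hU1]; simp only [Matrix.mul_assoc, Matrix.one_mul]
      _ = X * (U * Q * Uᴴ) := by rw [hXY]; simp only [Matrix.mul_assoc]
  · simp only [hP]
    conv_lhs => rw [hs]
    simp only [← Matrix.smul_mul, ← Matrix.sum_mul]
    congr 1
    ext a b
    simp [Matrix.sum_apply, mul_comm]

end Spectral

/-! ### Newton's identities for matrices -/

section Newton

open Matrix Polynomial

variable {n : Type*} [Fintype n] [DecidableEq n] {R : Type*} [CommRing R]

/-- Jacobi's formula for the derivative of a determinant. -/
lemma derivative_det (A : Matrix n n R[X]) :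
    derivative A.det = (A.adjugate * A.map derivative).trace := by
  have h1 : derivative A.det = ∑ i, (A.updateRow i (A.map derivative i)).det := by
    simp only [Matrix.det_apply, Polynomial.derivative_sum]
    rw [Finset.sum_comm]
    refine Finset.sum_congr rfl fun σ _ ↦ ?_
    rw [Units.smul_def, Polynomial.derivative_smul, Polynomial.derivative_prod_finset,
      ← Finset.smul_sum]
    congr 1
    rw [← Equiv.sum_comp σ fun i ↦ ∏ j, A.updateRow i (A.map derivative i) (σ j) j]
    refine Finset.sum_congr rfl fun i _ ↦ ?_
    rw [← Finset.prod_erase_mul _ _ (Finset.mem_univ i)]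
    congr 1
    · refine Finset.prod_congr rfl fun j hj ↦ ?_
      rw [Matrix.updateRow_ne (σ.injective.ne (Finset.ne_of_mem_erase hj))]
    · simp
  rw [h1]
  simp only [Matrix.trace, Matrix.diag, Matrix.mul_apply]
  rw [Finset.sum_comm]
  refine Finset.sum_congr rfl fun i _ ↦ ?_
  rw [← Matrix.cramer_transpose_apply, Matrix.cramer_eq_adjugate_mulVec,
    ← Matrix.adjugate_transpose]
  rfl

/-- With A = 1 + XM, the relation adj(A) A = det A reads adj(A) = det A − X adj(A) M. Substituting
it repeatedly into Jacobi's formula expands the logarithmic derivative as a geometric series; the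
remainder is divisible by X^N. -/
lemma derivative_det_one_add (M : Matrix n n R) (N : ℕ) :
    derivative (det (1 + (X : R[X]) • M.map C)) =
      ∑ k ∈ Finset.range N, (-X) ^ k * det (1 + (X : R[X]) • M.map C) * C (M ^ (k + 1)).trace
        + (-X) ^ N * (adjugate (1 + (X : R[X]) • M.map C) * (M.map C) ^ (N + 1)).trace := by
  induction N with
  | zero =>
    have : (1 + (X : R[X]) • M.map C).map derivative = M.map C := by
      ext i j
      simp [Matrix.one_apply, apply_ite derivative]
    simp [derivative_det, this]
  | succ N ih =>
    rw [ih, Finset.sum_range_succ, add_assoc]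
    congr 1
    set A := 1 + (X : R[X]) • M.map C with hA
    have h : A.adjugate = A.det • (1 : Matrix n n R[X]) - (X : R[X]) • (A.adjugate * M.map C) := by
      rw [← Matrix.adjugate_mul]
      conv_rhs => rw [hA, mul_add, mul_one, mul_smul_comm, add_sub_cancel_right]
    have h2 : (A.adjugate * M.map C ^ (N + 1)).trace
        = A.det * C (M ^ (N + 1)).trace
          - X * (A.adjugate * M.map C ^ (N + 1 + 1)).trace := by
      conv_lhs => rw [h]
      rw [sub_mul, smul_mul_assoc, smul_mul_assoc, one_mul, Matrix.trace_sub, Matrix.trace_smul,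
        Matrix.trace_smul, mul_assoc, ← pow_succ', smul_eq_mul, smul_eq_mul]
      congr 2
      rw [← Matrix.map_pow]
      exact (AddMonoidHom.map_trace C _).symm
    rw [h2]
    ring

/-- Newton's identity: the coefficients of `det (1 + X M)` in terms of traces of powers of `M`. -/
lemma newton_coeff_det (M : Matrix n n R) (k : ℕ) :
    (k + 1) * (det (1 + (X : R[X]) • M.map C)).coeff (k + 1) =
      ∑ j ∈ Finset.range (k + 1),
        (-1) ^ j * (det (1 + (X : R[X]) • M.map C)).coeff (k - j) * (M ^ (j + 1)).trace := by
  -- After k + 1 substitutions the remainder is divisible by X^{k+1} and does not reach the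
  -- coefficient of X^k.
  have h := congr_arg (fun p ↦ coeff p k) (derivative_det_one_add M (k + 1))
  simp only [coeff_derivative, coeff_add, finsetSum_coeff] at h
  rw [mul_comm, h, neg_pow (X : R[X]) (k + 1), mul_assoc, mul_comm _ (X ^ (k + 1) * _), mul_assoc,
    coeff_X_pow_mul', if_neg (by omega), add_zero]
  refine Finset.sum_congr rfl fun j hj ↦ ?_
  rw [coeff_mul_C, neg_pow, mul_assoc, ← C_1, ← C_neg, ← C_pow, coeff_C_mul, coeff_X_pow_mul',
    if_pos (by simpa [Nat.lt_succ_iff] using hj)]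

lemma coeff_zero_det_one_add (M : Matrix n n R) :
    (det (1 + (X : R[X]) • M.map C)).coeff 0 = 1 := by
  rw [coeff_zero_eq_eval_zero]
  simp [eval_det_add_X_smul]

lemma eval_one_det_one_add (M : Matrix n n R) :
    (det (1 + (X : R[X]) • M.map C)).eval 1 = det (1 + M) := by
  rw [← coe_evalRingHom, RingHom.map_det]
  congr 1
  ext i j
  by_cases h : i = j <;> simp [h]

end Newton

/-! ### Traces of exponentials of nilpotent matrices -/

section TraceExp

open Matrix

variable {A : Type*} [Ring A] [Module ℚ A] [SMulCommClass ℚ A A] [IsScalarTower ℚ A A]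

omit [SMulCommClass ℚ A A] [IsScalarTower ℚ A A] in
lemma exp_pow_of_isNilpotent {a : A} (ha : IsNilpotent a) (k : ℕ) :
    IsNilpotent.exp a ^ k = IsNilpotent.exp (k • a) := by
  induction k with
  | zero => simp
  | succ k ih =>
    rw [pow_succ, ih, succ_nsmul, IsNilpotent.exp_add_of_commute _ _ ha]
    · exact (Commute.refl a).smul_left k
    · exact ha.smul k

end TraceExp

/-! ### The exterior algebra -/

section Exterior

open ExteriorAlgebra

variable {n : ℕ}

/-- Moving a covector past the product costs two changes of sign. -/
lemma ι_mul_ι_mem_center {V : Type*} [AddCommGroup V] [Module ℂ V] (a b : V) :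
    ι ℂ a * ι ℂ b ∈ Subalgebra.center ℂ (ExteriorAlgebra ℂ V) := by
  rw [Subalgebra.mem_center_iff]
  have hsw : ∀ x y : V, ι ℂ x * ι ℂ y = - (ι ℂ y * ι ℂ x) := fun x y ↦ by
    rw [eq_neg_iff_add_eq_zero]
    exact ExteriorAlgebra.ι_add_mul_swap x y
  intro x
  induction x using ExteriorAlgebra.induction with
  | algebraMap r => exact Algebra.commutes r _
  | ι c =>
    rw [← mul_assoc, hsw c a, neg_mul, mul_assoc, hsw c b, mul_neg, neg_neg, mul_assoc]
  | mul x y hx hy => rw [mul_assoc, hy, ← mul_assoc, hx, mul_assoc]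
  | add x y hx hy => rw [add_mul, mul_add, hx, hy]

lemma toExt_two_mem_center (f : (Fin 2 → Model n) → ℂ) :
    toExt 2 f ∈ Subalgebra.center ℂ (Ext n) := by
  refine Subalgebra.smul_mem _ (Subalgebra.sum_mem _ fun I _ ↦ Subalgebra.smul_mem _ ?_ _) _
  rw [ιMulti_apply]
  simpa using ι_mul_ι_mem_center (dx (I 0)) (dx (I 1))

lemma ιMulti_mem {V : Type*} [AddCommGroup V] [Module ℂ V] (k : ℕ) (v : Fin k → V) :
    ιMulti ℂ k v ∈ ⋀[ℂ]^k V :=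
  ExteriorAlgebra.ιMulti_range ℂ k ⟨v, rfl⟩

lemma toExt_mem (k : ℕ) (f : (Fin k → Model n) → ℂ) :
    toExt k f ∈ ⋀[ℂ]^k (Model n →L[ℝ] ℂ) :=
  Submodule.smul_mem _ _ (Submodule.sum_mem _ fun _ _ ↦ Submodule.smul_mem _ _ (ιMulti_mem _ _))

lemma toExt_add (k : ℕ) (f g : (Fin k → Model n) → ℂ) :
    toExt k (fun v ↦ f v + g v) = toExt k f + toExt k g := by
  simp [toExt, add_smul, Finset.sum_add_distrib]

lemma toExt_smul (k : ℕ) (c : ℂ) (f : (Fin k → Model n) → ℂ) :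
    toExt k (fun v ↦ c * f v) = c • toExt k f := by
  simp only [toExt, mul_smul, ← Finset.smul_sum]
  rw [smul_comm]

lemma covector_eq_sum (φ : Model n →L[ℝ] ℂ) :
    φ = ∑ a, φ (EuclideanSpace.single a 1) • dx a := by
  refine ContinuousLinearMap.coe_injective ((EuclideanSpace.basisFun (Fin n) ℝ).toBasis.ext
    fun b ↦ ?_)
  simp [dx, EuclideanSpace.basisFun_apply, apply_ite Complex.ofReal]

lemma finrank_covector_le : Module.finrank ℂ (Model n →L[ℝ] ℂ) ≤ n := by
  have h : Submodule.span ℂ (Set.range (dx : Fin n → Model n →L[ℝ] ℂ)) = ⊤ := by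
    rw [eq_top_iff]
    intro φ _
    rw [covector_eq_sum φ]
    exact Submodule.sum_mem _ fun a _ ↦ Submodule.smul_mem _ _ (Submodule.subset_span ⟨a, rfl⟩)
  have := finrank_range_le_card (R := ℂ) (dx : Fin n → Model n →L[ℝ] ℂ)
  rwa [Set.finrank, h, finrank_top, Fintype.card_fin] at this

instance finite_covector : Module.Finite ℂ (Model n →L[ℝ] ℂ) := by
  classical
  refine ⟨⟨Finset.univ.image dx, ?_⟩⟩
  rw [eq_top_iff]
  intro φ _
  rw [covector_eq_sum φ]
  exact Submodule.sum_mem _ fun a _ ↦ Submodule.smul_mem _ _ (Submodule.subset_span (by simp))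

lemma eq_zero_of_mem_exteriorPower {d : ℕ} (hd : n < d) {x : Ext n}
    (hx : x ∈ ⋀[ℂ]^d (Model n →L[ℝ] ℂ)) : x = 0 := by
  rw [← ExteriorAlgebra.ιMulti_span_fixedDegree] at hx
  induction hx using Submodule.span_induction with
  | mem x hx =>
    obtain ⟨v, rfl⟩ := hx
    refine AlternatingMap.map_linearDependent _ v fun h ↦ ?_
    have := h.fintype_card_le_finrank
    rw [Fintype.card_fin] at this
    exact absurd (this.trans finrank_covector_le) (by omega)
  | zero => rfl
  | add x y _ _ hx hy => rw [hx, hy, add_zero]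
  | smul c x _ hx => rw [hx, smul_zero]

lemma topEval_ιMulti (v : Fin n → Model n) (k : ℕ) (φ : Fin k → Model n →L[ℝ] ℂ) :
    topEval v (ιMulti ℂ k φ) = if h : k = n then Matrix.det fun i j ↦ φ (Fin.cast h.symm i) (v j)
      else 0 := by
  rw [topEval, liftAlternating_apply_ιMulti]
  split_ifs with h
  · subst h
    simp only [Pi.single_eq_same]
    rfl
  · rw [Pi.single_eq_of_ne h]
    rfl

lemma topEval_eq_zero {v : Fin n → Model n} {d : ℕ} (hd : d ≠ n) {x : Ext n}
    (hx : x ∈ ⋀[ℂ]^d (Model n →L[ℝ] ℂ)) : topEval v x = 0 := by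
  rw [← ExteriorAlgebra.ιMulti_span_fixedDegree] at hx
  induction hx using Submodule.span_induction with
  | mem x hx =>
    obtain ⟨w, rfl⟩ := hx
    rw [topEval_ιMulti, dif_neg hd]
  | zero => simp
  | add x y _ _ hx hy => rw [map_add, hx, hy, add_zero]
  | smul c x _ hx => rw [map_smul, hx, smul_zero]

/-- The pullback of covectors under a linear map. -/
def pullCovector (L : Model n →L[ℝ] Model n) : (Model n →L[ℝ] ℂ) →ₗ[ℂ] (Model n →L[ℝ] ℂ) where
  toFun φ := φ ∘L L
  map_add' _ _ := rfl
  map_smul' _ _ := rfl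

/-- The pullback of mixed forms at a point under a linear map. -/
def pullExt (L : Model n →L[ℝ] Model n) : Ext n →ₐ[ℂ] Ext n := ExteriorAlgebra.map (pullCovector L)

/-- Expanding L in the coordinate basis on either side gives the same double sum over multi-indices.
The lemma transports mixed forms from the preferred chart at a point to a fixed chart. -/
lemma pullExt_toExt (L : Model n →L[ℝ] Model n) {k : ℕ}
    (f : MultilinearMap ℝ (fun _ : Fin k ↦ Model n) ℂ) :
    pullExt L (toExt k f) = toExt k fun v ↦ f fun l ↦ L (v l) := by
  have hL : ∀ b, L (EuclideanSpace.single b 1)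
      = ∑ a, (L (EuclideanSpace.single b 1) a) • (EuclideanSpace.single a (1 : ℝ)) := fun b ↦ by
    ext c; simp [Pi.single_apply]
  have hdx : ∀ a, pullCovector L (dx a)
      = ∑ b, ((L (EuclideanSpace.single b 1) a : ℝ) : ℂ) • dx b := fun a ↦ by
    rw [covector_eq_sum (pullCovector L (dx a))]
    rfl
  simp only [toExt, map_smul, map_sum, pullExt, ExteriorAlgebra.map_apply_ιMulti]
  congr 1
  have h1 : ∀ I : Fin k → Fin n, ιMulti ℂ k (⇑(pullCovector L) ∘ fun l ↦ dx (I l))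
      = ∑ J : Fin k → Fin n, (∏ l, ((L (EuclideanSpace.single (J l) 1) (I l) : ℝ) : ℂ)) •
        ιMulti ℂ k fun l ↦ dx (J l) := fun I ↦ by
    have : (⇑(pullCovector L) ∘ fun l ↦ dx (I l))
        = fun l ↦ ∑ b, ((L (EuclideanSpace.single b 1) (I l) : ℝ) : ℂ) • dx b :=
      funext fun l ↦ hdx _
    rw [this, ← AlternatingMap.coe_multilinearMap, MultilinearMap.map_sum]
    exact Finset.sum_congr rfl fun J _ ↦ MultilinearMap.map_smul_univ _ _ _
  have h2 : ∀ J : Fin k → Fin n, (f fun l ↦ L (EuclideanSpace.single (J l) 1))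
      = ∑ I : Fin k → Fin n, (∏ l, ((L (EuclideanSpace.single (J l) 1) (I l) : ℝ) : ℂ)) *
        f fun l ↦ EuclideanSpace.single (I l) 1 := fun J ↦ by
    have : (fun l ↦ L (EuclideanSpace.single (J l) 1)) = fun l ↦
        ∑ a, (L (EuclideanSpace.single (J l) 1) a) • (EuclideanSpace.single a (1 : ℝ)) :=
      funext fun l ↦ hL _
    rw [this, MultilinearMap.map_sum]
    refine Finset.sum_congr rfl fun I _ ↦ ?_
    rw [MultilinearMap.map_smul_univ, Complex.real_smul, Complex.ofReal_prod]
  simp only [h1, h2, Finset.smul_sum, Finset.sum_smul]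
  rw [Finset.sum_comm]
  refine Finset.sum_congr rfl fun J _ ↦ Finset.sum_congr rfl fun I _ ↦ ?_
  rw [smul_smul, mul_comm]

/-- Since `chartFrame` is the image of the standard frame, the integrand in a chart becomes the
evaluation of the pulled back form on a constant frame. -/
lemma topEval_comp (L : Model n →L[ℝ] Model n) (v : Fin n → Model n) (x : Ext n) :
    topEval (fun a ↦ L (v a)) x = topEval v (pullExt L x) := by
  suffices h : topEval (fun a ↦ L (v a)) = topEval v ∘ₗ (pullExt L).toLinearMap from
    DFunLike.congr_fun h x
  refine ExteriorAlgebra.lhom_ext fun k ↦ ?_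
  ext φ
  simp only [LinearMap.compAlternatingMap_apply, LinearMap.comp_apply, AlgHom.toLinearMap_apply,
    pullExt, ExteriorAlgebra.map_apply_ιMulti, topEval_ιMulti]
  rfl

end Exterior

/-! ### Associated bundles -/

section Associated

/-- A smooth multiplicative `*`-map between matrix algebras, together with its derivative at the
identity. It restricts to a representation of the unitary group. -/
structure UnitaryRep (r : ℕ) where
  dim : ℕ
  toFun : EndC r → EndC dim
  der : EndC r →L[ℝ] EndC dim
  map_one : toFun 1 = 1
  map_mul : ∀ a b, toFun (a * b) = toFun a * toFun b
  map_star : ∀ a, toFun (star a) = star (toFun a)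
  contDiff : ContDiff ℝ ∞ toFun
  hasFDerivAt_one : HasFDerivAt toFun der 1
  der_star : ∀ x, der (star x) = star (der x)
  der_lie : ∀ x y, der (x * y - y * x) = der x * der y - der y * der x

namespace UnitaryRep

variable {r : ℕ} (ρ : UnitaryRep r)

lemma differentiable : Differentiable ℝ ρ.toFun := ρ.contDiff.differentiable (by simp)

/-- Differentiate ρ(ba) = ρ(b) ρ(a) with respect to b at the identity. With its left-handed twin it
carries the gauge and parallelism equations of `E` over to the associated bundle. -/
lemma fderiv_mul_right (a x : EndC r) :
    fderiv ℝ ρ.toFun a (x * a) = ρ.der x * ρ.toFun a := by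
  have h1 : HasFDerivAt (fun b : EndC r ↦ ρ.toFun (b * a))
      ((fderiv ℝ ρ.toFun (1 * a)).comp ((ContinuousLinearMap.mul ℝ (EndC r)).flip a)) 1 :=
    (ρ.differentiable _).hasFDerivAt.comp (1 : EndC r)
      (((ContinuousLinearMap.mul ℝ (EndC r)).flip a).hasFDerivAt)
  have h2 : HasFDerivAt (fun b : EndC r ↦ ρ.toFun (b * a))
      (((ContinuousLinearMap.mul ℝ (EndC ρ.dim)).flip (ρ.toFun a)).comp ρ.der) 1 := by
    simp only [ρ.map_mul]
    exact (((ContinuousLinearMap.mul ℝ (EndC ρ.dim)).flip (ρ.toFun a)).hasFDerivAt).comp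
      (1 : EndC r) ρ.hasFDerivAt_one
  have := DFunLike.congr_fun (h1.unique h2) x
  simpa using this

lemma fderiv_mul_left (a x : EndC r) :
    fderiv ℝ ρ.toFun a (a * x) = ρ.toFun a * ρ.der x := by
  have h1 : HasFDerivAt (fun b : EndC r ↦ ρ.toFun (a * b))
      ((fderiv ℝ ρ.toFun (a * 1)).comp (ContinuousLinearMap.mul ℝ (EndC r) a)) 1 :=
    (ρ.differentiable _).hasFDerivAt.comp (1 : EndC r)
      ((ContinuousLinearMap.mul ℝ (EndC r) a).hasFDerivAt)
  have h2 : HasFDerivAt (fun b : EndC r ↦ ρ.toFun (a * b))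
      ((ContinuousLinearMap.mul ℝ (EndC ρ.dim) (ρ.toFun a)).comp ρ.der) 1 := by
    simp only [ρ.map_mul]
    exact ((ContinuousLinearMap.mul ℝ (EndC ρ.dim) (ρ.toFun a)).hasFDerivAt).comp
      (1 : EndC r) ρ.hasFDerivAt_one
  have := DFunLike.congr_fun (h1.unique h2) x
  simpa using this

lemma map_unitary {a : EndC r} (ha : a ∈ unitary (EndC r)) :
    ρ.toFun a ∈ unitary (EndC ρ.dim) := by
  rw [Unitary.mem_iff] at ha ⊢
  rw [← ρ.map_star, ← ρ.map_mul, ← ρ.map_mul, ha.1, ha.2, ρ.map_one]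
  exact ⟨rfl, rfl⟩

end UnitaryRep

variable {n : ℕ} [NeZero n] {M : Type*} [TopologicalSpace M]
  [ChartedSpace (EuclideanHalfSpace n) M] [IsManifold (𝓡∂ n) ∞ M]

lemma DiffForm.SmoothOn.contDiffWithinAt {k : ℕ} {W : Type*} [NormedAddCommGroup W]
    [NormedSpace ℝ W] {η : DiffForm n k M W} {U : Set M} (hη : η.SmoothOn U) (hU : IsOpen U)
    {c x : M} (hx : x ∈ U) (hc : x ∈ (extChartAt (𝓡∂ n) c).source) :
    ContDiffWithinAt ℝ ∞ (η.inChart c) (Set.range (𝓡∂ n)) (extChartAt (𝓡∂ n) c x) := by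
  refine (hη c _ ⟨(extChartAt (𝓡∂ n) c).map_source hc, ?_⟩).mono_of_mem_nhdsWithin ?_
  · rwa [Set.mem_preimage, (extChartAt (𝓡∂ n) c).left_inv hc]
  · refine Filter.inter_mem (extChartAt_target_mem_nhdsWithin' hc) (mem_nhdsWithin_of_mem_nhds ?_)
    refine (continuousAt_extChartAt_symm' hc).preimage_mem_nhds ?_
    rw [(extChartAt (𝓡∂ n) c).left_inv hc]
    exact hU.mem_nhds hx

omit [IsManifold (𝓡∂ n) ∞ M] in
lemma uniqueDiffWithinAt_range (c x : M) (hc : x ∈ (extChartAt (𝓡∂ n) c).source) :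
    UniqueDiffWithinAt ℝ (Set.range (𝓡∂ n)) (extChartAt (𝓡∂ n) c x) :=
  (𝓡∂ n).uniqueDiffOn _ (extChartAt_target_subset_range c ((extChartAt (𝓡∂ n) c).map_source hc))

omit [IsManifold (𝓡∂ n) ∞ M] in
lemma mvfderiv_comp_left {V W : Type*} [NormedAddCommGroup V] [NormedSpace ℝ V]
    [NormedAddCommGroup W] [NormedSpace ℝ W] {ρ : V → W} {g : M → V} {x : M}
    (hρ : DifferentiableAt ℝ ρ (g x)) (hg : MDifferentiableAt (𝓡∂ n) 𝓘(ℝ, V) g x)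
    (X : TangentSpace (𝓡∂ n) x) :
    mvfderiv (𝓡∂ n) (fun y ↦ ρ (g y)) x X = fderiv ℝ ρ (g x) (mvfderiv (𝓡∂ n) g x X) := by
  have h := mfderiv_comp x hρ.mdifferentiableAt hg
  have := DFunLike.congr_fun h X
  simp only [mfderiv_eq_fderiv] at this
  exact this

lemma extDerivWithin_comp_left {V F G : Type*} [NormedAddCommGroup V] [NormedSpace ℝ V]
    [NormedAddCommGroup F] [NormedSpace ℝ F] [NormedAddCommGroup G] [NormedSpace ℝ G] {k : ℕ}
    {θ : V → V [⋀^Fin k]→L[ℝ] F} {s : Set V} {x : V} (L : F →L[ℝ] G)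
    (hθ : DifferentiableWithinAt ℝ θ s x) (hs : UniqueDiffWithinAt ℝ s x) :
    extDerivWithin (fun y ↦ L.compContinuousAlternatingMap (θ y)) s x
      = L.compContinuousAlternatingMap (extDerivWithin θ s x) := by
  have hL : DifferentiableWithinAt ℝ (fun y ↦ L.compContinuousAlternatingMap (θ y)) s x :=
    (ContinuousLinearMap.compContinuousAlternatingMapCLM ℝ V F G (Fin k)
      L).differentiableAt.comp_differentiableWithinAt x hθ
  ext v
  rw [ContinuousLinearMap.compContinuousAlternatingMap_coe, Function.comp_apply,
    extDerivWithin_apply hL hs, extDerivWithin_apply hθ hs, map_sum]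
  refine Finset.sum_congr rfl fun i _ ↦ ?_
  rw [map_zsmul]
  congr 1
  have hd : DifferentiableWithinAt ℝ (fun y ↦ θ y (i.removeNth v)) s x :=
    hθ.continuousAlternatingMap_apply_const _
  exact DFunLike.congr_fun ((L.hasFDerivAt.comp_hasFDerivWithinAt x
    hd.hasFDerivWithinAt).fderivWithin hs) (v i)

lemma DiffForm.SmoothOn.comp_left {k : ℕ} {F G : Type*} [NormedAddCommGroup F] [NormedSpace ℝ F]
    [NormedAddCommGroup G] [NormedSpace ℝ G] {η : DiffForm n k M F} {U : Set M}
    (hη : η.SmoothOn U) (L : F →L[ℝ] G) :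
    DiffForm.SmoothOn (n := n) (M := M) (fun x ↦ L.compContinuousAlternatingMap (η x)) U :=
  fun c ↦ (ContinuousLinearMap.compContinuousAlternatingMapCLM ℝ (Model n) F G (Fin k)
    L).contDiff.comp_contDiffOn (hη c)

lemma DiffForm.d_comp_left {k : ℕ} {F G : Type*} [NormedAddCommGroup F] [NormedSpace ℝ F]
    [NormedAddCommGroup G] [NormedSpace ℝ G] {η : DiffForm n k M F} {U : Set M}
    (hη : η.SmoothOn U) (hU : IsOpen U) (L : F →L[ℝ] G) {x : M} (hx : x ∈ U) :
    DiffForm.d (n := n) (M := M) (fun x ↦ L.compContinuousAlternatingMap (η x)) x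
      = L.compContinuousAlternatingMap (η.d x) := by
  have hxs := mem_extChartAt_source (I := 𝓡∂ n) x
  exact extDerivWithin_comp_left L
    ((hη.contDiffWithinAt hU hx hxs).differentiableWithinAt (by simp))
    (uniqueDiffWithinAt_range x x hxs)

namespace HermitianBundle

variable (E : HermitianBundle n M)

lemma coordChange_self_eq (i : E.ι) {x : M} (hx : x ∈ E.core.baseSet i) :
    E.core.coordChange i i x = 1 :=
  ContinuousLinearMap.ext fun v ↦ E.core.coordChange_self i x hx v

lemma coordChange_mul (i j k : E.ι) {x : M}
    (hx : x ∈ E.core.baseSet i ∩ E.core.baseSet j ∩ E.core.baseSet k) :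
    E.core.coordChange j k x * E.core.coordChange i j x = E.core.coordChange i k x :=
  ContinuousLinearMap.ext fun v ↦ E.core.coordChange_comp i j k x hx v

lemma mdifferentiableAt_coordChange (i j : E.ι) {x : M}
    (hx : x ∈ E.core.baseSet i ∩ E.core.baseSet j) :
    MDifferentiableAt (𝓡∂ n) 𝓘(ℝ, EndC E.rank) (E.core.coordChange i j) x :=
  ((E.smooth_coordChange i j).contMDiffAt
    (((E.core.isOpen_baseSet i).inter (E.core.isOpen_baseSet j)).mem_nhds hx)).mdifferentiableAt
    (by simp)

/-- The bundle associated to `E` by a representation of the structure group. -/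
def assoc (ρ : UnitaryRep E.rank) : HermitianBundle n M where
  rank := ρ.dim
  ι := E.ι
  core :=
    { baseSet := E.core.baseSet
      isOpen_baseSet := E.core.isOpen_baseSet
      indexAt := E.core.indexAt
      mem_baseSet_at := E.core.mem_baseSet_at
      coordChange := fun i j x ↦ ρ.toFun (E.core.coordChange i j x)
      coordChange_self := fun i x hx v ↦ by rw [E.coordChange_self_eq i hx, ρ.map_one]; rfl
      continuousOn_coordChange := fun i j ↦
        ρ.contDiff.continuous.comp_continuousOn (E.core.continuousOn_coordChange i j)
      coordChange_comp := fun i j k x hx v ↦ by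
        rw [← E.coordChange_mul i j k hx, ρ.map_mul]; rfl }
  unitary_coordChange i j x hx := ρ.map_unitary (E.unitary_coordChange i j x hx)
  smooth_coordChange i j := ρ.contDiff.contMDiff.comp_contMDiffOn (E.smooth_coordChange i j)
  conn i x := ρ.der.compContinuousAlternatingMap (E.conn i x)
  smooth_conn i c := (E.smooth_conn i).comp_left ρ.der c
  skew_conn i x hx X := by
    change star (ρ.der (E.conn i x ![X])) = -ρ.der (E.conn i x ![X])
    rw [← ρ.der_star, E.skew_conn i x hx X, map_neg]
  conn_coordChange i j x hx X := by
    change _ + ρ.der (E.conn j x ![X]) * ρ.toFun (E.core.coordChange i j x)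
      = ρ.toFun (E.core.coordChange i j x) * ρ.der (E.conn i x ![X])
    -- All three terms are values of the derivative of ρ at the transition function, so the identity
    -- is the image of the gauge equation of `E` under one linear map.
    rw [mvfderiv_comp_left (ρ.differentiable _) (E.mdifferentiableAt_coordChange i j hx),
      ← ρ.fderiv_mul_right, ← ρ.fderiv_mul_left, ← map_add, E.conn_coordChange i j x hx X]

variable {E}

lemma IsBoundaryAdapted.assoc (h : E.IsBoundaryAdapted) (ρ : UnitaryRep E.rank) :
    (E.assoc ρ).IsBoundaryAdapted := by
  obtain ⟨W, h, hW, hb, hs, hu, hc, hp⟩ := h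
  refine ⟨W, fun i x ↦ ρ.toFun (h i x), hW, hb, fun i ↦ ?_, fun i x hx ↦ ρ.map_unitary (hu i x hx),
    fun i j x hx ↦ ?_, fun i x hx X ↦ ?_⟩
  · exact ρ.contDiff.contMDiff.comp_contMDiffOn (hs i)
  · change ρ.toFun (h j x) = ρ.toFun (E.core.coordChange i j x) * ρ.toFun (h i x)
    rw [hc i j x hx, ρ.map_mul]
  · have hd : MDifferentiableAt (𝓡∂ n) 𝓘(ℝ, EndC E.rank) (h i) x :=
      ((hs i).contMDiffAt (((E.core.isOpen_baseSet i).inter hW).mem_nhds hx)).mdifferentiableAt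
        (by simp)
    change mvfderiv (𝓡∂ n) (fun x ↦ ρ.toFun (h i x)) x X
      + ρ.der (E.conn i x ![X]) * ρ.toFun (h i x) = 0
    rw [mvfderiv_comp_left (ρ.differentiable _) hd, ← ρ.fderiv_mul_right, ← map_add, hp i x hx X,
      map_zero]

variable (E)

/-- The exterior derivative commutes with the constant linear map `ρ.der`, and the commutator term
is respected because `ρ.der` is a Lie algebra homomorphism. -/
lemma localCurvature_assoc (ρ : UnitaryRep E.rank) (i : E.ι) {x : M} (hx : x ∈ E.core.baseSet i)
    (X Y : TangentSpace (𝓡∂ n) x) :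
    (E.assoc ρ).localCurvature i x X Y = ρ.der (E.localCurvature i x X Y) := by
  have key : ((E.assoc ρ).conn i).d x ![X, Y] = ρ.der ((E.conn i).d x ![X, Y]) :=
    DFunLike.congr_fun
      (DiffForm.d_comp_left (E.smooth_conn i) (E.core.isOpen_baseSet i) ρ.der hx) ![X, Y]
  simp only [localCurvature, map_add, key, ρ.der_lie]
  rfl

lemma curvature_assoc (ρ : UnitaryRep E.rank) (x : M) (X Y : TangentSpace (𝓡∂ n) x) :
    (E.assoc ρ).curvature x X Y = ρ.der (E.curvature x X Y) :=
  E.localCurvature_assoc ρ _ (E.core.mem_baseSet_at x) X Y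

lemma curvatureNorm_assoc_le (ρ : UnitaryRep E.rank) {C : ℝ≥0} (hC : ∀ x, ‖ρ.der x‖ ≤ C * ‖x‖)
    (g : Bundle.ContMDiffRiemannianMetric (𝓡∂ n) ∞ (Model n)
      (fun x : M ↦ TangentSpace (𝓡∂ n) x)) :
    (E.assoc ρ).curvatureNorm g ≤ C * E.curvatureNorm g := by
  have hC' : ∀ x, ‖ρ.der x‖ₑ ≤ C * ‖x‖ₑ := fun x ↦ by
    have : ‖ρ.der x‖₊ ≤ C * ‖x‖₊ := hC x
    simp only [enorm_eq_nnnorm]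
    exact_mod_cast this
  refine iSup_le fun x ↦ iSup_le fun X ↦ iSup_le fun Y ↦ iSup_le fun hX ↦ iSup_le fun hY ↦ ?_
  rw [curvature_assoc]
  refine (hC' _).trans (mul_le_mul_right ?_ _)
  exact le_iSup_of_le x <| le_iSup_of_le X <| le_iSup_of_le Y <| le_iSup_of_le hX <|
    le_iSup_of_le hY le_rfl

end HermitianBundle

end Associated

/-! ### Tensor powers as representations -/

section TensorRep

open Matrix

variable {r : ℕ} {ι : Type*} [Fintype ι] [DecidableEq ι] {s : ℕ}

/-- The matrix of an endomorphism of `ℂʳ`. -/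
abbrev mat (r : ℕ) : EndC r ≃⋆ₐ[ℂ] Matrix (Fin r) (Fin r) ℂ := Matrix.toEuclideanCLM.symm

lemma mat_apply (A : EndC r) (a b : Fin r) : mat r A a b = A (EuclideanSpace.single b 1) a := by
  conv_rhs => rw [← (mat r).symm_apply_apply A]
  generalize mat r A = B
  change B a b = (toEuclideanCLM (𝕜 := ℂ) B (WithLp.toLp 2 (Pi.single b 1))) a
  rw [toEuclideanCLM_toLp]
  simp

lemma mat_star (A : EndC r) : mat r (star A) = (mat r A)ᴴ := map_star (mat r) A

lemma mat_symm_conjTranspose (X : Matrix (Fin r) (Fin r) ℂ) :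
    (mat r).symm Xᴴ = star ((mat r).symm X) := map_star (mat r).symm X

lemma tens_add_update (A : ι → Matrix (Fin r) (Fin r) ℂ) (l : ι) (x y : Matrix (Fin r) (Fin r) ℂ) :
    tens (Function.update A l (x + y))
      = tens (Function.update A l x) + tens (Function.update A l y) := by
  ext f g
  simp only [tens_apply, Matrix.add_apply]
  have h : ∀ z : Matrix (Fin r) (Fin r) ℂ, ∏ k, Function.update A l z k (f k) (g k)
      = z (f l) (g l) * ∏ k ∈ Finset.univ.erase l, A k (f k) (g k) := fun z ↦ by
    rw [← Finset.mul_prod_erase _ _ (Finset.mem_univ l), Function.update_self]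
    congr 1
    exact Finset.prod_congr rfl fun k hk ↦ by
      rw [Function.update_of_ne (Finset.ne_of_mem_erase hk)]
  rw [h, h, h, Matrix.add_apply, add_mul]

lemma tens_smul_update (A : ι → Matrix (Fin r) (Fin r) ℂ) (l : ι) (c : ℂ)
    (x : Matrix (Fin r) (Fin r) ℂ) :
    tens (Function.update A l (c • x)) = c • tens (Function.update A l x) := by
  ext f g
  simp only [tens_apply, Matrix.smul_apply]
  have h : ∀ z : Matrix (Fin r) (Fin r) ℂ, ∏ k, Function.update A l z k (f k) (g k)
      = z (f l) (g l) * ∏ k ∈ Finset.univ.erase l, A k (f k) (g k) := fun z ↦ by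
    rw [← Finset.mul_prod_erase _ _ (Finset.mem_univ l), Function.update_self]
    congr 1
    exact Finset.prod_congr rfl fun k hk ↦ by
      rw [Function.update_of_ne (Finset.ne_of_mem_erase hk)]
  rw [h, h, Matrix.smul_apply, smul_eq_mul, smul_eq_mul, mul_assoc]

lemma continuous_mat : Continuous (mat r) :=
  LinearMap.continuous_of_finiteDimensional (mat r).toAlgEquiv.toLinearMap

lemma continuous_mat_symm : Continuous (mat r).symm :=
  LinearMap.continuous_of_finiteDimensional (mat r).symm.toAlgEquiv.toLinearMap

/-- The map `(Aₗ)ₗ ↦ Jᴴ (⨂ₗ Aₗ) J`. -/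
def tensCompress (J : Matrix (ι → Fin r) (Fin s) ℂ) :
    ContinuousMultilinearMap ℂ (fun _ : ι ↦ EndC r) (EndC s) where
  toMultilinearMap := MultilinearMap.mk'
    (fun A ↦ (mat s).symm (Jᴴ * tens (fun l ↦ mat r (A l)) * J))
    (fun A l x y ↦ by
      have h : ∀ z : EndC r, (fun k ↦ mat r (Function.update A l z k))
          = Function.update (fun k ↦ mat r (A k)) l (mat r z) := fun z ↦
        funext fun k ↦ Function.apply_update (fun _ ↦ mat r) A l z k
      rw [h, h, h, map_add, tens_add_update, Matrix.mul_add, Matrix.add_mul, map_add])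
    (fun A l c x ↦ by
      have h : ∀ z : EndC r, (fun k ↦ mat r (Function.update A l z k))
          = Function.update (fun k ↦ mat r (A k)) l (mat r z) := fun z ↦
        funext fun k ↦ Function.apply_update (fun _ ↦ mat r) A l z k
      rw [h, h, map_smul, tens_smul_update, Matrix.mul_smul, Matrix.smul_mul, map_smul])
  cont := by
    refine continuous_mat_symm.comp ((Continuous.matrix_mul continuous_const ?_).matrix_mul
      continuous_const)
    refine continuous_matrix fun f g ↦ ?_
    simp only [tens_apply]
    refine continuous_finsetProd _ fun l _ ↦ ?_
    exact (continuous_mat.comp (continuous_apply l)).matrix_elem _ _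

lemma tensCompress_apply (J : Matrix (ι → Fin r) (Fin s) ℂ) (A : ι → EndC r) :
    tensCompress J A = (mat s).symm (Jᴴ * tens (fun l ↦ mat r (A l)) * J) := rfl

/-- The derivative at the identity of `A ↦ Jᴴ A^{⊗ι} J`. -/
def tensCompressDer (J : Matrix (ι → Fin r) (Fin s) ℂ) : EndC r →L[ℂ] EndC s :=
  (tensCompress J).linearDeriv 1 ∘L ContinuousLinearMap.pi fun _ ↦ ContinuousLinearMap.id ℂ _

lemma tensCompressDer_apply (J : Matrix (ι → Fin r) (Fin s) ℂ) (x : EndC r) :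
    tensCompressDer J x = (mat s).symm (Jᴴ * tensDer ι (mat r x) * J) := by
  rw [tensCompressDer, ContinuousLinearMap.comp_apply, ContinuousMultilinearMap.linearDeriv_apply,
    tensDer_apply, Matrix.mul_sum, Matrix.sum_mul, map_sum]
  refine Finset.sum_congr rfl fun l _ ↦ ?_
  rw [tensCompress_apply, slot_apply]
  congr 4
  ext1 k
  by_cases h : k = l
  · subst h; simp
  · rw [Function.update_of_ne h, Pi.mulSingle_eq_of_ne h, Pi.one_apply, map_one]

-- Each slot embedding is a `*`-homomorphism of C*-algebras, hence contractive; there are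
-- `Fintype.card ι` of them.
open scoped Matrix.Norms.L2Operator in
lemma norm_tensDer_le (x : Matrix (Fin r) (Fin r) ℂ) :
    ‖tensDer ι x‖ ≤ Fintype.card ι * ‖x‖ := by
  rw [tensDer_apply]
  refine (norm_sum_le _ _).trans ?_
  refine (Finset.sum_le_card_nsmul _ _ ‖x‖ fun l _ ↦ ?_).trans (by simp)
  let φ : Matrix (Fin r) (Fin r) ℂ →⋆ₐ[ℂ] Matrix (ι → Fin r) (ι → Fin r) ℂ :=
    { slot l with map_star' := fun x ↦ (slot_conjTranspose l x).symm }
  exact NonUnitalStarAlgHom.norm_apply_le φ x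

open scoped Matrix.Norms.L2Operator in
lemma norm_compress_le {N : Type*} [Fintype N] [DecidableEq N] {J : Matrix N (Fin s) ℂ}
    (hJ : Jᴴ * J = 1) (X : Matrix N N ℂ) : ‖Jᴴ * X * J‖ ≤ ‖X‖ := by
  have h1 : ‖J‖ ≤ 1 := by
    have h := Matrix.l2_opNorm_conjTranspose_mul_self J
    rw [hJ] at h
    -- Only an inequality is available, since s = 0 gives a zero algebra in which the unit has norm
    -- zero.
    have : ‖(1 : Matrix (Fin s) (Fin s) ℂ)‖ ≤ 1 := by
      rcases subsingleton_or_nontrivial (Matrix (Fin s) (Fin s) ℂ) with hs | hs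
      · rw [Subsingleton.elim (1 : Matrix (Fin s) (Fin s) ℂ) 0]; simp
      · exact (CStarRing.norm_one).le
    nlinarith [norm_nonneg J]
  calc ‖Jᴴ * X * J‖ ≤ ‖Jᴴ‖ * ‖X‖ * ‖J‖ :=
        (Matrix.l2_opNorm_mul _ _).trans (by gcongr; exact Matrix.l2_opNorm_mul _ _)
    _ ≤ 1 * ‖X‖ * 1 := by
        rw [Matrix.l2_opNorm_conjTranspose]
        gcongr
    _ = ‖X‖ := by ring

lemma hasFDerivAt_tensCompress (J : Matrix (ι → Fin r) (Fin s) ℂ) :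
    HasFDerivAt (fun A : EndC r ↦ tensCompress J fun _ ↦ A) (tensCompressDer J) 1 :=
  HasFDerivAt.comp (f := fun A : EndC r ↦ fun _ : ι ↦ A) (1 : EndC r)
    ((tensCompress J).hasFDerivAt (1 : ι → EndC r))
    (ContinuousLinearMap.pi fun _ ↦ ContinuousLinearMap.id ℂ (EndC r)).hasFDerivAt

lemma contDiff_tensCompress (J : Matrix (ι → Fin r) (Fin s) ℂ) :
    ContDiff ℝ ∞ fun A : EndC r ↦ tensCompress J fun _ ↦ A := by
  have h : ContDiff ℂ ∞ fun A : EndC r ↦ tensCompress J fun _ ↦ A :=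
    (tensCompress J).contDiff.comp (contDiff_pi.2 fun _ ↦ contDiff_id)
  exact h.restrict_scalars ℝ

lemma norm_tensCompressDer_le {J : Matrix (ι → Fin r) (Fin s) ℂ} (hJ : Jᴴ * J = 1) (x : EndC r) :
    ‖tensCompressDer J x‖ ≤ Fintype.card ι * ‖x‖ := by
  rw [tensCompressDer_apply]
  have h := (norm_compress_le hJ (tensDer ι (mat r x))).trans (norm_tensDer_le (mat r x))
  have h2 : mat r x = mat r x := rfl
  simp only [Matrix.cstar_norm_def] at h
  rwa [show toEuclideanCLM (𝕜 := ℂ) (mat r x) = x from (mat r).symm_apply_apply x] at h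

/-- The representation on the image of an isometry `J` into the tensor power, when the image is
invariant. -/
def tensRep (J : Matrix (ι → Fin r) (Fin s) ℂ) (hJ : Jᴴ * J = 1)
    (hT : ∀ A : Matrix (Fin r) (Fin r) ℂ, Commute (J * Jᴴ) (tens fun _ : ι ↦ A))
    (hD : ∀ A : Matrix (Fin r) (Fin r) ℂ, Commute (J * Jᴴ) (tensDer ι A)) : UnitaryRep r where
  dim := s
  toFun A := tensCompress J fun _ ↦ A
  der := (tensCompressDer J).restrictScalars ℝ
  map_one := by
    have : (fun _ : ι ↦ mat r (1 : EndC r)) = 1 := funext fun _ ↦ map_one _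
    rw [tensCompress_apply, this, tens_one, Matrix.mul_one, hJ, map_one]
  map_mul a b := by
    simp only [tensCompress_apply]
    rw [← map_mul]
    have : (fun _ : ι ↦ mat r (a * b)) = (fun _ ↦ mat r a) * fun _ ↦ mat r b :=
      funext fun _ ↦ map_mul _ _ _
    rw [this, ← tens_mul]
    congr 1
    set A := tens fun _ : ι ↦ mat r a
    set B := tens fun _ : ι ↦ mat r b
    -- Compression is multiplicative because the projection J Jᴴ commutes with A, that is, because
    -- the image of J is invariant.
    calc Jᴴ * (A * B) * J = Jᴴ * J * Jᴴ * (A * B) * J := by rw [hJ, Matrix.one_mul]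
      _ = Jᴴ * (J * Jᴴ * A) * B * J := by simp only [Matrix.mul_assoc]
      _ = Jᴴ * (A * (J * Jᴴ)) * B * J := by rw [(hT (mat r a)).eq]
      _ = Jᴴ * A * J * (Jᴴ * B * J) := by simp only [Matrix.mul_assoc]
  map_star a := by
    simp only [tensCompress_apply]
    rw [← mat_symm_conjTranspose]
    congr 1
    simp only [mat_star, conjTranspose_mul, conjTranspose_conjTranspose,
      tens_conjTranspose, Matrix.mul_assoc]
  contDiff := contDiff_tensCompress J
  hasFDerivAt_one := (hasFDerivAt_tensCompress J).restrictScalars ℝ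
  der_star x := by
    simp only [ContinuousLinearMap.coe_restrictScalars', tensCompressDer_apply]
    rw [← mat_symm_conjTranspose]
    congr 1
    simp only [mat_star, conjTranspose_mul, conjTranspose_conjTranspose,
      tensDer_conjTranspose, Matrix.mul_assoc]
  der_lie x y := by
    simp only [ContinuousLinearMap.coe_restrictScalars', tensCompressDer_apply]
    rw [← map_mul, ← map_mul, ← map_sub]
    congr 1
    rw [map_sub, map_mul, map_mul, tensDer_lie]
    set A := tensDer ι (mat r x)
    set B := tensDer ι (mat r y)
    have key : ∀ A B : Matrix (ι → Fin r) (ι → Fin r) ℂ, Commute (J * Jᴴ) A →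
        Jᴴ * (A * B) * J = Jᴴ * A * J * (Jᴴ * B * J) := fun A B h ↦ by
      calc Jᴴ * (A * B) * J = Jᴴ * J * Jᴴ * (A * B) * J := by rw [hJ, Matrix.one_mul]
        _ = Jᴴ * (J * Jᴴ * A) * B * J := by simp only [Matrix.mul_assoc]
        _ = Jᴴ * (A * (J * Jᴴ)) * B * J := by rw [h.eq]
        _ = Jᴴ * A * J * (Jᴴ * B * J) := by simp only [Matrix.mul_assoc]
    rw [Matrix.mul_sub, Matrix.sub_mul, key A B (hD _), key B A (hD _)]

end TensorRep

/-! ### The Chern character of a compressed tensor power -/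

section TraceIdentity

open Matrix

variable {ι n : Type*} [Fintype ι] [DecidableEq ι] [Fintype n] [DecidableEq n]
variable {S : Type*} [CommRing S] [Algebra ℂ S]

variable (S) in
/-- The extension of scalars of a complex matrix. -/
abbrev extMat {N K : Type*} (J : Matrix N K ℂ) : Matrix N K S := J.map (algebraMap ℂ S)

lemma extMat_mul {N K L : Type*} [Fintype K] (A : Matrix N K ℂ) (B : Matrix K L ℂ) :
    extMat S (A * B) = extMat S A * extMat S B := Matrix.map_mul

lemma extMat_one {N : Type*} [DecidableEq N] : extMat S (1 : Matrix N N ℂ) = 1 :=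
  Matrix.map_one _ (map_zero _) (map_one _)

/-- The matrix `Jᴴ (∑ₗ 1 ⊗ ⋯ ⊗ B ⊗ ⋯ ⊗ 1) J`. -/
def compressDer {K : Type*} (J : Matrix (ι → n) K ℂ) (B : Matrix n n S) : Matrix K K S :=
  extMat S Jᴴ * tensDer ι B * extMat S J

omit [Fintype ι] [DecidableEq ι] [Fintype n] in
lemma extMat_permTens [Fintype ι] (σ : Equiv.Perm ι) :
    extMat S (permTens n ℂ σ) = permTens n S σ := by
  ext f g
  simp only [permTens, Matrix.map_apply, Matrix.of_apply]
  split_ifs <;> simp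

lemma slot_apply_ite {R : Type*} [CommRing R] (l : ι) (x : Matrix n n R) (f g : ι → n) :
    slot l x f g = if ∀ k ∈ Finset.univ.erase l, f k = g k then x (f l) (g l) else 0 := by
  simp only [slot_apply_apply, Matrix.one_apply, Finset.prod_ite_zero, Finset.prod_const_one,
    mul_ite, mul_one, mul_zero]

/-- Linear maps of coefficients commute with complex linear operations on matrices. -/
lemma map_compress {P : Type*} [CommRing P] [Algebra ℂ P] (Φ : P →ₗ[ℂ] S) {K : Type*}
    (J : Matrix (ι → n) K ℂ) (X : Matrix n n P) :
    (compressDer J X).map Φ = compressDer J (X.map Φ) := by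
  have h1 : (tensDer ι X).map Φ = tensDer ι (X.map Φ) := by
    ext f g
    simp only [tensDer_apply, Matrix.map_apply, Matrix.sum_apply, map_sum, slot_apply_ite]
    exact Finset.sum_congr rfl fun l _ ↦ by split_ifs <;> simp
  rw [compressDer, compressDer, ← h1]
  ext a b
  simp only [Matrix.mul_apply, Matrix.map_apply, map_sum, Finset.sum_mul]
  refine Finset.sum_congr rfl fun g _ ↦ Finset.sum_congr rfl fun f _ ↦ ?_
  rw [mul_right_comm, ← map_mul, ← Algebra.smul_def, map_smul, Algebra.smul_def, map_mul,
    mul_right_comm]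

/-- Both sides are linear over S in the matrix, so matrix units suffice, and these have complex
entries. -/
lemma commute_extMat_tensDer {Q : Matrix (ι → n) (ι → n) ℂ}
    (hQ : ∀ A : Matrix n n ℂ, Commute Q (tensDer ι A)) (X : Matrix n n S) :
    Commute (extMat S Q) (tensDer ι X) := by
  have hext : ∀ A : Matrix n n ℂ, extMat S (tensDer ι A) = tensDer ι (extMat S A) := fun A ↦ by
    ext f g
    simp only [tensDer_apply, Matrix.map_apply, Matrix.sum_apply, map_sum, slot_apply_ite]
    exact Finset.sum_congr rfl fun l _ ↦ by split_ifs <;> simp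
  rw [Matrix.matrix_eq_sum_single X]
  simp only [map_sum]
  refine Commute.sum_right _ _ _ fun a _ ↦ Commute.sum_right _ _ _ fun b _ ↦ ?_
  have h : (Matrix.single a b (X a b) : Matrix n n S)
      = X a b • extMat S (Matrix.single a b (1 : ℂ)) := by
    ext c d
    simp [Matrix.single_apply]
  rw [h, map_smul, ← hext]
  refine Commute.smul_right ?_ _
  simp only [Commute, SemiconjBy, ← extMat_mul, (hQ _).eq]

variable [Algebra ℚ S] [IsScalarTower ℚ ℂ S]

/-- Scaling the curvature by c scales the degree j component by c^j: this is the Chern character of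
the Adams operation ψ^c. -/
lemma trace_exp {B : Matrix n n S} {N : ℕ} (hB : B ^ N = 0) (c : ℕ) :
    (IsNilpotent.exp (c • B)).trace
      = ∑ j ∈ Finset.range N, ((c : ℂ) ^ j) • ((j.factorial : ℂ)⁻¹ • (B ^ j).trace) := by
  have h : (c • B) ^ N = 0 := by rw [smul_pow, hB, smul_zero]
  rw [IsNilpotent.exp_eq_sum h, Matrix.trace_sum]
  refine Finset.sum_congr rfl fun j _ ↦ ?_
  rw [Matrix.trace_smul, smul_pow, Matrix.trace_smul, smul_comm, ← Nat.cast_smul_eq_nsmul ℂ,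
    Nat.cast_pow]
  congr 1
  rw [← algebraMap_smul ℂ ((j.factorial : ℚ)⁻¹)]
  simp

omit [Algebra ℂ S] [Algebra ℚ S] [IsScalarTower ℚ ℂ S] in
lemma compress_pow {K : Type*} [Fintype K] [DecidableEq K] {N : Type*} [Fintype N] [DecidableEq N]
    {J : Matrix N K S} {J' : Matrix K N S} (hJ : J' * J = 1) {D : Matrix N N S}
    (hD : Commute (J * J') D) (j : ℕ) : (J' * D * J) ^ j = J' * D ^ j * J := by
  induction j with
  | zero => rw [pow_zero, pow_zero, Matrix.mul_one, hJ]
  | succ j ih =>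
    rw [pow_succ, ih]
    calc J' * D ^ j * J * (J' * D * J) = J' * D ^ j * (J * J' * D) * J := by
          simp only [Matrix.mul_assoc]
      _ = J' * D ^ j * (D * (J * J')) * J := by rw [hD.eq]
      _ = J' * (D ^ j * D) * J * (J' * J) := by simp only [Matrix.mul_assoc]
      _ = J' * D ^ (j + 1) * J := by rw [hJ, Matrix.mul_one, pow_succ]

-- The projection commutes with the derivation, so the compression passes through every term of the
-- exponential series; cyclicity of the trace and `exp_tensDer` finish.
omit [IsScalarTower ℚ ℂ S] in
lemma trace_exp_compress {K : Type*} [Fintype K] [DecidableEq K] {J : Matrix (ι → n) K ℂ}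
    (hJ : Jᴴ * J = 1) (hD : ∀ A : Matrix n n ℂ, Commute (J * Jᴴ) (tensDer ι A))
    {B : Matrix n n S} (hB : IsNilpotent B) :
    (IsNilpotent.exp (compressDer J B)).trace
      = (extMat S (J * Jᴴ) * tens fun _ : ι ↦ IsNilpotent.exp B).trace := by
  obtain ⟨⟨N, hN⟩, hexp⟩ := exp_tensDer (ι := ι) hB
  have hJ' : extMat S Jᴴ * extMat S J = 1 := by rw [← extMat_mul, hJ, extMat_one]
  have hc : Commute (extMat S J * extMat S Jᴴ) (tensDer ι B) := by
    rw [← extMat_mul]; exact commute_extMat_tensDer hD B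
  rw [compressDer, ← hexp, IsNilpotent.exp_eq_sum hN, IsNilpotent.exp_eq_sum (k := N)
    (by rw [compress_pow hJ' hc, hN, Matrix.mul_zero, Matrix.zero_mul]), Matrix.trace_sum,
    Matrix.mul_sum, Matrix.trace_sum]
  refine Finset.sum_congr rfl fun j _ ↦ ?_
  rw [compress_pow hJ' hc, Matrix.mul_smul, Matrix.trace_smul, Matrix.trace_smul,
    Matrix.trace_mul_comm, ← Matrix.mul_assoc, ← extMat_mul]

omit [IsScalarTower ℚ ℂ S] in
/-- Products of Adams operations are combinations of honest bundles: the identity for Chern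
characters. -/
lemma sum_trace_exp_compress {κ : Type*} [Fintype κ] [DecidableEq κ] (k : κ → ℕ) {Λ : Finset ℝ}
    {s : ℝ → ℕ} {J : ∀ t, Matrix ((Σ i, Fin (k i + 1)) → n) (Fin (s t)) ℂ}
    (hJ : ∀ t, (J t)ᴴ * J t = 1)
    (hD : ∀ t, ∀ A : Matrix n n ℂ, Commute (J t * (J t)ᴴ) (tensDer _ A))
    (hH : permTens n ℂ (cycles k) + permTens n ℂ (cycles k)⁻¹
      = ∑ t ∈ Λ, (t : ℂ) • (J t * (J t)ᴴ))
    {B : Matrix n n S} (hB : IsNilpotent B) :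
    ∑ t ∈ Λ, (t : ℂ) • ((IsNilpotent.exp (compressDer (J t) B)).trace
        - (s t : S))
      = 2 * ((∏ i, (IsNilpotent.exp ((k i + 1) • B)).trace)
        - (Fintype.card n : S) ^ Fintype.card κ) := by
  have h1 : ∑ t ∈ Λ, (t : ℂ) •
      (IsNilpotent.exp (compressDer (J t) B)).trace
      = 2 * ∏ i, (IsNilpotent.exp ((k i + 1) • B)).trace := by
    have h2 : ∑ t ∈ Λ, (t : ℂ) • extMat S (J t * (J t)ᴴ)
        = permTens n S (cycles k) + permTens n S (cycles k)⁻¹ := by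
      rw [← extMat_permTens (cycles k), ← extMat_permTens (cycles k)⁻¹,
        ← Matrix.map_add _ (map_add _), hH]
      ext f g
      simp only [Matrix.sum_apply, Matrix.smul_apply, Matrix.map_apply, map_sum]
      exact Finset.sum_congr rfl fun t _ ↦ by rw [Algebra.smul_def, smul_eq_mul, map_mul]
    simp only [trace_exp_compress (hJ _) (hD _) hB, ← Matrix.trace_smul, ← Matrix.trace_sum,
      ← Matrix.smul_mul, ← Matrix.sum_mul, h2]
    rw [Matrix.add_mul, Matrix.trace_add, trace_permTens_cycles, trace_permTens_cycles_inv,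
      two_mul]
    simp only [exp_pow_of_isNilpotent hB]
  -- The ranks satisfy the same identity: s t is the trace of the projection, and the cycle formulas
  -- are evaluated at the identity matrix.
  have h3 : ∑ t ∈ Λ, (t : ℂ) • (s t : S) = 2 * (Fintype.card n : S) ^ Fintype.card κ := by
    have h4 : ∀ t, (s t : ℂ) = (J t * (J t)ᴴ).trace := fun t ↦ by
      rw [Matrix.trace_mul_comm, hJ, Matrix.trace_one, Fintype.card_fin]
    have h5 : ∑ t ∈ Λ, (t : ℂ) * (s t : ℂ) = 2 * (Fintype.card n : ℂ) ^ Fintype.card κ := by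
      simp only [h4, ← smul_eq_mul (a := ((_ : ℝ) : ℂ)), ← Matrix.trace_smul, ← Matrix.trace_sum]
      rw [← hH, Matrix.trace_add]
      have h6 := trace_permTens_cycles k (1 : Matrix n n ℂ)
      have h7 := trace_permTens_cycles_inv k (1 : Matrix n n ℂ)
      rw [show (fun _ : (Σ i, Fin (k i + 1)) ↦ (1 : Matrix n n ℂ)) = 1 from rfl, tens_one,
        Matrix.mul_one] at h6 h7
      rw [h6, h7]
      simp [two_mul]
    have := congr_arg (algebraMap ℂ S) h5
    simpa [Algebra.smul_def, map_ofNat] using this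
  simp only [smul_sub, Finset.sum_sub_distrib, h1, h3, mul_sub]

end TraceIdentity

/-! ### Chern forms as elements of a commutative ring -/

section ChernRing

open Matrix Polynomial

/-- The center of the exterior algebra, which contains all forms of degree two. -/
abbrev EvenExt (n : ℕ) := Subalgebra.center ℂ (Ext n)

/-- Rational scalars are needed for `IsNilpotent.exp`; taking them through ℂ makes them compatible
with the complex structure. -/
instance ratAlgebraEvenExt (n : ℕ) : Algebra ℚ (EvenExt n) :=
  Algebra.compHom _ (algebraMap ℚ ℂ)

instance isScalarTowerEvenExt (n : ℕ) : IsScalarTower ℚ ℂ (EvenExt n) :=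
  IsScalarTower.of_algebraMap_eq fun _ ↦ rfl

/-- The linear map `toExt 2` with values in the center. -/
def toEvenExt (n : ℕ) : ((Fin 2 → Model n) → ℂ) →ₗ[ℂ] EvenExt n where
  toFun f := ⟨toExt 2 f, toExt_two_mem_center f⟩
  map_add' f g := Subtype.ext (toExt_add 2 f g)
  map_smul' c f := Subtype.ext (toExt_smul 2 c f)

/-- The forms of degree `2 j`. -/
def evenDeg (n j : ℕ) : Submodule ℂ (EvenExt n) :=
  (⋀[ℂ]^(2 * j) (Model n →L[ℝ] ℂ)).comap (EvenExt n).val.toLinearMap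

lemma one_mem_evenDeg {n : ℕ} : (1 : EvenExt n) ∈ evenDeg n 0 :=
  SetLike.GradedOne.one_mem (A := fun d : ℕ ↦ ⋀[ℂ]^d (Model n →L[ℝ] ℂ))

lemma mul_mem_evenDeg {n i j : ℕ} {x y : EvenExt n} (hx : x ∈ evenDeg n i) (hy : y ∈ evenDeg n j) :
    x * y ∈ evenDeg n (i + j) := by
  rw [evenDeg, Submodule.mem_comap, mul_add]
  exact SetLike.GradedMul.mul_mem (A := fun d : ℕ ↦ ⋀[ℂ]^d (Model n →L[ℝ] ℂ)) hx hy

variable {n : ℕ} [NeZero n] {M : Type*} [TopologicalSpace M]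
  [ChartedSpace (EuclideanHalfSpace n) M] [IsManifold (𝓡∂ n) ∞ M]

namespace HermitianBundle

variable (E : HermitianBundle n M)

/-- The matrix `(i / 2π) R` of forms of degree two, over the commutative ring `EvenExt n`. -/
def normCurv (x : M) : Matrix (Fin E.rank) (Fin E.rank) (EvenExt n) :=
  Matrix.of fun a b ↦ (Complex.I / (2 * Real.pi)) • toEvenExt n fun v : Fin 2 → Model n ↦
    mat E.rank (E.curvature x (v 0) (v 1)) a b

lemma map_normCurv (x : M) :
    (E.normCurv x).map (EvenExt n).val = (Complex.I / (2 * Real.pi)) • E.curvatureMatrix x := by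
  ext a b
  simp only [normCurv, Matrix.map_apply, Matrix.of_apply, map_smul, Matrix.smul_apply,
    curvatureMatrix, mat_apply]
  rfl

lemma normCurv_mem (x : M) (a b : Fin E.rank) : E.normCurv x a b ∈ evenDeg n 1 := by
  have h : ∀ f, toEvenExt n f ∈ evenDeg n 1 := fun f ↦ toExt_mem 2 f
  exact Submodule.smul_mem _ _ (h _)

lemma normCurv_pow_mem (x : M) (j : ℕ) (a b : Fin E.rank) :
    (E.normCurv x ^ j) a b ∈ evenDeg n j := by
  induction j generalizing b with
  | zero =>
    rw [pow_zero, Matrix.one_apply]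
    split_ifs
    · exact one_mem_evenDeg
    · exact Submodule.zero_mem _
  | succ j ih =>
    rw [pow_succ, Matrix.mul_apply]
    exact Submodule.sum_mem _ fun c _ ↦ mul_mem_evenDeg (ih c) (E.normCurv_mem x c b)

lemma normCurv_pow_eq_zero (x : M) {N : ℕ} (hN : n < 2 * N) : E.normCurv x ^ N = 0 :=
  Matrix.ext fun a b ↦ Subtype.ext (eq_zero_of_mem_exteriorPower hN (E.normCurv_pow_mem x N a b))

/-- The Chern character form as an element of `EvenExt n`. -/
def chernCharacterEven (j : ℕ) (x : M) : EvenExt n :=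
  ((j.factorial : ℂ))⁻¹ • (E.normCurv x ^ j).trace

lemma coe_chernCharacterEven (j : ℕ) (x : M) :
    (E.chernCharacterEven j x : Ext n) = E.chernCharacter j x := by
  rw [chernCharacterEven, chernCharacter, ← map_normCurv, Subalgebra.coe_smul]
  congr 1
  have h : (E.normCurv x).map (EvenExt n).val ^ j
      = (E.normCurv x ^ j).map (EvenExt n).val :=
    (Matrix.map_pow (E.normCurv x) (EvenExt n).val.toRingHom j).symm
  rw [h]
  exact AddMonoidHom.map_trace (EvenExt n).val _

lemma chernCharacter_zero (x : M) : E.chernCharacter 0 x = (E.rank : Ext n) := by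
  simp [chernCharacter, Matrix.trace_one]

lemma sum_chernCharacterEven (x : M) {N : ℕ} (hN : n < 2 * N) (c : ℕ) :
    (IsNilpotent.exp (c • E.normCurv x)).trace
      = ∑ j ∈ Finset.range N, ((c : ℂ) ^ j) • E.chernCharacterEven j x :=
  trace_exp (E.normCurv_pow_eq_zero x hN) c

/-- The coefficients of `det (1 + t (i / 2π) R)`. -/
def chernEven (j : ℕ) (x : M) : EvenExt n :=
  (det (1 + (X : (EvenExt n)[X]) • (E.normCurv x).map C)).coeff j

/-- Polynomials whose coefficient of X^l has degree 2l for every l form a subring. It contains the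
entries of 1 + X (i / 2π) R, hence their determinant. -/
lemma chernEven_mem (j : ℕ) (x : M) : E.chernEven j x ∈ evenDeg n j := by
  let T : Subring (EvenExt n)[X] :=
    { carrier := {p | ∀ l, p.coeff l ∈ evenDeg n l}
      mul_mem' := fun {p q} hp hq l ↦ by
        rw [Polynomial.coeff_mul]
        refine Submodule.sum_mem _ fun i hi ↦ ?_
        rw [← Finset.HasAntidiagonal.mem_antidiagonal.1 hi]
        exact mul_mem_evenDeg (hp _) (hq _)
      one_mem' := fun l ↦ by
        rw [Polynomial.coeff_one]
        split_ifs with h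
        · subst h
          exact one_mem_evenDeg
        · exact Submodule.zero_mem _
      add_mem' := fun {p q} hp hq l ↦ by
        rw [Polynomial.coeff_add]; exact Submodule.add_mem _ (hp l) (hq l)
      zero_mem' := fun l ↦ by rw [Polynomial.coeff_zero]; exact Submodule.zero_mem _
      neg_mem' := fun {p} hp l ↦ by
        have h := Submodule.neg_mem _ (hp l)
        convert! h using 1 }
  have h : det (1 + (X : (EvenExt n)[X]) • (E.normCurv x).map C) ∈ T := by
    rw [Matrix.det_apply]
    refine Subring.sum_mem _ fun σ _ ↦ ?_
    rw [Units.smul_def]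
    refine Subring.zsmul_mem _ (Subring.prod_mem _ fun a _ ↦ ?_) _
    rw [Matrix.add_apply]
    refine Subring.add_mem _ ?_ fun l ↦ ?_
    · rw [Matrix.one_apply]
      split_ifs
      exacts [Subring.one_mem _, Subring.zero_mem _]
    · rw [Matrix.smul_apply, Matrix.map_apply, smul_eq_mul, mul_comm, coeff_C_mul, coeff_X]
      split_ifs with h1
      · subst h1
        simpa using E.normCurv_mem x _ _
      · rw [mul_zero]
        exact Submodule.zero_mem _
  exact h j

lemma totalChernForm_eq (x : M) :
    E.totalChernForm x = ((1 + E.normCurv x).det : Ext n) := by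
  have h0 : (1 + (Complex.I / (2 * Real.pi)) • E.curvatureMatrix x)
      = (1 + E.normCurv x).map (EvenExt n).val := by
    rw [← map_normCurv]
    ext a b
    by_cases h : a = b <;> simp [h]
  -- The transpose matches the convention of the Leibniz formula with entries a, σ a.
  rw [totalChernForm, ← Matrix.det_transpose, Matrix.det_apply', h0]
  change _ = (EvenExt n).val _
  rw [map_sum]
  refine Finset.sum_congr rfl fun σ _ ↦ ?_
  rw [map_mul, map_intCast, zsmul_eq_mul, ← List.prod_ofFn, map_list_prod, List.map_ofFn]
  rfl

lemma coe_chernEven (j : ℕ) (x : M) : (E.chernEven j x : Ext n) = E.chernForm j x := by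
  set p := det (1 + (X : (EvenExt n)[X]) • (E.normCurv x).map C) with hp
  -- The range is lengthened by j so that it contains the index j even beyond the degree of p.
  have h1 : E.totalChernForm x = ∑ l ∈ Finset.range (p.natDegree + 1 + j), (p.coeff l : Ext n) := by
    rw [totalChernForm_eq, ← eval_one_det_one_add, ← hp,
      eval_eq_sum_range' (n := p.natDegree + 1 + j) (by omega)]
    change (EvenExt n).val _ = _
    rw [map_sum]
    simp
  rw [chernForm, h1, map_sum, Finset.sum_eq_single j]
  · rw [GradedRing.proj_apply]
    exact (DirectSum.decompose_of_mem_same (ℳ := fun d : ℕ ↦ ⋀[ℂ]^d (Model n →L[ℝ] ℂ))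
      (E.chernEven_mem j x)).symm
  · intro l _ hl
    rw [GradedRing.proj_apply]
    exact DirectSum.decompose_of_mem_ne (ℳ := fun d : ℕ ↦ ⋀[ℂ]^d (Model n →L[ℝ] ℂ))
      (E.chernEven_mem l x) (by omega)
  · intro h
    exact absurd (Finset.mem_range.2 (by omega)) h

lemma chernEven_zero (x : M) : E.chernEven 0 x = 1 := coeff_zero_det_one_add _

/-- The power sum tr ((i / 2π) R)^{j+1} is (j+1)! ch_{j+1}, which accounts for the factorials. -/
lemma newton_chernEven (k : ℕ) (x : M) :
    (k + 1 : ℂ) • E.chernEven (k + 1) x = ∑ j ∈ Finset.range (k + 1),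
      ((-1) ^ j * ((j + 1).factorial : ℂ)) •
        (E.chernEven (k - j) x * E.chernCharacterEven (j + 1) x) := by
  have h := newton_coeff_det (E.normCurv x) k
  rw [Algebra.smul_def, map_add, map_natCast, map_one]
  refine h.trans (Finset.sum_congr rfl fun j _ ↦ ?_)
  have h2 : ((j + 1).factorial : ℂ) ≠ 0 := Nat.cast_ne_zero.2 (Nat.factorial_ne_zero _)
  rw [chernCharacterEven, mul_smul_comm, smul_smul, mul_assoc ((-1 : ℂ) ^ j), mul_inv_cancel₀ h2,
    mul_one, Algebra.smul_def ((-1 : ℂ) ^ j), map_pow, map_neg, map_one, mul_assoc]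
  rfl

end HermitianBundle

end ChernRing

/-! ### Gauge covariance and chart independence of the curvature -/

section Gauge

lemma two_le_infty : (2 : WithTop ℕ∞) ≤ ((⊤ : ℕ∞) : WithTop ℕ∞) :=
  WithTop.coe_le_coe.2 (le_top : (2 : ℕ∞) ≤ ⊤)

lemma extDerivWithin_one_apply {V F : Type*} [NormedAddCommGroup V] [NormedSpace ℝ V]
    [NormedAddCommGroup F] [NormedSpace ℝ F] {A : V → V [⋀^Fin 1]→L[ℝ] F} {s : Set V} {y : V}
    (hA : DifferentiableWithinAt ℝ A s y) (hs : UniqueDiffWithinAt ℝ s y) (u v : V) :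
    extDerivWithin A s y ![u, v]
      = fderivWithin ℝ (fun z ↦ A z ![v]) s y u - fderivWithin ℝ (fun z ↦ A z ![u]) s y v := by
  have h0 : (0 : Fin 2).removeNth ![u, v] = ![v] := by
    ext i; fin_cases i; rfl
  have h1 : (1 : Fin 2).removeNth ![u, v] = ![u] := by
    ext i; fin_cases i; rfl
  rw [extDerivWithin_apply hA hs, Fin.sum_univ_two, h0, h1]
  simp [sub_eq_add_neg]

/-- The transformation law of the curvature of a connection form under a change of gauge. -/
lemma curvature_gauge {V 𝒜 : Type*} [NormedAddCommGroup V] [NormedSpace ℝ V] [NormedRing 𝒜]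
    [NormedAlgebra ℝ 𝒜] {s : Set V} (hs : UniqueDiffOn ℝ s) {y : V} (hy : y ∈ s)
    (hc : y ∈ closure (interior s)) {g : V → 𝒜} {A B : V → V [⋀^Fin 1]→L[ℝ] 𝒜}
    (hg : ContDiffWithinAt ℝ ∞ g s y) (hA : DifferentiableWithinAt ℝ A s y)
    (hB : DifferentiableWithinAt ℝ B s y)
    (h : ∀ᶠ z in 𝓝[s] y, ∀ v, fderivWithin ℝ g s z v + B z ![v] * g z = g z * A z ![v]) (u v : V) :
    (extDerivWithin B s y ![u, v] + (B y ![u] * B y ![v] - B y ![v] * B y ![u])) * g y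
      = g y * (extDerivWithin A s y ![u, v] + (A y ![u] * A y ![v] - A y ![v] * A y ![u])) := by
  have hsy := hs y hy
  have hgd : DifferentiableWithinAt ℝ g s y := hg.differentiableWithinAt (by simp)
  have hsymm : IsSymmSndFDerivWithinAt ℝ g s y :=
    hg.isSymmSndFDerivWithinAt
      (by rw [minSmoothness_of_isRCLikeNormedField]; exact two_le_infty) hs hc hy
  have hd2 : DifferentiableWithinAt ℝ (fderivWithin ℝ g s) s y :=
    (hg.fderivWithin_right (m := 1) hs two_le_infty hy).differentiableWithinAt one_ne_zero
  have hAv : ∀ w, DifferentiableWithinAt ℝ (fun z ↦ A z ![w]) s y := fun w ↦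
    hA.continuousAlternatingMap_apply_const _
  have hBv : ∀ w, DifferentiableWithinAt ℝ (fun z ↦ B z ![w]) s y := fun w ↦
    hB.continuousAlternatingMap_apply_const _
  have h0 : ∀ w, fderivWithin ℝ g s y w = g y * A y ![w] - B y ![w] * g y := fun w ↦
    eq_sub_of_add_eq (h.self_of_nhdsWithin hy w)
  -- This is the derivative of the gauge equation dg = gA − Bg in the direction u.
  have key : ∀ u w, fderivWithin ℝ (fderivWithin ℝ g s) s y u w
      = g y * fderivWithin ℝ (fun z ↦ A z ![w]) s y u + fderivWithin ℝ g s y u * A y ![w]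
        - (B y ![w] * fderivWithin ℝ g s y u
          + fderivWithin ℝ (fun z ↦ B z ![w]) s y u * g y) := fun u w ↦ by
    have e1 : fderivWithin ℝ (fun z ↦ fderivWithin ℝ g s z w) s y u
        = fderivWithin ℝ (fderivWithin ℝ g s) s y u w := by
      rw [fderivWithin_clm_apply hsy hd2 (differentiableWithinAt_const _)]
      simp
    have e2 : (fun z ↦ fderivWithin ℝ g s z w) =ᶠ[𝓝[s] y]
        fun z ↦ g z * A z ![w] - B z ![w] * g z := by
      filter_upwards [h] with z hz using eq_sub_of_add_eq (hz w)
    rw [← e1, e2.fderivWithin_eq (e2.self_of_nhdsWithin hy),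
      fderivWithin_fun_sub hsy (hgd.fun_mul (hAv w)) ((hBv w).fun_mul hgd),
      fderivWithin_fun_mul' hsy hgd (hAv w), fderivWithin_fun_mul' hsy (hBv w) hgd]
    simp
  -- Symmetry of the second derivative of g removes it from the antisymmetrised equation;
  -- substituting dg = gA − Bg leaves the two curvatures.
  have hs2 := hsymm u v
  rw [key, key, h0 u, h0 v] at hs2
  rw [extDerivWithin_one_apply hA hsy, extDerivWithin_one_apply hB hsy, ← sub_eq_zero]
  rw [← sub_eq_zero] at hs2
  rw [← neg_eq_zero, ← hs2]
  noncomm_ring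

end Gauge

/-! ### Change of charts for differential forms -/

section Chart

variable {n : ℕ} [NeZero n] {M : Type*} [TopologicalSpace M]
  [ChartedSpace (EuclideanHalfSpace n) M] [IsManifold (𝓡∂ n) ∞ M]

local instance isManifoldOne : IsManifold (𝓡∂ n) 1 M := IsManifold.of_le (n := ∞) (by simp)

omit [IsManifold (𝓡∂ n) ∞ M] in
lemma eventually_symm_mem {c x : M} (hx : x ∈ (extChartAt (𝓡∂ n) c).source) {U : Set M}
    (hU : U ∈ 𝓝 x) :
    ∀ᶠ z in 𝓝[Set.range (𝓡∂ n)] (extChartAt (𝓡∂ n) c x), z ∈ (extChartAt (𝓡∂ n) c).target ∧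
      (extChartAt (𝓡∂ n) c).symm z ∈ U := by
  have h1 : ∀ᶠ z in 𝓝[Set.range (𝓡∂ n)] (extChartAt (𝓡∂ n) c x), z ∈ (extChartAt (𝓡∂ n) c).target :=
    extChartAt_target_mem_nhdsWithin' hx
  refine h1.and (mem_nhdsWithin_of_mem_nhds ?_)
  refine (continuousAt_extChartAt_symm' hx).preimage_mem_nhds ?_
  rwa [(extChartAt (𝓡∂ n) c).left_inv hx]

lemma contDiffWithinAt_transition {c c' x : M} (hc : x ∈ (extChartAt (𝓡∂ n) c).source)
    (hc' : x ∈ (extChartAt (𝓡∂ n) c').source) :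
    ContDiffWithinAt ℝ ∞ (extChartAt (𝓡∂ n) c' ∘ (extChartAt (𝓡∂ n) c).symm)
      (Set.range (𝓡∂ n)) (extChartAt (𝓡∂ n) c x) := by
  apply contDiffWithinAt_ext_coord_change
  rw [PartialEquiv.trans_source'', PartialEquiv.symm_symm, PartialEquiv.symm_target]
  exact Set.mem_image_of_mem _ ⟨hc, hc'⟩

omit [IsManifold (𝓡∂ n) ∞ M] in
lemma mapsTo_extChartAt_range (c : M) (f : Model n → M) (s : Set (Model n)) :
    Set.MapsTo (extChartAt (𝓡∂ n) c ∘ f) s (Set.range (𝓡∂ n)) := fun z _ ↦ by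
  simp [extChartAt]

lemma fderivWithin_comp_symm {F : Type*} [NormedAddCommGroup F] [NormedSpace ℝ F] {g : M → F}
    {c p : M} (hp : p ∈ (extChartAt (𝓡∂ n) c).source)
    (hg : MDifferentiableAt (𝓡∂ n) 𝓘(ℝ, F) g p) (v : Model n) :
    fderivWithin ℝ (g ∘ (extChartAt (𝓡∂ n) c).symm) (Set.range (𝓡∂ n)) (extChartAt (𝓡∂ n) c p) v
      = mvfderiv (𝓡∂ n) g p (tangentCoordChange (𝓡∂ n) c p p v) := by
  have hpp := mem_extChartAt_source (I := 𝓡∂ n) p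
  have hun := uniqueDiffWithinAt_range (n := n) c p hp
  have hev := eventually_symm_mem hp (extChartAt_source_mem_nhds (I := 𝓡∂ n) p)
  have heq : g ∘ (extChartAt (𝓡∂ n) c).symm =ᶠ[𝓝[Set.range (𝓡∂ n)] (extChartAt (𝓡∂ n) c p)]
      (g ∘ (extChartAt (𝓡∂ n) p).symm) ∘ (extChartAt (𝓡∂ n) p ∘ (extChartAt (𝓡∂ n) c).symm) := by
    filter_upwards [hev] with z hz
    simp only [Function.comp_apply, (extChartAt (𝓡∂ n) p).left_inv hz.2]
  have h1 : HasFDerivWithinAt (g ∘ (extChartAt (𝓡∂ n) p).symm) (mvfderiv (𝓡∂ n) g p)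
      (Set.range (𝓡∂ n)) (extChartAt (𝓡∂ n) p p) := by
    exact hg.hasMFDerivAt.2
  have h2 := hasFDerivWithinAt_tangentCoordChange (I := 𝓡∂ n) (x := c) (y := p) (z := p) ⟨hp, hpp⟩
  have h3 : (extChartAt (𝓡∂ n) p ∘ (extChartAt (𝓡∂ n) c).symm) (extChartAt (𝓡∂ n) c p)
      = extChartAt (𝓡∂ n) p p := by
    simp only [Function.comp_apply, (extChartAt (𝓡∂ n) c).left_inv hp]
  rw [heq.fderivWithin_eq (heq.self_of_nhdsWithin (extChartAt_target_subset_range c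
    ((extChartAt (𝓡∂ n) c).map_source hp)))]
  have h4 := HasFDerivWithinAt.comp (extChartAt (𝓡∂ n) c p) (by rw [h3]; exact h1) h2
    (mapsTo_extChartAt_range p _ _)
  rw [h4.fderivWithin hun]
  rfl

/-- The cocycle rule for `tangentCoordChange` presents one local expression as the pullback of
another under the transition map, the form needed for naturality of the exterior derivative. -/
lemma inChart_eventuallyEq {k : ℕ} {W : Type*} [NormedAddCommGroup W] [NormedSpace ℝ W]
    (η : DiffForm n k M W) {c x : M} (hx : x ∈ (extChartAt (𝓡∂ n) c).source) :
    η.inChart c =ᶠ[𝓝[Set.range (𝓡∂ n)] (extChartAt (𝓡∂ n) c x)] fun z ↦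
      (η.inChart x ((extChartAt (𝓡∂ n) x ∘ (extChartAt (𝓡∂ n) c).symm) z)).compContinuousLinearMap
        (fderivWithin ℝ (extChartAt (𝓡∂ n) x ∘ (extChartAt (𝓡∂ n) c).symm)
          (Set.range (𝓡∂ n)) z) := by
  filter_upwards [eventually_symm_mem hx (extChartAt_source_mem_nhds (I := 𝓡∂ n) x)] with z hz
  set p := (extChartAt (𝓡∂ n) c).symm z with hp
  have hpc : p ∈ (extChartAt (𝓡∂ n) c).source := (extChartAt (𝓡∂ n) c).map_target hz.1
  have hz' : extChartAt (𝓡∂ n) c p = z := (extChartAt (𝓡∂ n) c).right_inv hz.1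
  have hd : fderivWithin ℝ (extChartAt (𝓡∂ n) x ∘ (extChartAt (𝓡∂ n) c).symm)
      (Set.range (𝓡∂ n)) z = tangentCoordChange (𝓡∂ n) c x p := by
    rw [tangentCoordChange_def, hz']
  rw [hd]
  have hxp : (extChartAt (𝓡∂ n) x).symm ((extChartAt (𝓡∂ n) x ∘ (extChartAt (𝓡∂ n) c).symm) z) = p :=
    (extChartAt (𝓡∂ n) x).left_inv hz.2
  simp only [DiffForm.inChart]
  rw [hxp, ← hp]
  ext v
  simp only [ContinuousAlternatingMap.compContinuousLinearMap_apply]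
  exact congr_arg (η p) (funext fun l ↦
    (tangentCoordChange_comp ⟨⟨hpc, hz.2⟩, mem_extChartAt_source p⟩).symm)

/-- The exterior derivative does not depend on the chart in which it is computed. -/
lemma DiffForm.SmoothOn.d_apply_tangentCoordChange {k : ℕ} {W : Type*} [NormedAddCommGroup W]
    [NormedSpace ℝ W] {η : DiffForm n k M W} {U : Set M} (hη : η.SmoothOn U) (hU : IsOpen U)
    {c x : M} (hxU : x ∈ U) (hx : x ∈ (extChartAt (𝓡∂ n) c).source) (v : Fin (k + 1) → Model n) :
    η.d x (fun l ↦ tangentCoordChange (𝓡∂ n) c x x (v l))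
      = extDerivWithin (η.inChart c) (Set.range (𝓡∂ n)) (extChartAt (𝓡∂ n) c x) v := by
  have hxx := mem_extChartAt_source (I := 𝓡∂ n) x
  have hxr : extChartAt (𝓡∂ n) c x ∈ Set.range (𝓡∂ n) :=
    extChartAt_target_subset_range c ((extChartAt (𝓡∂ n) c).map_source hx)
  have heq := inChart_eventuallyEq η hx
  have h3 : (extChartAt (𝓡∂ n) x ∘ (extChartAt (𝓡∂ n) c).symm) (extChartAt (𝓡∂ n) c x)
      = extChartAt (𝓡∂ n) x x := by
    simp only [Function.comp_apply, (extChartAt (𝓡∂ n) c).left_inv hx]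
  have hd : DifferentiableWithinAt ℝ (η.inChart x) (Set.range (𝓡∂ n))
      ((extChartAt (𝓡∂ n) x ∘ (extChartAt (𝓡∂ n) c).symm) (extChartAt (𝓡∂ n) c x)) := by
    rw [h3]
    exact (hη.contDiffWithinAt hU hxU hxx).differentiableWithinAt (by simp)
  rw [heq.extDerivWithin_eq (heq.self_of_nhdsWithin hxr),
    extDerivWithin_pullback hd (contDiffWithinAt_transition hx hxx)
      (by rw [minSmoothness_of_isRCLikeNormedField]; exact two_le_infty)
      (𝓡∂ n).uniqueDiffOn ((𝓡∂ n).range_subset_closure_interior hxr) hxr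
      (mapsTo_extChartAt_range x _ _), h3]
  rfl

end Chart

/-! ### The curvature in a fixed chart and a fixed frame -/

section LocalCurvature

variable {n : ℕ} [NeZero n] {M : Type*} [TopologicalSpace M]
  [ChartedSpace (EuclideanHalfSpace n) M] [IsManifold (𝓡∂ n) ∞ M]

lemma contDiffWithinAt_alternating_apply {X V W : Type*} [NormedAddCommGroup X] [NormedSpace ℝ X]
    [NormedAddCommGroup V] [NormedSpace ℝ V] [NormedAddCommGroup W] [NormedSpace ℝ W] {k : ℕ}
    {r : WithTop ℕ∞} {F : X → V [⋀^Fin k]→L[ℝ] W} {s : Set X} {y : X}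
    (hF : ContDiffWithinAt ℝ r F s y) (v : Fin k → V) :
    ContDiffWithinAt ℝ r (fun y ↦ F y v) s y :=
  (ContinuousAlternatingMap.apply ℝ V W v).contDiff.comp_contDiffWithinAt hF

/-- The bilinear map `A(v₀) A(v₁) - A(v₁) A(v₀)`. -/
def commMulti {V 𝒜 : Type*} [AddCommGroup V] [Module ℝ V] [Ring 𝒜] [Algebra ℝ 𝒜] (A : V →ₗ[ℝ] 𝒜) :
    MultilinearMap ℝ (fun _ : Fin 2 ↦ V) 𝒜 :=
  (MultilinearMap.mkPiAlgebraFin ℝ 2 𝒜).compLinearMap (fun _ ↦ A)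
    - ((MultilinearMap.mkPiAlgebraFin ℝ 2 𝒜).compLinearMap fun _ ↦ A).domDomCongr (Equiv.swap 0 1)

lemma commMulti_apply {V 𝒜 : Type*} [AddCommGroup V] [Module ℝ V] [Ring 𝒜] [Algebra ℝ 𝒜]
    (A : V →ₗ[ℝ] 𝒜) (v : Fin 2 → V) :
    commMulti A v = A (v 0) * A (v 1) - A (v 1) * A (v 0) := by
  simp [commMulti]

lemma inChart_apply {k : ℕ} {W : Type*} [NormedAddCommGroup W] [NormedSpace ℝ W]
    (η : DiffForm n k M W) {c x : M} (hx : x ∈ (extChartAt (𝓡∂ n) c).source)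
    (v : Fin k → Model n) :
    η.inChart c (extChartAt (𝓡∂ n) c x) v
      = η x fun l ↦ tangentCoordChange (𝓡∂ n) c x x (v l) := by
  rw [DiffForm.inChart, (extChartAt (𝓡∂ n) c).left_inv hx]
  rfl

lemma inChart_one_apply {W : Type*} [NormedAddCommGroup W] [NormedSpace ℝ W]
    (η : DiffForm n 1 M W) {c x : M} (hx : x ∈ (extChartAt (𝓡∂ n) c).source) (v : Model n) :
    η.inChart c (extChartAt (𝓡∂ n) c x) ![v] = η x ![tangentCoordChange (𝓡∂ n) c x x v] := by
  rw [inChart_apply η hx]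
  congr 1
  ext1 l
  fin_cases l
  rfl

namespace HermitianBundle

variable (E : HermitianBundle n M)

/-- The curvature in the `i`-th frame and the chart around `c`. -/
def chartCurvature (c : M) (i : E.ι) (y : Model n) (u v : Model n) : EndC E.rank :=
  extDerivWithin ((E.conn i).inChart c) (Set.range (𝓡∂ n)) y ![u, v]
    + ((E.conn i).inChart c y ![u] * (E.conn i).inChart c y ![v]
      - (E.conn i).inChart c y ![v] * (E.conn i).inChart c y ![u])

/-- The derivative `d` uses the preferred chart at each point, which may jump with the point; here
one chart serves a whole neighbourhood. -/
lemma localCurvature_tangentCoordChange (i : E.ι) {c x : M} (hi : x ∈ E.core.baseSet i)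
    (hx : x ∈ (extChartAt (𝓡∂ n) c).source) (u v : Model n) :
    E.localCurvature i x (tangentCoordChange (𝓡∂ n) c x x u) (tangentCoordChange (𝓡∂ n) c x x v)
      = E.chartCurvature c i (extChartAt (𝓡∂ n) c x) u v := by
  have h := (E.smooth_conn i).d_apply_tangentCoordChange (E.core.isOpen_baseSet i) hi hx ![u, v]
  have h2 : (fun l ↦ tangentCoordChange (𝓡∂ n) c x x (![u, v] l))
      = ![tangentCoordChange (𝓡∂ n) c x x u, tangentCoordChange (𝓡∂ n) c x x v] := by
    ext1 l
    fin_cases l <;> rfl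
  rw [h2] at h
  rw [chartCurvature, inChart_one_apply _ hx, inChart_one_apply _ hx, ← h]
  rfl

lemma localCurvature_eq_chartCurvature (i : E.ι) {x : M} (hi : x ∈ E.core.baseSet i)
    (u v : Model n) :
    E.localCurvature i x u v = E.chartCurvature x i (extChartAt (𝓡∂ n) x x) u v := by
  have hx := mem_extChartAt_source (I := 𝓡∂ n) x
  rw [← E.localCurvature_tangentCoordChange i hi hx, tangentCoordChange_self hx,
    tangentCoordChange_self hx]

/-- Covariance of the curvature under a change of frame. -/
lemma localCurvature_mul_coordChange (i j : E.ι) {x : M}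
    (hx : x ∈ E.core.baseSet i ∩ E.core.baseSet j) (u v : Model n) :
    E.localCurvature j x u v * E.core.coordChange i j x
      = E.core.coordChange i j x * E.localCurvature i x u v := by
  have hxx := mem_extChartAt_source (I := 𝓡∂ n) x
  have hopen := (E.core.isOpen_baseSet i).inter (E.core.isOpen_baseSet j)
  have hxr : extChartAt (𝓡∂ n) x x ∈ Set.range (𝓡∂ n) :=
    extChartAt_target_subset_range x ((extChartAt (𝓡∂ n) x).map_source hxx)
  have hg : ContDiffWithinAt ℝ ∞ (E.core.coordChange i j ∘ (extChartAt (𝓡∂ n) x).symm)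
      (Set.range (𝓡∂ n)) (extChartAt (𝓡∂ n) x x) :=
    (contMDiffAt_iff.1 ((E.smooth_coordChange i j).contMDiffAt (hopen.mem_nhds hx))).2
  -- The gauge equation is required near the point and not only at it, because it will be
  -- differentiated.
  have h : ∀ᶠ z in 𝓝[Set.range (𝓡∂ n)] (extChartAt (𝓡∂ n) x x), ∀ w,
      fderivWithin ℝ (E.core.coordChange i j ∘ (extChartAt (𝓡∂ n) x).symm) (Set.range (𝓡∂ n)) z w
        + (E.conn j).inChart x z ![w] * (E.core.coordChange i j ∘ (extChartAt (𝓡∂ n) x).symm) z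
      = (E.core.coordChange i j ∘ (extChartAt (𝓡∂ n) x).symm) z
        * (E.conn i).inChart x z ![w] := by
    filter_upwards [eventually_symm_mem hxx (hopen.mem_nhds hx)] with z hz w
    obtain ⟨hzt, hzb⟩ := hz
    set p := (extChartAt (𝓡∂ n) x).symm z with hp
    have hps : p ∈ (extChartAt (𝓡∂ n) x).source := (extChartAt (𝓡∂ n) x).map_target hzt
    have hz' : z = extChartAt (𝓡∂ n) x p := ((extChartAt (𝓡∂ n) x).right_inv hzt).symm
    rw [Function.comp_apply, ← hp, hz', fderivWithin_comp_symm hps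
      (E.mdifferentiableAt_coordChange i j hzb), inChart_one_apply _ hps, inChart_one_apply _ hps]
    exact E.conn_coordChange i j p hzb _
  have key := curvature_gauge (𝓡∂ n).uniqueDiffOn hxr ((𝓡∂ n).range_subset_closure_interior hxr) hg
    (((E.smooth_conn i).contDiffWithinAt (E.core.isOpen_baseSet i) hx.1
      hxx).differentiableWithinAt (by simp))
    (((E.smooth_conn j).contDiffWithinAt (E.core.isOpen_baseSet j) hx.2
      hxx).differentiableWithinAt (by simp)) h u v
  rw [Function.comp_apply, (extChartAt (𝓡∂ n) x).left_inv hxx] at key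
  rw [E.localCurvature_eq_chartCurvature i hx.1, E.localCurvature_eq_chartCurvature j hx.2]
  exact key

/-- The local curvature as a multilinear map. -/
def curvMulti (i : E.ι) (x : M) : MultilinearMap ℝ (fun _ : Fin 2 ↦ Model n) (EndC E.rank) :=
  let A : Model n →ₗ[ℝ] EndC E.rank :=
    { toFun := fun X ↦ E.conn i x ![X]
      map_add' := fun X Y ↦ (E.conn i x).toMultilinearMap.cons_add ![] X Y
      map_smul' := fun t X ↦ (E.conn i x).toMultilinearMap.cons_smul ![] t X }
  let D : MultilinearMap ℝ (fun _ : Fin 2 ↦ Model n) (EndC E.rank) :=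
    ((E.conn i).d x).toMultilinearMap
  D + commMulti A

lemma curvMulti_apply (i : E.ι) (x : M) (v : Fin 2 → Model n) :
    E.curvMulti i x v = E.localCurvature i x (v 0) (v 1) := by
  have h : v = ![v 0, v 1] := by ext1 l; fin_cases l <;> rfl
  have h2 : (E.conn i).d x v = (E.conn i).d x ![v 0, v 1] := congrArg _ h
  exact congrArg₂ (· + ·) h2 (commMulti_apply _ v)

/-- With chart and frame fixed, only values and first derivatives of smooth functions occur. -/
lemma continuousAt_chartCurvature (i : E.ι) {c x : M} (hi : x ∈ E.core.baseSet i)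
    (hx : x ∈ (extChartAt (𝓡∂ n) c).source) (u v : Model n) :
    ContinuousAt (fun x ↦ E.chartCurvature c i (extChartAt (𝓡∂ n) c x) u v) x := by
  have hopen : IsOpen ((extChartAt (𝓡∂ n) c).source ∩ E.core.baseSet i) :=
    (isOpen_extChartAt_source c).inter (E.core.isOpen_baseSet i)
  have hxr : ∀ x ∈ (extChartAt (𝓡∂ n) c).source, extChartAt (𝓡∂ n) c x ∈ Set.range (𝓡∂ n) :=
    fun x hx ↦ extChartAt_target_subset_range c ((extChartAt (𝓡∂ n) c).map_source hx)
  have hs : ∀ x ∈ (extChartAt (𝓡∂ n) c).source ∩ E.core.baseSet i,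
      ContDiffWithinAt ℝ ∞ ((E.conn i).inChart c) (Set.range (𝓡∂ n)) (extChartAt (𝓡∂ n) c x) :=
    fun x hx ↦ (E.smooth_conn i).contDiffWithinAt (E.core.isOpen_baseSet i) hx.2 hx.1
  have hcont : Filter.Tendsto (extChartAt (𝓡∂ n) c) (𝓝 x)
      (𝓝[Set.range (𝓡∂ n)] (extChartAt (𝓡∂ n) c x)) :=
    tendsto_nhdsWithin_iff.2 ⟨continuousAt_extChartAt' hx,
      Filter.Eventually.of_forall fun z ↦ by simp [extChartAt]⟩
  have h1 : ∀ w, ContDiffWithinAt ℝ ∞ (fun y ↦ (E.conn i).inChart c y ![w]) (Set.range (𝓡∂ n))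
      (extChartAt (𝓡∂ n) c x) := fun w ↦ contDiffWithinAt_alternating_apply (hs x ⟨hx, hi⟩) ![w]
  have hA : ∀ w, ContinuousAt (fun x ↦ (E.conn i).inChart c (extChartAt (𝓡∂ n) c x) ![w]) x :=
    fun w ↦ (h1 w).continuousWithinAt.tendsto.comp hcont
  have hD : ∀ w w', ContinuousAt (fun x ↦ fderivWithin ℝ (fun y ↦ (E.conn i).inChart c y ![w])
      (Set.range (𝓡∂ n)) (extChartAt (𝓡∂ n) c x) w') x := fun w w' ↦ by
    have h2 := ((h1 w).fderivWithin_right (m := 1) (𝓡∂ n).uniqueDiffOn two_le_infty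
      (hxr x hx)).continuousWithinAt
    have h3 : ContinuousAt (fun x ↦ fderivWithin ℝ (fun y ↦ (E.conn i).inChart c y ![w])
      (Set.range (𝓡∂ n)) (extChartAt (𝓡∂ n) c x)) x := h2.tendsto.comp hcont
    exact h3.clm_apply continuousAt_const
  have heq : (fun x ↦ E.chartCurvature c i (extChartAt (𝓡∂ n) c x) u v) =ᶠ[𝓝 x] fun x ↦
      (fderivWithin ℝ (fun y ↦ (E.conn i).inChart c y ![v])
        (Set.range (𝓡∂ n)) (extChartAt (𝓡∂ n) c x) u
      - fderivWithin ℝ (fun y ↦ (E.conn i).inChart c y ![u])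
        (Set.range (𝓡∂ n)) (extChartAt (𝓡∂ n) c x) v)
      + ((E.conn i).inChart c (extChartAt (𝓡∂ n) c x) ![u]
          * (E.conn i).inChart c (extChartAt (𝓡∂ n) c x) ![v]
        - (E.conn i).inChart c (extChartAt (𝓡∂ n) c x) ![v]
          * (E.conn i).inChart c (extChartAt (𝓡∂ n) c x) ![u]) := by
    filter_upwards [hopen.mem_nhds ⟨hx, hi⟩] with z hz
    rw [chartCurvature, extDerivWithin_one_apply ((hs z hz).differentiableWithinAt (by simp))
      (uniqueDiffWithinAt_range c z hz.1)]
  refine ContinuousAt.congr ?_ heq.symm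
  exact ((hD v u).sub (hD u v)).add (((hA u).mul (hA v)).sub ((hA v).mul (hA u)))

end HermitianBundle

end LocalCurvature

/-! ### Continuity of mixed forms -/

section Continuity

/-- Exterior powers of degree above n vanish, so finitely many finite-dimensional summands remain.
-/
instance finite_ext (n : ℕ) : Module.Finite ℂ (Ext n) := by
  have h : (⨆ d : Fin (n + 1), ⋀[ℂ]^(d : ℕ) (Model n →L[ℝ] ℂ)) = ⊤ := by
    rw [eq_top_iff, ← (DirectSum.Decomposition.isInternal
      (fun d : ℕ ↦ ⋀[ℂ]^d (Model n →L[ℝ] ℂ))).submodule_iSup_eq_top]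
    refine iSup_le fun d ↦ ?_
    by_cases hd : d < n + 1
    · exact le_iSup (fun d : Fin (n + 1) ↦ ⋀[ℂ]^(d : ℕ) (Model n →L[ℝ] ℂ)) ⟨d, hd⟩
    · intro x hx
      rw [eq_zero_of_mem_exteriorPower (by omega) hx]
      exact Submodule.zero_mem _
  have h2 : Module.Finite ℂ (⊤ : Submodule ℂ (Ext n)) := by
    rw [← h]
    infer_instance
  exact Module.Finite.equiv Submodule.topEquiv

/-- Continuity at a point of a function with values in the finite-dimensional space `Ext n`. -/
def ContAt {n : ℕ} {X : Type*} [TopologicalSpace X] (η : X → Ext n) (x : X) : Prop :=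
  ∀ l : Ext n →ₗ[ℂ] ℂ, ContinuousAt (fun x ↦ l (η x)) x

namespace ContAt

variable {n : ℕ} {X : Type*} [TopologicalSpace X] {x : X} {η θ : X → Ext n}

lemma const (a : Ext n) : ContAt (fun _ ↦ a) x := fun _ ↦ continuousAt_const

lemma congr (hη : ContAt η x) (h : ∀ᶠ y in 𝓝 x, η y = θ y) : ContAt θ x := fun l ↦
  (hη l).congr (h.mono fun _ hy ↦ congrArg l hy)

lemma add (hη : ContAt η x) (hθ : ContAt θ x) : ContAt (fun y ↦ η y + θ y) x := fun l ↦ by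
  simp only [map_add]
  exact (hη l).add (hθ l)

lemma smul {f : X → ℂ} (hf : ContinuousAt f x) (hη : ContAt η x) :
    ContAt (fun y ↦ f y • η y) x := fun l ↦ by
  simp only [map_smul, smul_eq_mul]
  exact hf.mul (hη l)

lemma sum {κ : Type*} (s : Finset κ) {η : κ → X → Ext n} (hη : ∀ i ∈ s, ContAt (η i) x) :
    ContAt (fun y ↦ ∑ i ∈ s, η i y) x := fun l ↦ by
  simp only [map_sum]
  exact tendsto_finsetSum s fun i hi ↦ hη i hi l

/-- In a basis of `Ext n` the product is a finite combination of constant elements with coefficients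
that are products of coordinates. -/
lemma mul (hη : ContAt η x) (hθ : ContAt θ x) : ContAt (fun y ↦ η y * θ y) x := by
  let b := Module.finBasis ℂ (Ext n)
  have h : ∀ y, η y * θ y = ∑ i, ∑ j, (b.coord i (η y) * b.coord j (θ y)) • (b i * b j) :=
    fun y ↦ by
      conv_lhs => rw [← b.sum_repr (η y), ← b.sum_repr (θ y), Finset.sum_mul_sum]
      simp only [smul_mul_smul_comm, Module.Basis.coord_apply]
  simp only [h]
  exact sum _ fun i _ ↦ sum _ fun j _ ↦ smul ((hη _).mul (hθ _)) (const _)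

lemma matrix_pow {r : ℕ} {A : X → Matrix (Fin r) (Fin r) (Ext n)}
    (hA : ∀ a b, ContAt (fun y ↦ A y a b) x) (k : ℕ) (a b : Fin r) :
    ContAt (fun y ↦ (A y ^ k) a b) x := by
  induction k generalizing b with
  | zero => simpa only [pow_zero] using const _
  | succ k ih =>
    simp only [pow_succ, Matrix.mul_apply]
    exact sum _ fun c _ ↦ (ih c).mul (hA c b)

lemma toExt {k : ℕ} {f : X → (Fin k → Model n) → ℂ}
    (hf : ∀ v, ContinuousAt (fun y ↦ f y v) x) : ContAt (fun y ↦ toExt k (f y)) x :=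
  smul continuousAt_const (sum _ fun _ _ ↦ smul (hf _) (const _))

end ContAt

variable {n : ℕ} [NeZero n] {M : Type*} [TopologicalSpace M]
  [ChartedSpace (EuclideanHalfSpace n) M] [IsManifold (𝓡∂ n) ∞ M]

variable (n M) in
/-- The algebra of continuous mixed forms. -/
def contForms : Subalgebra ℂ (M → Ext n) where
  carrier := {η | ∀ c, ∀ x ∈ (extChartAt (𝓡∂ n) c).source,
    ContAt (fun x ↦ pullExt (tangentCoordChange (𝓡∂ n) c x x) (η x)) x}
  mul_mem' := fun {η θ} hη hθ c x hx ↦ by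
    simpa only [Pi.mul_apply, map_mul] using (hη c x hx).mul (hθ c x hx)
  add_mem' := fun {η θ} hη hθ c x hx ↦ by
    simpa only [Pi.add_apply, map_add] using (hη c x hx).add (hθ c x hx)
  algebraMap_mem' := fun t c x _ ↦ by
    simpa only [Pi.algebraMap_apply, AlgHom.commutes] using ContAt.const _

lemma DiffForm.SmoothOn.toExt_mem_contForms {k : ℕ} {w : DiffForm n k M ℝ}
    (hw : w.SmoothOn Set.univ) :
    (fun x ↦ toExt k fun v : Fin k → Model n ↦ (w x v : ℂ)) ∈ contForms n M := by
  intro c x hx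
  have h : ∀ y ∈ (extChartAt (𝓡∂ n) c).source,
      toExt k (fun v ↦ (w.inChart c (extChartAt (𝓡∂ n) c y) v : ℂ))
        = pullExt (tangentCoordChange (𝓡∂ n) c y y)
          (toExt k fun v : Fin k → Model n ↦ (w y v : ℂ)) := fun y hy ↦ by
    let f : MultilinearMap ℝ (fun _ : Fin k ↦ Model n) ℂ :=
      Complex.ofRealCLM.toLinearMap.compMultilinearMap (w y).toMultilinearMap
    refine Eq.trans ?_ (pullExt_toExt _ f).symm
    congr 1
    ext1 v
    rw [inChart_apply w hy]
    rfl
  refine (ContAt.toExt fun v ↦ ?_).congr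
    (Filter.eventually_of_mem ((isOpen_extChartAt_source c).mem_nhds hx) h)
  have h1 : ContDiffWithinAt ℝ ∞ (fun y ↦ w.inChart c y v) (Set.range (𝓡∂ n))
      (extChartAt (𝓡∂ n) c x) :=
    contDiffWithinAt_alternating_apply (hw.contDiffWithinAt isOpen_univ (Set.mem_univ x) hx) v
  have hcont : Filter.Tendsto (extChartAt (𝓡∂ n) c) (𝓝 x)
      (𝓝[Set.range (𝓡∂ n)] (extChartAt (𝓡∂ n) c x)) :=
    tendsto_nhdsWithin_iff.2 ⟨continuousAt_extChartAt' hx,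
      Filter.Eventually.of_forall fun z ↦ by simp [extChartAt]⟩
  exact Complex.continuous_ofReal.continuousAt.comp (h1.continuousWithinAt.tendsto.comp hcont)

namespace HermitianBundle

variable (E : HermitianBundle n M)

/-- The matrix `(i / 2π) R` in the `i`-th frame. -/
def frameCurv (i : E.ι) (x : M) : Matrix (Fin E.rank) (Fin E.rank) (EvenExt n) :=
  Matrix.of fun a b ↦ (Complex.I / (2 * Real.pi)) • toEvenExt n fun v : Fin 2 → Model n ↦
    mat E.rank (E.localCurvature i x (v 0) (v 1)) a b

lemma frameCurv_mul (i j : E.ι) {x : M} (hx : x ∈ E.core.baseSet i ∩ E.core.baseSet j) :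
    E.frameCurv j x * extMat (EvenExt n) (mat E.rank (E.core.coordChange i j x))
      = extMat (EvenExt n) (mat E.rank (E.core.coordChange i j x)) * E.frameCurv i x := by
  set g := mat E.rank (E.core.coordChange i j x)
  have h : ∀ v : Fin 2 → Model n, mat E.rank (E.localCurvature j x (v 0) (v 1)) * g
      = g * mat E.rank (E.localCurvature i x (v 0) (v 1)) := fun v ↦ by
    rw [← map_mul, ← map_mul, E.localCurvature_mul_coordChange i j hx]
  ext1 a b
  simp only [Matrix.mul_apply, frameCurv, Matrix.of_apply, Matrix.map_apply, smul_mul_assoc,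
    mul_smul_comm, ← Finset.smul_sum]
  congr 1
  simp only [← Algebra.smul_def, mul_comm _ (algebraMap ℂ (EvenExt n) _), ← map_smul, ← map_sum]
  congr 1
  ext1 v
  have h2 := congrFun₂ (h v) a b
  simp only [Matrix.mul_apply] at h2
  simp only [Finset.sum_apply, Pi.smul_apply, smul_eq_mul]
  rw [← h2]
  exact Finset.sum_congr rfl fun c _ ↦ mul_comm _ _

/-- Frames change the curvature by conjugation, the inverse being the opposite transition function.
The preferred frame may therefore be replaced by one that is valid near a given point. -/
lemma trace_frameCurv_pow (i j : E.ι) {x : M} (hx : x ∈ E.core.baseSet i ∩ E.core.baseSet j)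
    (k : ℕ) : (E.frameCurv j x ^ k).trace = (E.frameCurv i x ^ k).trace := by
  set G := extMat (EvenExt n) (mat E.rank (E.core.coordChange i j x)) with hG
  set G' := extMat (EvenExt n) (mat E.rank (E.core.coordChange j i x)) with hG'
  have h : E.frameCurv j x ^ k * G = G * E.frameCurv i x ^ k :=
    ((show SemiconjBy G (E.frameCurv i x) (E.frameCurv j x) from
      (E.frameCurv_mul i j hx).symm).pow_right k).eq.symm
  have h1 : G * G' = 1 := by
    rw [hG, hG', ← extMat_mul, ← map_mul, E.coordChange_mul j i j ⟨hx.symm, hx.2⟩,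
      E.coordChange_self_eq j hx.2, map_one, extMat_one]
  have h2 : G' * G = 1 := mul_eq_one_comm.1 h1
  calc (E.frameCurv j x ^ k).trace = (E.frameCurv j x ^ k * G * G').trace := by
        rw [mul_assoc, h1, mul_one]
    _ = (G' * (G * E.frameCurv i x ^ k)).trace := by rw [h, Matrix.trace_mul_comm]
    _ = _ := by rw [← mul_assoc, h2, one_mul]

/-- An entry of an endomorphism of `ℂʳ`. -/
def matEntry {r : ℕ} (a b : Fin r) : EndC r →ₗ[ℝ] ℂ where
  toFun A := mat r A a b
  map_add' A A' := by rw [map_add]; rfl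
  map_smul' t A := by
    change mat r ((t : ℂ) • A) a b = _
    rw [map_smul]; rfl

lemma continuous_matEntry {r : ℕ} (a b : Fin r) : Continuous (matEntry a b) :=
  continuous_mat.matrix_elem a b

lemma coe_frameCurv (i : E.ι) (x : M) (a b : Fin E.rank) :
    (E.frameCurv i x a b : Ext n) = (Complex.I / (2 * Real.pi)) •
      toExt 2 ((matEntry a b).compMultilinearMap (E.curvMulti i x)) := by
  have h1 : (fun v : Fin 2 → Model n ↦ mat E.rank (E.localCurvature i x (v 0) (v 1)) a b)
      = (matEntry a b).compMultilinearMap (E.curvMulti i x) :=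
    funext fun v ↦ (congrArg (matEntry a b) (E.curvMulti_apply i x v)).symm
  have h2 : E.frameCurv i x a b = (Complex.I / (2 * Real.pi)) • toEvenExt n fun v ↦
    mat E.rank (E.localCurvature i x (v 0) (v 1)) a b := rfl
  rw [h2, h1, Subalgebra.coe_smul]
  rfl

lemma pullExt_frameCurv (i : E.ι) {c x : M} (hi : x ∈ E.core.baseSet i)
    (hx : x ∈ (extChartAt (𝓡∂ n) c).source) (a b : Fin E.rank) :
    pullExt (tangentCoordChange (𝓡∂ n) c x x) (E.frameCurv i x a b)
      = (Complex.I / (2 * Real.pi)) • toExt 2 fun v ↦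
        matEntry a b (E.chartCurvature c i (extChartAt (𝓡∂ n) c x) (v 0) (v 1)) := by
  rw [coe_frameCurv, (pullExt _).map_smul_of_tower, pullExt_toExt]
  refine congrArg _ (congrArg (toExt 2) (funext fun v ↦ ?_))
  rw [← E.localCurvature_tangentCoordChange i hi hx]
  exact congrArg (matEntry a b) (E.curvMulti_apply i x _)

lemma contAt_pullExt_frameCurv (i : E.ι) {c x : M} (hi : x ∈ E.core.baseSet i)
    (hx : x ∈ (extChartAt (𝓡∂ n) c).source) (a b : Fin E.rank) :
    ContAt (fun y ↦ pullExt (tangentCoordChange (𝓡∂ n) c y y) (E.frameCurv i y a b)) x := by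
  have h : ∀ v : Fin 2 → Model n, ContinuousAt (fun y ↦
      matEntry a b (E.chartCurvature c i (extChartAt (𝓡∂ n) c y) (v 0) (v 1))) x := fun v ↦
    (continuous_matEntry a b).continuousAt.comp
      (E.continuousAt_chartCurvature i hi hx (v 0) (v 1))
  refine (ContAt.smul (continuousAt_const (y := Complex.I / (2 * Real.pi)))
    (ContAt.toExt h)).congr ?_
  filter_upwards [(isOpen_extChartAt_source c).mem_nhds hx,
    (E.core.isOpen_baseSet i).mem_nhds hi] with y hy hyi
  exact (E.pullExt_frameCurv i hyi hy a b).symm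

lemma chernCharacterEven_eq_frameCurv (i : E.ι) {x : M} (hi : x ∈ E.core.baseSet i) (k : ℕ) :
    E.chernCharacterEven k x = ((k.factorial : ℂ))⁻¹ • (E.frameCurv i x ^ k).trace := by
  have h : E.normCurv x = E.frameCurv (E.core.indexAt x) x := rfl
  rw [chernCharacterEven, h, E.trace_frameCurv_pow i _ ⟨hi, E.core.mem_baseSet_at x⟩]

/-- The frame preferred at x is kept for all nearby points, which is permitted by invariance of the
trace; continuity then follows from that of the matrix entries. -/
lemma chernCharacter_mem_contForms (k : ℕ) : E.chernCharacter k ∈ contForms n M := by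
  intro c x hx
  set i := E.core.indexAt x
  have hi : x ∈ E.core.baseSet i := E.core.mem_baseSet_at x
  let P (y : M) : EvenExt n →+* Ext n :=
    (pullExt (tangentCoordChange (𝓡∂ n) c y y)).toRingHom.comp (EvenExt n).val.toRingHom
  have hB : ∀ a b, ContAt (fun y ↦ ((E.frameCurv i y).map (P y)) a b) x :=
    E.contAt_pullExt_frameCurv i hi hx
  refine (ContAt.smul (continuousAt_const (y := ((k.factorial : ℂ))⁻¹))
    (ContAt.sum Finset.univ fun a _ ↦ ContAt.matrix_pow hB k a a)).congr ?_
  filter_upwards [(E.core.isOpen_baseSet i).mem_nhds hi] with y hyi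
  have h2 : ∑ a, (((E.frameCurv i y).map (P y)) ^ k) a a = P y (E.frameCurv i y ^ k).trace := by
    rw [← Matrix.map_pow, Matrix.trace, map_sum]
    rfl
  rw [← coe_chernCharacterEven, E.chernCharacterEven_eq_frameCurv i hyi, h2, Subalgebra.coe_smul,
    (pullExt _).map_smul_of_tower]
  rfl

end HermitianBundle

end Continuity

/-! ### Linearity of the integral -/

section IntegralLinear

open MeasureTheory

variable {n : ℕ} [NeZero n] {M : Type*} [TopologicalSpace M]
  [ChartedSpace (EuclideanHalfSpace n) M] [IsManifold (𝓡∂ n) ∞ M]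

lemma ManifoldOrientation.continuousAt_sign (o : ManifoldOrientation n M) {c x : M}
    (hx : x ∈ (extChartAt (𝓡∂ n) c).source) : ContinuousAt (o.sign c) x := by
  rw [extChartAt_source] at hx
  refine continuousAt_const.congr (Filter.EventuallyEq.symm ?_) (f := fun _ ↦ o.sign c x)
  filter_upwards [o.locallyConstant c x hx] with y hy
  classical exact if_congr hy rfl rfl

variable [CompactSpace M] [T2Space M]

lemma tsupport_partitionOfUnity (c : M) :
    tsupport (partitionOfUnity n M c) ⊆ (extChartAt (𝓡∂ n) c).source := by
  rw [extChartAt_source]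
  exact (SmoothPartitionOfUnity.exists_isSubordinate_chartAt_source (𝓡∂ n) M).choose_spec c

lemma finite_partitionOfUnity :
    {c : M | (Function.support (partitionOfUnity n M c)).Nonempty}.Finite :=
  (partitionOfUnity n M).locallyFinite.finite_nonempty_of_compact

/-- The coefficient of the form `η` in the chart around `c`, cut off by the partition of unity. -/
def chartIntegrand (o : ManifoldOrientation n M) (c : M) (η : M → Ext n) (x : M) : ℂ :=
  ((partitionOfUnity n M c x * o.sign c x : ℝ) : ℂ) * topEval (chartFrame c x) (η x)

/-- The contribution of the chart around `c` to the integral. -/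
def chartIntegral (o : ManifoldOrientation n M) (c : M) (η : M → Ext n) : ℂ :=
  ∫ y in (extChartAt (𝓡∂ n) c).target, chartIntegrand o c η ((extChartAt (𝓡∂ n) c).symm y)

lemma integral_eq_finsum (o : ManifoldOrientation n M) (η : M → Ext n) :
    integral o η = ∑ᶠ c, chartIntegral o c η := rfl

variable (o : ManifoldOrientation n M) {η θ : M → Ext n}

lemma continuous_chartIntegrand (hη : η ∈ contForms n M) (c : M) :
    Continuous (chartIntegrand o c η) := by
  rw [continuous_iff_continuousAt]
  intro x
  by_cases hx : x ∈ tsupport (partitionOfUnity n M c)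
  · have hxs := tsupport_partitionOfUnity c hx
    have h1 : ContinuousAt (fun x ↦ topEval (chartFrame c x) (η x)) x := by
      have h2 : ∀ y, topEval (chartFrame c y) (η y)
          = topEval (fun a ↦ (EuclideanSpace.single a 1 : Model n))
            (pullExt (tangentCoordChange (𝓡∂ n) c y y) (η y)) := fun y ↦
        topEval_comp (tangentCoordChange (𝓡∂ n) c y y) _ (η y)
      simp only [h2]
      exact hη c x hxs _
    have h3 : ContinuousAt (fun x ↦ partitionOfUnity n M c x * o.sign c x) x :=
      (partitionOfUnity n M c).2.continuous.continuousAt.mul (o.continuousAt_sign hxs)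
    exact (Complex.continuous_ofReal.continuousAt.comp h3).mul h1
  · refine continuousAt_const.congr (f := fun _ ↦ 0) (Filter.EventuallyEq.symm ?_)
    filter_upwards [(isClosed_tsupport _).isOpen_compl.mem_nhds hx] with y hy
    simp [chartIntegrand, image_eq_zero_of_notMem_tsupport hy]

/-- The integrand is continuous and vanishes off the compact image of the support of the cut-off
function. Without integrability the integral would not be additive. -/
lemma integrableOn_chartIntegrand (hη : η ∈ contForms n M) (c : M) :
    IntegrableOn (fun y ↦ chartIntegrand o c η ((extChartAt (𝓡∂ n) c).symm y))
      (extChartAt (𝓡∂ n) c).target := by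
  have hs := tsupport_partitionOfUnity (n := n) c
  set K := extChartAt (𝓡∂ n) c '' tsupport (partitionOfUnity n M c) with hK
  have hKt : K ⊆ (extChartAt (𝓡∂ n) c).target := by
    rintro _ ⟨x, hx, rfl⟩
    exact (extChartAt (𝓡∂ n) c).map_source (hs hx)
  have hKc : IsCompact K :=
    (isClosed_tsupport _).isCompact.image_of_continuousOn ((continuousOn_extChartAt c).mono hs)
  have hm : MeasurableSet (extChartAt (𝓡∂ n) c).target := by
    rw [extChartAt_target]
    exact (((chartAt (EuclideanHalfSpace n) c).open_target.preimage
      (𝓡∂ n).continuous_symm).measurableSet).inter (𝓡∂ n).isClosed_range.measurableSet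
  have hcont : ContinuousOn (fun y ↦ chartIntegrand o c η ((extChartAt (𝓡∂ n) c).symm y))
      (extChartAt (𝓡∂ n) c).target :=
    (continuous_chartIntegrand o hη c).comp_continuousOn (continuousOn_extChartAt_symm c)
  refine IntegrableOn.of_forall_sdiff_eq_zero ((hcont.mono hKt).integrableOn_compact hKc) hm ?_
  rintro y ⟨hy, hyK⟩
  have h : (extChartAt (𝓡∂ n) c).symm y ∉ tsupport (partitionOfUnity n M c) := fun h ↦
    hyK ⟨_, h, (extChartAt (𝓡∂ n) c).right_inv hy⟩
  rw [chartIntegrand, image_eq_zero_of_notMem_tsupport h, zero_mul, Complex.ofReal_zero, zero_mul]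

lemma finite_support_chartIntegral (η : M → Ext n) :
    (Function.support fun c ↦ chartIntegral o c η).Finite := by
  refine (finite_partitionOfUnity (n := n)).subset fun c hc ↦ ?_
  by_contra h
  rw [Set.mem_ofPred_eq, Set.not_nonempty_iff_eq_empty, Function.support_eq_empty_iff] at h
  exact hc (by simp [chartIntegral, chartIntegrand, h])

lemma integral_add (hη : η ∈ contForms n M) (hθ : θ ∈ contForms n M) :
    integral o (η + θ) = integral o η + integral o θ := by
  rw [integral_eq_finsum, integral_eq_finsum, integral_eq_finsum,
    ← finsum_add_distrib (finite_support_chartIntegral o η) (finite_support_chartIntegral o θ)]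
  refine finsum_congr fun c ↦ ?_
  rw [chartIntegral, chartIntegral, chartIntegral,
    ← MeasureTheory.integral_add (integrableOn_chartIntegrand o hη c)
      (integrableOn_chartIntegrand o hθ c)]
  simp only [chartIntegrand, Pi.add_apply, map_add, mul_add]

lemma integral_smul (t : ℂ) (η : M → Ext n) : integral o (t • η) = t * integral o η := by
  rw [integral_eq_finsum, integral_eq_finsum, mul_finsum]
  refine finsum_congr fun c ↦ ?_
  rw [chartIntegral, chartIntegral, ← integral_const_mul]
  simp only [chartIntegrand, Pi.smul_apply, map_smul, smul_eq_mul, mul_left_comm]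

/-- The integral as a linear functional on continuous forms. -/
def integralLin : contForms n M →ₗ[ℂ] ℂ where
  toFun η := integral o η
  map_add' η θ := integral_add o η.2 θ.2
  map_smul' t η := integral_smul o t η

lemma integral_congr
    (h : ∀ x v, topEval (n := n) v (η x) = topEval v (θ x)) : integral o η = integral o θ := by
  have h1 : ∀ c, chartIntegral o c η = chartIntegral o c θ := fun c ↦
    integral_congr_ae (Filter.Eventually.of_forall fun y ↦ congrArg _ (h _ _))
  rw [integral_eq_finsum, integral_eq_finsum, finsum_congr h1]

lemma integral_eq_zero {d : ℕ} (hd : d ≠ n) (h : ∀ x, η x ∈ ⋀[ℂ]^d (Model n →L[ℝ] ℂ)) :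
    integral o η = 0 := by
  rw [integral_congr o (θ := 0) fun x v ↦ by
    rw [topEval_eq_zero hd (h x), Pi.zero_apply, map_zero]]
  exact (integralLin o).map_zero

end IntegralLinear

/-! ### Bundles that realise products of Adams operations -/

section Realization

/-- The sum is the value of a polynomial of degree less than N in each variable at a point of the
grid {1, …, N}^s. A polynomial of such degrees that vanishes on the grid is zero. -/
lemma coeff_eq_zero_of_sum_prod_pow {s N : ℕ} (a : (Fin s → ℕ) → ℂ)
    (h : ∀ k : Fin s → ℕ, (∀ i, k i < N) →
      ∑ J ∈ Fintype.piFinset fun _ : Fin s ↦ Finset.range N,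
        (∏ i, ((k i + 1 : ℕ) : ℂ) ^ J i) * a J = 0)
    {J : Fin s → ℕ} (hJ : ∀ i, J i < N) : a J = 0 := by
  classical
  set P : MvPolynomial (Fin s) ℂ := ∑ J ∈ Fintype.piFinset fun _ : Fin s ↦ Finset.range N,
    MvPolynomial.monomial (Finsupp.equivFunOnFinite.symm J) (a J) with hP
  have hcoeff : P.coeff (Finsupp.equivFunOnFinite.symm J) = a J := by
    rw [hP, MvPolynomial.coeff_sum, Finset.sum_eq_single J]
    · simp
    · intro J' _ hJ'
      rw [MvPolynomial.coeff_monomial, if_neg]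
      exact fun h ↦ hJ' (Finsupp.equivFunOnFinite.symm.injective h)
    · exact fun h ↦ absurd (Fintype.mem_piFinset.2 fun i ↦ Finset.mem_range.2 (hJ i)) h
  let G : Finset ℂ := (Finset.range N).image fun l : ℕ ↦ ((l + 1 : ℕ) : ℂ)
  have hG : G.card = N := by
    rw [Finset.card_image_of_injective _ fun x y hxy ↦ by simpa using hxy, Finset.card_range]
  have hzero : P = 0 := by
    refine MvPolynomial.eq_zero_of_eval_zero_at_prod_finset P (fun _ ↦ G) (fun i ↦ ?_) fun x hx ↦ ?_
    · rw [hG]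
      have hN : 0 < N := (Nat.zero_le _).trans_lt (hJ i)
      refine (MvPolynomial.degreeOf_sum_le _ _ _).trans_lt ((Finset.sup_lt_iff hN).2 fun J' hJ' ↦ ?_)
      refine (MvPolynomial.degreeOf_le_iff.2 fun d hd ↦ ?_).trans_lt
        (Finset.mem_range.1 (Fintype.mem_piFinset.1 hJ' i))
      rw [Finset.mem_singleton.1 (MvPolynomial.support_monomial_subset hd)]
      rfl
    · have hx' : ∀ i, ∃ l, l < N ∧ ((l + 1 : ℕ) : ℂ) = x i := fun i ↦ by
        simpa [G] using hx i
      choose k hk hkx using hx'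
      rw [hP, map_sum, ← h k hk]
      refine Finset.sum_congr rfl fun J' _ ↦ ?_
      rw [MvPolynomial.eval_monomial, Finsupp.prod_fintype _ _ fun i ↦ pow_zero _, mul_comm]
      simp only [hkx]
      rfl
  rw [← hcoeff, hzero, MvPolynomial.coeff_zero]

variable {n : ℕ} [NeZero n] {M : Type*} [TopologicalSpace M]
  [ChartedSpace (EuclideanHalfSpace n) M] [IsManifold (𝓡∂ n) ∞ M]

namespace HermitianBundle

open Matrix

variable (E : HermitianBundle n M)

/-- Compression is linear in the coefficients, so it commutes both with evaluating the curvature on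
a pair of vectors and with passing to forms; on a given pair of vectors the claim is the formula for
the derivative of the representation. -/
lemma normCurv_assoc_tensRep {ι : Type*} [Fintype ι] [DecidableEq ι] {s : ℕ}
    {J : Matrix (ι → Fin E.rank) (Fin s) ℂ} (hJ : Jᴴ * J = 1)
    (hT : ∀ A : Matrix (Fin E.rank) (Fin E.rank) ℂ, Commute (J * Jᴴ) (tens fun _ : ι ↦ A))
    (hD : ∀ A : Matrix (Fin E.rank) (Fin E.rank) ℂ, Commute (J * Jᴴ) (tensDer ι A)) (x : M) :
    (E.assoc (tensRep J hJ hT hD)).normCurv x = compressDer J (E.normCurv x) := by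
  let Φ : ((Fin 2 → Model n) → ℂ) →ₗ[ℂ] EvenExt n := (Complex.I / (2 * Real.pi)) • toEvenExt n
  let X : Matrix (Fin E.rank) (Fin E.rank) ((Fin 2 → Model n) → ℂ) :=
    Matrix.of fun a b v ↦ mat E.rank (E.curvature x (v 0) (v 1)) a b
  have h1 : E.normCurv x = X.map Φ := rfl
  rw [h1, ← map_compress]
  ext1 a b
  change Φ _ = Φ _
  congr 1
  ext1 v
  have h2 := congrFun₂ (map_compress
    (LinearMap.proj v : ((Fin 2 → Model n) → ℂ) →ₗ[ℂ] ℂ) J X) a b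
  refine Eq.trans ?_ h2.symm
  have h3 : X.map (LinearMap.proj v : ((Fin 2 → Model n) → ℂ) →ₗ[ℂ] ℂ)
      = mat E.rank (E.curvature x (v 0) (v 1)) := rfl
  have h4 : (E.assoc (tensRep J hJ hT hD)).curvature x (v 0) (v 1)
      = (mat s).symm (Jᴴ * tensDer ι (mat E.rank (E.curvature x (v 0) (v 1))) * J) :=
    (E.curvature_assoc _ x _ _).trans (tensCompressDer_apply J _)
  rw [h3]
  refine congrFun₂ ((congrArg (mat s) h4).trans ((mat s).apply_symm_apply _)) a b

/-- The product of the Adams operations `ψ^(kᵢ + 1)` of `E` is a combination of bundles whose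
curvature is controlled by that of `E`. -/
lemma exists_realization {s : ℕ} (k : Fin s → ℕ) :
    ∃ (Λ : Finset ℝ) (F : ℝ → HermitianBundle n M),
      (∀ t, E.IsBoundaryAdapted → (F t).IsBoundaryAdapted) ∧
      (∀ t g, (F t).curvatureNorm g ≤ ((∑ i, (k i + 1) : ℕ) : ℝ≥0) * E.curvatureNorm g) ∧
      ∀ x N, n < 2 * N → ∑ t ∈ Λ, (t : ℂ) •
          (∑ j ∈ Finset.range N, (F t).chernCharacterEven j x - ((F t).rank : EvenExt n))
        = 2 * (∏ i, ∑ j ∈ Finset.range N, ((k i + 1 : ℕ) : ℂ) ^ j • E.chernCharacterEven j x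
          - (E.rank : EvenExt n) ^ s) := by
  -- The cycle permutation is symmetrised with its inverse to obtain real eigenvalues; both have the
  -- same traces, whence the factor 2 in the conclusion.
  have hherm : (permTens (Fin E.rank) ℂ (cycles k)
      + permTens (Fin E.rank) ℂ (cycles k)⁻¹).IsHermitian := by
    rw [Matrix.IsHermitian, conjTranspose_add, permTens_conjTranspose, permTens_conjTranspose,
      inv_inv, add_comm]
  obtain ⟨Λ, s', J, hJ, hcomm, hH⟩ := exists_isometries hherm
  have hT : ∀ t, ∀ A : Matrix (Fin E.rank) (Fin E.rank) ℂ,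
      Commute (J t * (J t)ᴴ) (tens fun _ ↦ A) := fun t A ↦
    hcomm t _ ((permTens_commute_tens _ A).add_left (permTens_commute_tens _ A))
  have hD : ∀ t, ∀ A : Matrix (Fin E.rank) (Fin E.rank) ℂ,
      Commute (J t * (J t)ᴴ) (tensDer _ A) := fun t A ↦
    hcomm t _ ((permTens_commute_tensDer _ A).add_left (permTens_commute_tensDer _ A))
  refine ⟨Λ, fun t ↦ E.assoc (tensRep (J t) (hJ t) (hT t) (hD t)), fun t h ↦ h.assoc _,
    fun t g ↦ E.curvatureNorm_assoc_le _ (fun x ↦ ?_) g, fun x N hN ↦ ?_⟩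
  · refine (norm_tensCompressDer_le (hJ t) x).trans_eq ?_
    simp
  · have key := sum_trace_exp_compress k hJ hD hH ⟨N, E.normCurv_pow_eq_zero x hN⟩
    have h1 : ∀ i, (IsNilpotent.exp ((k i + 1) • E.normCurv x)).trace
        = ∑ j ∈ Finset.range N, ((k i + 1 : ℕ) : ℂ) ^ j • E.chernCharacterEven j x := fun i ↦
      E.sum_chernCharacterEven x hN (k i + 1)
    have h2 : ∀ t, (IsNilpotent.exp (compressDer (J t) (E.normCurv x))).trace
        = ∑ j ∈ Finset.range N,
          (E.assoc (tensRep (J t) (hJ t) (hT t) (hD t))).chernCharacterEven j x := fun t ↦ by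
      have h3 := (E.assoc (tensRep (J t) (hJ t) (hT t) (hD t))).sum_chernCharacterEven x hN 1
      simp only [one_smul, Nat.cast_one, one_pow] at h3
      rw [← h3, E.normCurv_assoc_tensRep]
      rfl
    refine (Finset.sum_congr rfl fun t _ ↦ ?_).trans (key.trans ?_)
    · exact congrArg (fun z ↦ (t : ℂ) • (z - (s' t : EvenExt n))) (h2 t).symm
    · rw [Fintype.card_fin, Fintype.card_fin]
      exact congrArg (fun z ↦ 2 * (z - (E.rank : EvenExt n) ^ s))
        (Finset.prod_congr rfl fun i _ ↦ h1 i)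

end HermitianBundle

end Realization

/-! ### Characteristic numbers -/

section CharacteristicNumbers

variable {n : ℕ} [NeZero n] {M : Type*} [TopologicalSpace M]
  [ChartedSpace (EuclideanHalfSpace n) M] [IsManifold (𝓡∂ n) ∞ M]

/-- Expanding the product gives a polynomial in the numbers k_i + 1 with coefficients f(∏ a_{J_i}).
The subtracted power of a 0 removes exactly the constant term, about which nothing is concluded. -/
lemma map_prod_eq_zero_of_vandermonde {R : Type*} [CommRing R] [Algebra ℂ R] (f : R →ₗ[ℂ] ℂ)
    (a : ℕ → R) {s N : ℕ}
    (h : ∀ k : Fin s → ℕ, (∀ i, k i < N) →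
      f (∏ i, ∑ j ∈ Finset.range N, ((k i + 1 : ℕ) : ℂ) ^ j • a j - a 0 ^ s) = 0)
    {J : Fin s → ℕ} (hJ : ∀ i, J i < N) (hJ0 : J ≠ 0) : f (∏ i, a (J i)) = 0 := by
  classical
  have main := coeff_eq_zero_of_sum_prod_pow (s := s) (N := N)
    (fun J ↦ if J = 0 then 0 else f (∏ i, a (J i))) (fun k hk ↦ ?_) hJ
  · simpa [hJ0] using main
  · have h1 := h k hk
    rw [Finset.prod_univ_sum, map_sub, map_sum] at h1
    have h0 : (0 : Fin s → ℕ) ∈ Fintype.piFinset fun _ : Fin s ↦ Finset.range N :=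
      Fintype.mem_piFinset.2 fun i ↦ Finset.mem_range.2 ((Nat.zero_le _).trans_lt (hJ i))
    let b (J : Fin s → ℕ) : ℂ := f (∏ i, ((k i + 1 : ℕ) : ℂ) ^ J i • a (J i))
    have hb0 : b 0 = f (a 0 ^ s) := by simp [b]
    have hb : ∀ J, b J = (∏ i, ((k i + 1 : ℕ) : ℂ) ^ J i) * f (∏ i, a (J i)) := fun J ↦ by
      rw [← smul_eq_mul, ← map_smul]
      refine congrArg f ?_
      simp only [Algebra.smul_def, Finset.prod_mul_distrib, map_prod]
    have h2 : ∀ J, (∏ i, ((k i + 1 : ℕ) : ℂ) ^ J i) * (if J = 0 then 0 else f (∏ i, a (J i)))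
        = b J - if J = 0 then b J else 0 := fun J ↦ by
      split_ifs
      · rw [mul_zero, sub_self]
      · rw [sub_zero, hb]
    rw [Finset.sum_congr rfl fun J _ ↦ h2 J, Finset.sum_sub_distrib, Finset.sum_ite_eq', if_pos h0,
      hb0]
    exact h1

lemma map_eq_zero_of_sum_smul_eq {R κ : Type*} [AddCommGroup R] [Module ℂ R] (f : R →ₗ[ℂ] ℂ)
    {Λ : Finset κ} {c : κ → ℂ} {y : κ → R} {z : R} (h : ∑ t ∈ Λ, c t • y t = (2 : ℂ) • z)
    (hy : ∀ t, f (y t) = 0) : f z = 0 := by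
  have h1 := congrArg f h
  simp only [map_sum, map_smul, hy, smul_zero, Finset.sum_const_zero] at h1
  exact (smul_eq_zero.1 h1.symm).resolve_left two_ne_zero

omit [NeZero n] in
lemma prod_mem_evenDeg {s : ℕ} (J : Fin s → ℕ) {a : ℕ → EvenExt n} (ha : ∀ j, a j ∈ evenDeg n j) :
    ∏ i, a (J i) ∈ evenDeg n (∑ i, J i) := by
  induction s with
  | zero => simpa using one_mem_evenDeg
  | succ s ih =>
    rw [Fin.prod_univ_succ, Fin.sum_univ_succ]
    exact mul_mem_evenDeg (ha _) (ih _)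

variable (n M) in
/-- The commutative algebra of continuous mixed forms with values in the center. -/
def evenForms : Subalgebra ℂ (M → EvenExt n) :=
  (contForms n M).comap ((EvenExt n).val.compLeft M)

/-- Evaluation of an even form at a point. -/
def evalEven (x : M) : evenForms n M →ₐ[ℂ] EvenExt n :=
  (Pi.evalAlgHom ℂ (fun _ : M ↦ EvenExt n) x).comp (evenForms n M).val

lemma evenForms_ext {η θ : evenForms n M} (h : ∀ x, evalEven x η = evalEven x θ) : η = θ :=
  Subtype.ext (funext h)

namespace HermitianBundle

variable (E : HermitianBundle n M)

lemma chernCharacterEven_mem (j : ℕ) (x : M) : E.chernCharacterEven j x ∈ evenDeg n j :=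
  Submodule.smul_mem _ _ (Submodule.sum_mem _ fun a _ ↦ E.normCurv_pow_mem x j a a)

/-- The Chern character form as an element of `evenForms n M`. -/
def chForm (j : ℕ) : evenForms n M :=
  ⟨E.chernCharacterEven j, by
    have h : (fun x ↦ (E.chernCharacterEven j x : Ext n)) = E.chernCharacter j :=
      funext fun x ↦ E.coe_chernCharacterEven j x
    change (fun x ↦ (E.chernCharacterEven j x : Ext n)) ∈ contForms n M
    rw [h]
    exact E.chernCharacter_mem_contForms j⟩

lemma evalEven_chForm (j : ℕ) (x : M) : evalEven x (E.chForm j) = E.chernCharacterEven j x := rfl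

lemma chForm_zero : E.chForm 0 = (E.rank : evenForms n M) := by
  refine evenForms_ext fun x ↦ Subtype.ext ?_
  rw [evalEven_chForm, coe_chernCharacterEven, chernCharacter_zero, map_natCast]
  simp

/-- Chern forms are polynomials in the components of the Chern character form. -/
lemma exists_chernForm (j : ℕ) : ∃ η ∈ Algebra.adjoin ℂ (Set.range fun j ↦ E.chForm (j + 1)),
    ∀ x, evalEven x η = E.chernEven j x := by
  induction j using Nat.strong_induction_on with
  | _ j ih =>
    rcases j with _ | k
    · exact ⟨1, one_mem _, fun x ↦ (E.chernEven_zero x).symm⟩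
    · have h : ∀ j ∈ Finset.range (k + 1),
          ∃ η ∈ Algebra.adjoin ℂ (Set.range fun j ↦ E.chForm (j + 1)),
            ∀ x, evalEven x η = ((-1) ^ j * ((j + 1).factorial : ℂ)) •
              (E.chernEven (k - j) x * E.chernCharacterEven (j + 1) x) := fun j _ ↦ by
        obtain ⟨η, hη, hηx⟩ := ih (k - j) (by omega)
        refine ⟨((-1) ^ j * ((j + 1).factorial : ℂ)) • (η * E.chForm (j + 1)),
          Subalgebra.smul_mem _ (mul_mem hη (Algebra.subset_adjoin ⟨j, rfl⟩)) _, fun x ↦ ?_⟩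
        rw [← hηx, ← evalEven_chForm]
        rfl
      choose! η hη hηx using h
      refine ⟨((k : ℂ) + 1)⁻¹ • ∑ j ∈ Finset.range (k + 1), η j,
        Subalgebra.smul_mem _ (sum_mem hη) _, fun x ↦ ?_⟩
      have hk : (k : ℂ) + 1 ≠ 0 := Nat.cast_add_one_ne_zero k
      rw [← inv_smul_smul₀ hk (E.chernEven (k + 1) x), E.newton_chernEven,
        (evalEven x).map_smul_of_tower, map_sum]
      exact congrArg _ (Finset.sum_congr rfl fun j hj ↦ hηx j hj x)

/-- The rank-reduced Chern character form. -/
def reducedCh (N : ℕ) : evenForms n M :=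
  ∑ j ∈ Finset.range N, E.chForm j - (E.rank : evenForms n M)

lemma sum_reducedCh {N s : ℕ} {k : Fin s → ℕ} {Λ : Finset ℝ} {F : ℝ → HermitianBundle n M}
    (h : ∀ x, ∑ t ∈ Λ, (t : ℂ) •
        (∑ j ∈ Finset.range N, (F t).chernCharacterEven j x - ((F t).rank : EvenExt n))
      = 2 * (∏ i, ∑ j ∈ Finset.range N, ((k i + 1 : ℕ) : ℂ) ^ j • E.chernCharacterEven j x
        - (E.rank : EvenExt n) ^ s)) :
    ∑ t ∈ Λ, (t : ℂ) • (F t).reducedCh N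
      = (2 : ℂ) • (∏ i, ∑ j ∈ Finset.range N, ((k i + 1 : ℕ) : ℂ) ^ j • E.chForm j
        - E.chForm 0 ^ s) := by
  refine evenForms_ext fun x ↦ ?_
  have h2 := h x
  rw [← map_ofNat (algebraMap ℂ (EvenExt n)) 2, ← Algebra.smul_def] at h2
  simpa only [chForm_zero, reducedCh, map_sum, map_prod, map_sub, map_pow, map_natCast,
    evalEven_chForm, (evalEven x).map_smul_of_tower] using h2

/-- If the pairings with the Chern characters of all realizations vanish, then so do the pairings
with the products of at most `s` components of the Chern character form. -/
lemma map_prod_chForm_eq_zero (f : evenForms n M →ₗ[ℂ] ℂ) {N s : ℕ} (hN : n < 2 * N)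
    (h : ∀ F : HermitianBundle n M, (E.IsBoundaryAdapted → F.IsBoundaryAdapted) →
      (∀ g, F.curvatureNorm g ≤ ((s * N : ℕ) : ℝ≥0) * E.curvatureNorm g) → f (F.reducedCh N) = 0)
    {J : Fin s → ℕ} (hJ : ∀ i, J i < N) (hJ0 : J ≠ 0) : f (∏ i, E.chForm (J i)) = 0 := by
  refine map_prod_eq_zero_of_vandermonde f E.chForm (fun k hk ↦ ?_) hJ hJ0
  obtain ⟨Λ, F, hb, hnorm, hF⟩ := E.exists_realization k
  refine map_eq_zero_of_sum_smul_eq f (E.sum_reducedCh fun x ↦ hF x N hN) fun t ↦ ?_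
  refine h _ (hb t) fun g ↦ (hnorm t g).trans (mul_le_mul_left ?_ _)
  -- The left side is the number of tensor factors, hence the curvature constant; each k i + 1 is at
  -- most N.
  have h4 : ∑ i, (k i + 1) ≤ s * N :=
    (Finset.sum_le_card_nsmul _ _ N fun i _ ↦ hk i).trans_eq (by simp)
  exact_mod_cast h4

end HermitianBundle

variable [CompactSpace M] [T2Space M] (o : ManifoldOrientation n M)

/-- Integration of even forms against a continuous mixed form. -/
def pairing (w : contForms n M) : evenForms n M →ₗ[ℂ] ℂ where
  toFun η := integral o (w * (EvenExt n).val.compLeft M η)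
  map_add' η θ := by
    rw [Subalgebra.coe_add, map_add, mul_add]
    exact integral_add o (mul_mem w.2 η.2) (mul_mem w.2 θ.2)
  map_smul' t η := by
    have h := integral_smul o t (w * (EvenExt n).val.compLeft M η)
    rw [← mul_smul_comm] at h
    exact h

lemma pairing_apply (w : contForms n M) (η : evenForms n M) :
    pairing o w η = integral o (w * (EvenExt n).val.compLeft M η) := rfl

end CharacteristicNumbers

/-! ### Comparison of the two cowaists -/

section Comparison

variable {m : ℕ} [NeZero m] {M : Type*} [TopologicalSpace M]
  [ChartedSpace (EuclideanHalfSpace (2 * m)) M] [IsManifold (𝓡∂ (2 * m)) ∞ M]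

lemma mixedForm_mem_contForms {w : ∀ j : ℕ, DiffForm (2 * m) (2 * j) M ℝ}
    (hw : ∀ j ∈ Finset.Icc 1 m, (w j).SmoothOn Set.univ) : mixedForm w ∈ contForms (2 * m) M := by
  have h : mixedForm w = 1 + ∑ j ∈ Finset.Icc 1 m, fun x ↦
      toExt (2 * j) (fun v : Fin (2 * j) → Model (2 * m) ↦ (w j x v : ℂ)) := by
    ext1 x
    simp [mixedForm]
  rw [h]
  exact add_mem (one_mem _) (sum_mem fun j hj ↦ (hw j hj).toExt_mem_contForms)

omit [IsManifold (𝓡∂ (2 * m)) ∞ M] in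
-- The components of ω of positive degree push a form of degree 2m above the top degree.
lemma topEval_mixedForm_mul (w : ∀ j : ℕ, DiffForm (2 * m) (2 * j) M ℝ) (x : M)
    {y : Ext (2 * m)} (hy : y ∈ ⋀[ℂ]^(2 * m) (Model (2 * m) →L[ℝ] ℂ))
    (v : Fin (2 * m) → Model (2 * m)) : topEval v (mixedForm w x * y) = topEval v y := by
  rw [mixedForm, add_mul, one_mul, map_add, add_eq_left, Finset.sum_mul, map_sum]
  refine Finset.sum_eq_zero fun j hj ↦ ?_
  have hj1 := (Finset.mem_Icc.1 hj).1
  refine topEval_eq_zero (d := 2 * j + 2 * m) (by omega) ?_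
  exact SetLike.GradedMul.mul_mem (A := fun d : ℕ ↦ ⋀[ℂ]^d (Model (2 * m) →L[ℝ] ℂ))
    (toExt_mem (2 * j) _) hy

lemma HermitianBundle.exists_prod_of_mem_closure (E : HermitianBundle (2 * m) M)
    {η : evenForms (2 * m) M}
    (hη : η ∈ Submonoid.closure (Set.range fun j ↦ E.chForm (j + 1))) :
    ∃ (s : ℕ) (J : Fin s → ℕ), (∀ i, 1 ≤ J i) ∧ η = ∏ i, E.chForm (J i) := by
  induction hη using Submonoid.closure_induction_left with
  | one => exact ⟨0, Fin.elim0, fun i ↦ i.elim0, by simp⟩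
  | mul_left y hy z _ ih =>
    obtain ⟨j, rfl⟩ := hy
    obtain ⟨s, J, hJ, rfl⟩ := ih
    refine ⟨s + 1, Fin.cons (j + 1) J, Fin.cases (by simp) fun i ↦ by simpa using hJ i, ?_⟩
    rw [Fin.prod_univ_succ]
    simp

variable [CompactSpace M] [T2Space M] (o : ManifoldOrientation (2 * m) M)

lemma pairing_one_eq_zero {d : ℕ} (hd : d ≠ m) {η : evenForms (2 * m) M}
    (hη : ∀ x, evalEven x η ∈ evenDeg (2 * m) d) : pairing o 1 η = 0 := by
  rw [pairing_apply]
  refine integral_eq_zero o (d := 2 * d) (by omega) fun x ↦ ?_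
  rw [OneMemClass.coe_one, one_mul]
  exact hη x

lemma pairing_mixedForm {w : ∀ j : ℕ, DiffForm (2 * m) (2 * j) M ℝ}
    (hw : mixedForm w ∈ contForms (2 * m) M) {η : evenForms (2 * m) M}
    (hη : ∀ x, evalEven x η ∈ evenDeg (2 * m) m) :
    pairing o ⟨mixedForm w, hw⟩ η = pairing o 1 η := by
  rw [pairing_apply, pairing_apply]
  refine integral_congr o fun x v ↦ ?_
  rw [OneMemClass.coe_one, one_mul]
  exact topEval_mixedForm_mul w x (hη x) v

namespace HermitianBundle

variable (E : HermitianBundle (2 * m) M)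

/-- If the pairings with the Chern characters of all realizations vanish, then so do all the Chern
numbers. -/
lemma pairing_one_adjoin_eq_zero {w : ∀ j : ℕ, DiffForm (2 * m) (2 * j) M ℝ}
    (hw : mixedForm w ∈ contForms (2 * m) M)
    (h : ∀ F : HermitianBundle (2 * m) M, (E.IsBoundaryAdapted → F.IsBoundaryAdapted) →
      (∀ g, F.curvatureNorm g ≤ ((m * (m + 1) : ℕ) : ℝ≥0) * E.curvatureNorm g) →
      pairing o ⟨mixedForm w, hw⟩ (F.reducedCh (m + 1)) = 0)
    {η : evenForms (2 * m) M}
    (hη : η ∈ Algebra.adjoin ℂ (Set.range fun j ↦ E.chForm (j + 1))) : pairing o 1 η = 0 := by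
  have hm : m ≠ 0 := NeZero.ne m
  rw [← Subalgebra.mem_toSubmodule, Algebra.adjoin_eq_span] at hη
  induction hη using Submodule.span_induction with
  | zero => exact map_zero _
  | add x y _ _ hx hy => rw [map_add, hx, hy, add_zero]
  | smul c x _ hx => rw [map_smul, hx, smul_zero]
  | mem η hη =>
    obtain ⟨s, J, hJ, rfl⟩ := E.exists_prod_of_mem_closure hη
    have hdeg : ∀ x, evalEven x (∏ i, E.chForm (J i)) ∈ evenDeg (2 * m) (∑ i, J i) := fun x ↦ by
      rw [map_prod]
      exact prod_mem_evenDeg J fun j ↦ E.chernCharacterEven_mem j x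
    by_cases hsum : ∑ i, J i = m
    · rw [hsum] at hdeg
      -- The product has top degree, so ω may be inserted. As every J i is at least 1, there are at
      -- most m factors, each of index at most m.
      rw [← pairing_mixedForm o hw hdeg]
      have hs : s ≤ m := by
        calc s = ∑ _i : Fin s, 1 := by simp
          _ ≤ ∑ i, J i := Finset.sum_le_sum fun i _ ↦ hJ i
          _ = m := hsum
      refine E.map_prod_chForm_eq_zero (N := m + 1) _ (by omega)
        (fun F hF hnorm ↦ h F hF fun g ↦ (hnorm g).trans (mul_le_mul_left ?_ _)) (fun i ↦ ?_) ?_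
      · exact_mod_cast Nat.mul_le_mul_right (m + 1) hs
      · exact Nat.lt_succ_of_le
          (hsum ▸ Finset.single_le_sum (fun i _ ↦ Nat.zero_le (J i)) (Finset.mem_univ i))
      · rintro rfl
        exact hm (by simpa using hsum.symm)
    · exact pairing_one_eq_zero o hsum hdeg

/-- By contradiction: if no realization within the curvature bound pairs nontrivially with ω,
integration kills the whole algebra generated by the ch_j with j ≥ 1. That algebra contains the
product of Chern forms with nonzero integral. -/
lemma exists_of_isAdmissible {w : ∀ j : ℕ, DiffForm (2 * m) (2 * j) M ℝ}
    (hw : ∀ j ∈ Finset.Icc 1 m, (w j).SmoothOn Set.univ) (hE : E.IsAdmissible o) :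
    ∃ F : HermitianBundle (2 * m) M, (F.IsBoundaryAdapted ∧ integral o (fun x ↦ mixedForm w x *
      (∑ j ∈ Finset.range (m + 1), F.chernCharacter j x - (F.rank : Ext (2 * m)))) ≠ 0) ∧
      ∀ g, F.curvatureNorm g ≤ ((m * (m + 1) : ℕ) : ℝ≥0) * E.curvatureNorm g := by
  by_contra! hcon
  obtain ⟨hb, γ, hγ⟩ := hE
  choose η hη hηx using E.exists_chernForm
  refine hγ ?_
  have h1 : pairing o 1 (∏ j, η (γ j)) = 0 := by
    refine E.pairing_one_adjoin_eq_zero o (mixedForm_mem_contForms hw) (fun F hF hnorm ↦ ?_)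
      (prod_mem fun j _ ↦ hη (γ j))
    have h0 : pairing o ⟨mixedForm w, mixedForm_mem_contForms hw⟩ (F.reducedCh (m + 1))
        = integral o (fun x ↦ mixedForm w x *
          (∑ j ∈ Finset.range (m + 1), F.chernCharacter j x - (F.rank : Ext (2 * m)))) := by
      rw [pairing_apply]
      congr 1
      ext1 x
      change mixedForm w x * (evalEven x (F.reducedCh (m + 1)) : Ext (2 * m)) = _
      congr 1
      simp only [reducedCh, map_sub, map_sum, map_natCast, evalEven_chForm,
        ← coe_chernCharacterEven]
      simp
    by_contra hne
    obtain ⟨g, hg⟩ := hcon F ⟨hF hb, h0 ▸ hne⟩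
    exact absurd (hnorm g) (not_le.2 hg)
  rw [← h1, pairing_apply]
  congr 1
  ext1 x
  rw [OneMemClass.coe_one, one_mul]
  change _ = (EvenExt (2 * m)).val (evalEven x (∏ j, η (γ j)))
  rw [map_prod, ← List.prod_ofFn, map_list_prod, List.map_ofFn]
  congr 2
  ext1 j
  rw [Function.comp_apply, hηx, ← coe_chernEven]
  rfl

end HermitianBundle

end Comparison

end KCowaist

end

/-! ### The comparison theorem -/

theorem theorem2p5 (m : ℕ) [NeZero m] :
    ∃ c : ℝ≥0, ∀ (M : Type*) [TopologicalSpace M] [ChartedSpace (EuclideanHalfSpace (2 * m)) M]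
      [IsManifold (𝓡∂ (2 * m)) ∞ M] [CompactSpace M] [T2Space M]
      (g : Bundle.ContMDiffRiemannianMetric (𝓡∂ (2 * m)) ∞ (EuclideanSpace ℝ (Fin (2 * m)))
        (fun x : M ↦ TangentSpace (𝓡∂ (2 * m)) x))
      (o : KCowaist.ManifoldOrientation (2 * m) M)
      (w : ∀ j : ℕ, KCowaist.DiffForm (2 * m) (2 * j) M ℝ),
      (∀ j ∈ Finset.Icc 1 m, (w j).SmoothOn Set.univ) →
        KCowaist.kCowaist g o ≤ c * KCowaist.omegaCowaist g o w := by
  -- At most m Adams operations are multiplied, each of order at most m + 1, so at most m(m + 1)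
  -- tensor factors occur.
  refine ⟨((m * (m + 1) : ℕ) : ℝ≥0), fun M _ _ _ _ _ g o w hw ↦ ?_⟩
  set c : ℝ≥0∞ := (((m * (m + 1) : ℕ) : ℝ≥0) : ℝ≥0∞) with hc
  -- That c is neither zero nor infinite allows c · c⁻¹ = 1 in [0, ∞], also when the curvature norm
  -- is 0 or ∞.
  have hc0 : c ≠ 0 := by
    have hm : m ≠ 0 := NeZero.ne m
    rw [hc]
    exact_mod_cast Nat.mul_ne_zero hm (Nat.succ_ne_zero m)
  have hct : c ≠ ⊤ := ENNReal.coe_ne_top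
  rw [KCowaist.kCowaist, KCowaist.omegaCowaist, ENNReal.inv_iInf]
  refine iSup_le fun E ↦ ?_
  rw [ENNReal.inv_iInf]
  refine iSup_le fun hE ↦ ?_
  obtain ⟨F, hF, hnorm⟩ := E.exists_of_isAdmissible o hw hE
  have h1 : (c * E.curvatureNorm g)⁻¹ ≤ _ := ENNReal.inv_le_inv.2
    ((iInf₂_le (f := fun (F : KCowaist.HermitianBundle (2 * m) M) (_ : F.IsBoundaryAdapted ∧
      KCowaist.integral o (fun x ↦ KCowaist.mixedForm w x *
      (∑ j ∈ Finset.range (m + 1), F.chernCharacter j x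
        - (F.rank : KCowaist.Ext (2 * m)))) ≠ 0) ↦ F.curvatureNorm g) F hF).trans (hnorm g))
  refine le_trans ?_ (mul_le_mul_right h1 c)
  rw [ENNReal.mul_inv (Or.inl hc0) (Or.inl hct), ← mul_assoc, ENNReal.mul_inv_cancel hc0 hct,
    one_mul]
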